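/- **Setting.** There are $K$ arms, a horizon $T$, and changepoints $1=\nu_0<\nu_1<\dots<\nu_{M-1}<\nu_M=T+1$, which divide $\{1,\dots,T\}$ into $M$ stationary segments $S_m=\{\nu_{m-1},\dots,\nu_m-1\}$. Segment $S_m$ has a preference matrix $P^{(m)}=(p^{(m)}_{i,j})\in[0,1]^{K\times K}$ with $p^{(m)}_{i,j}+p^{(m)}_{j,i}=1$ and a Condorcet winner $m^*$, that is, $p^{(m)}_{m^*,i}>\frac12$ for all $i\neq m^*$. If the pair $(i,j)$ is played at time $t\in S_m$, the outcome $X^{(t)}_{i,j}\sim\mathrm{Ber}(p^{(m)}_{i,j})$ is observed; all $X^{(t)}_{i,j}$ are mutually independent. With $\Delta^{(m)}_i=p^{(m)}_{m^*,i}-\frac12$, playing $(I_t,J_t)$ at time $t\in S_m$ costs the binary strong regret $\lceil(\Delta^{(m)}_{I_t}+\Delta^{(m)}_{J_t})/2\rceil$, and $R^{\bar{\mathrm S}}(T)$ is its sum over $t=1,\dots,T$. **Algorithm.** Monitored Dueling Bandits (MDB) has as parameters an even integer $w\ge 2$, a threshold $b>0$, a rate $\gamma\in(0,1]$, an ordering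 $O$ (counting from $0$) of the pairs $(i,j)$ with $i<j$, and a (possibly randomized) black-box dueling bandits algorithm $Alg$. Let $d=\lfloor K(K-1)/(2\gamma)\rfloor$. Initially $\tau=0$. At time $t$ let $r=(t-\tau-1)\bmod d$. If $r<K(K-1)/2$, MDB plays the $r$-th pair $(i,j)$ of $O$ and records the outcome as the next detection sample of this pair; if this pair now has at least $w$ samples since the last reset and, among its $w$ most recent ones, the numbers of wins in the older $w/2$ and in the newer $w/2$ differ by more than $b$, then the changepoint detection is triggered: $\tau$ is set to $t$, all detection samples are discarded, and $Alg$ is reset to its initial state. If $r\ge K(K-1)/2$, MDB plays the pair selected by $Alg$ and forwards the outcome to $Alg$. MDB initialized at time $s$ is the same procedure with first time step $s$ and initially $\tau=s-1$. **Assumptions.** Put $L=w\,d$ and $\delta^{(m)}=\max_{i,j}|p^{(m+1)}_{i,j}-p^{(m)}_{i,j}|$ for $1\le m\le M-1$. Suppose 1. $|S_m|\ge 2L$ for all $m\in\{1,\dots,M\}$; 2. there is $c>0$ with $\delta^{(m)}\ge\frac{2b}{w}+c$ for all $m\in\{1,\dots,M-1\}$; 3. $\gamma\in\left[\frac{K(K-1)}{2T},\frac{K-1}{2}\right]$.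 **Theorem 3.** Let $\tau_m$ be the first time step in $\{\nu_{m-1},\dots,T\}$ at which the changepoint detection is triggered when MDB is initialized at $\nu_{m-1}$ ($\tau_m=\infty$ if there is none). Let $p,q\in[0,1]$ be such that $\mathbb P(\tau_m<\nu_m)\le p$ for all $m\le M$ and $\mathbb P(\tau_m\ge\nu_m+L/2\mid\tau_m\ge\nu_m)\le q$ for all $m\le M-1$. Then the expected cumulative binary strong regret of MDB, initialized at time $1$, satisfies $$\mathbb E\big[R^{\bar{\mathrm S}}(T)\big]\le\frac{ML}{2}+2T\left(\frac{\gamma K}{K-1}+p+q\right)+\sum_{m=1}^{M}\mathbb E\big[\tilde R^{\bar{\mathrm S}}(\nu_{m-1},\nu_m-1)\big],$$ where $\tilde R^{\bar{\mathrm S}}(\nu_{m-1},\nu_m-1)$ is the cumulative binary strong regret that $Alg$ incurs when it is started in its initial state at time $\nu_{m-1}$ and run on its own until time $\nu_m-1$. -/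

import Mathlib

open MeasureTheory ProbabilityTheory

noncomputable section

/-- A non-stationary dueling bandits problem with arms `Fin K`, time steps `1, …, T` and `M`
stationary segments. Segments are indexed from `0`: segment `m : Fin M` consists of the time steps
`cp m.castSucc, …, cp m.succ - 1`, where `cp 0 = 1` and `cp M = T + 1` are the dummy changepoints.
In segment `m`, arm `i` wins against arm `j` with probability `P m i j`, and `best m` is the
Condorcet winner. -/
structure DuelingProblem (K T M : ℕ) where
  cp : Fin (M + 1) → ℕ
  cp_strictMono : StrictMono cp
  cp_zero : cp 0 = 1
  cp_last : cp (Fin.last M) = T + 1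
  P : Fin M → Matrix (Fin K) (Fin K) ℝ
  P_mem : ∀ m i j, P m i j ∈ Set.Icc (0 : ℝ) 1
  P_add : ∀ m i j, P m i j + P m j i = 1
  best : Fin M → Fin K
  best_wins : ∀ m i, i ≠ best m → 1 / 2 < P m (best m) i

namespace DuelingProblem

variable {K T M : ℕ} (E : DuelingProblem K T M)

/-- The time steps of the `m`-th stationary segment. -/
def segment (m : Fin M) : Finset ℕ := Finset.Ico (E.cp m.castSucc) (E.cp m.succ)

/-- The suboptimality gap of arm `i` in segment `m`. -/
def gap (m : Fin M) (i : Fin K) : ℝ := E.P m (E.best m) i - 1 / 2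

/-- The instantaneous strong regret of a pair of arms in segment `m`. -/
def strongRegret (m : Fin M) (a : Fin K × Fin K) : ℝ := (E.gap m a.1 + E.gap m a.2) / 2

/-- The instantaneous binary strong regret of a pair of arms in segment `m`. -/
def binaryStrongRegret (m : Fin M) (a : Fin K × Fin K) : ℝ := (⌈E.strongRegret m a⌉ : ℝ)

/-- The segmental change at the changepoint between the segments `m` and `m + 1`: the largest
absolute change of an entry of the preference matrix. -/
def change (m : Fin M) (h : (m : ℕ) + 1 < M) : ℝ :=
  ⨆ ij : Fin K × Fin K, |E.P ⟨m + 1, h⟩ ij.1 ij.2 - E.P m ij.1 ij.2|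

end DuelingProblem

/-- A (possibly randomized) black-box dueling bandits algorithm. In each of its time steps it
receives a fresh random seed, selects a pair of arms from its internal state and the seed, and,
after the outcome of the duel is forwarded to it, updates its internal state. -/
structure DuelingAlg (K : ℕ) (St Sd : Type*) [MeasurableSpace St] [MeasurableSpace Sd] where
  init : St
  select : St → Sd → Fin K × Fin K
  update : St → Sd → Bool → St
  measurable_select : Measurable (fun z : St × Sd => select z.1 z.2)
  measurable_update : Measurable (fun z : St × Sd × Bool => update z.1 z.2.1 z.2.2)

/-- The random experiment: `X t i j` is the outcome of a duel between `i` and `j` at time `t`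
(`true` if `i` wins), Bernoulli distributed with the parameter of the segment that contains `t`;
`ξ t` is the seed available to the black-box algorithm at time `t`. All outcomes and all seeds are
mutually independent, and the seeds are identically distributed. -/
structure DuelingProblem.IsExperiment {K T M : ℕ} (E : DuelingProblem K T M) {Ω Sd : Type*}
    [MeasurableSpace Ω] [MeasurableSpace Sd] (μ : Measure Ω)
    (X : ℕ → Fin K → Fin K → Ω → Bool) (ξ : ℕ → Ω → Sd) : Prop where
  measurable_outcome : ∀ t i j, Measurable (X t i j)
  measurable_seed : ∀ t, Measurable (ξ t)
  bernoulli : ∀ m, ∀ t ∈ E.segment m, ∀ i j, μ.real {ω | X t i j ω = true} = E.P m i j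
  indep_outcomes :
    iIndepFun (fun (c : Finset.Icc 1 T × Fin K × Fin K) => X c.1 c.2.1 c.2.2) μ
  indep_seeds : iIndepFun (fun (t : Finset.Icc 1 T) => ξ t) μ
  indep : IndepFun
    (fun ω (c : Finset.Icc 1 T × Fin K × Fin K) => X c.1 c.2.1 c.2.2 ω)
    (fun ω (t : Finset.Icc 1 T) => ξ t ω) μ
  identDistrib : ∀ s ∈ Finset.Icc 1 T, ∀ t ∈ Finset.Icc 1 T, IdentDistrib (ξ s) (ξ t) μ μ

/-! ### The black-box algorithm on its own -/

namespace DuelingAlg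

variable {K : ℕ} {St Sd : Type*} [MeasurableSpace St] [MeasurableSpace Sd] (A : DuelingAlg K St Sd)

/-- The internal state after `k` time steps when the algorithm is started at time `t₀` on its own,
with outcomes `x` and seeds `u`. -/
def stateFrom (x : ℕ → Fin K → Fin K → Bool) (u : ℕ → Sd) (t₀ : ℕ) : ℕ → St
  | 0 => A.init
  | k + 1 =>
    let s := stateFrom x u t₀ k
    let a := A.select s (u (t₀ + k))
    A.update s (u (t₀ + k)) (x (t₀ + k) a.1 a.2)

/-- The pair played at time `t ≥ t₀` when the algorithm is started at time `t₀` on its own. -/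
def played (x : ℕ → Fin K → Fin K → Bool) (u : ℕ → Sd) (t₀ t : ℕ) : Fin K × Fin K :=
  A.select (A.stateFrom x u t₀ (t - t₀)) (u t)

/-- The binary strong regret of the algorithm when run on its own during segment `m`, started at
the first time step of the segment. -/
def regretAlone {T M : ℕ} (E : DuelingProblem K T M)
    (x : ℕ → Fin K → Fin K → Bool) (u : ℕ → Sd) (m : Fin M) : ℝ :=
  ∑ t ∈ E.segment m, E.binaryStrongRegret m (A.played x u (E.cp m.castSucc) t)

end DuelingAlg

/-! ### Monitored Dueling Bandits -/

/-- The pairs of distinct arms, each counted once. -/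
abbrev DistinctPair (K : ℕ) : Type := {a : Fin K × Fin K // a.1 < a.2}

/-- Monitored Dueling Bandits, given by a window length `w`, a threshold `b`, an exploration rate
`γ`, an ordering of the pairs of distinct arms (counting from `0`), and a black-box algorithm. -/
structure MDB (K : ℕ) (St Sd : Type*) [MeasurableSpace St] [MeasurableSpace Sd] where
  w : ℕ
  b : ℝ
  γ : ℝ
  order : Fin (K * (K - 1) / 2) ≃ DistinctPair K
  alg : DuelingAlg K St Sd

/-- The memory of Monitored Dueling Bandits: the time `tau` of the last reset, the number `n a` of
detection samples of the pair `a` since then, the samples `obs a 1, …, obs a (n a)`, and the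
internal state of the black-box algorithm. -/
structure MDBState (K : ℕ) (St : Type*) where
  tau : ℕ
  n : DistinctPair K → ℕ
  obs : DistinctPair K → ℕ → Bool
  inner : St

namespace MDBState

variable {K : ℕ} {St : Type*}

/-- Append an outcome to the detection samples of the pair `a`. -/
def record (s : MDBState K St) (a : DistinctPair K) (o : Bool) : MDBState K St :=
  { s with
    n := Function.update s.n a (s.n a + 1)
    obs := Function.update s.obs a (Function.update (s.obs a) (s.n a + 1) o) }

/-- The number of wins among the samples of the pair `a` with index in `{k, …, l}`. -/
def wins (s : MDBState K St) (a : DistinctPair K) (k l : ℕ) : ℝ :=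
  ∑ r ∈ Finset.Icc k l, if s.obs a r = true then (1 : ℝ) else 0

/-- The detection window (of even length `w`) of the pair `a` is filled, and the numbers of wins in
its two halves differ by more than `b`. -/
def windowExceeds (s : MDBState K St) (w : ℕ) (b : ℝ) (a : DistinctPair K) : Prop :=
  w ≤ s.n a ∧
    b < |s.wins a (s.n a - w + 1) (s.n a - w / 2) - s.wins a (s.n a - w / 2 + 1) (s.n a)|

end MDBState

namespace MDB

variable {K : ℕ} {St Sd : Type*} [MeasurableSpace St] [MeasurableSpace Sd] (D : MDB K St Sd)

/-- The distance between two consecutive detection phases, `⌊K (K - 1) / (2 γ)⌋`. -/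
def period : ℕ := ⌊(K : ℝ) * ((K : ℝ) - 1) / (2 * D.γ)⌋₊

/-- The number `L` of time steps needed to fill all detection windows. -/
def L : ℕ := D.w * D.period

/-- The memory of MDB right after initialization such that time step `tau + 1` is the next one. -/
def fresh (tau : ℕ) : MDBState K St where
  tau := tau
  n := fun _ => 0
  obs := fun _ _ => false
  inner := D.alg.init

/-- The pair to be explored in a detection step at time `t`; `none` if the black-box algorithm is to
be run at time `t`. -/
def detectionPair (t : ℕ) (s : MDBState K St) : Option (DistinctPair K) :=
  if h : (t - s.tau - 1) % D.period < K * (K - 1) / 2 then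
    some (D.order ⟨(t - s.tau - 1) % D.period, h⟩)
  else none

/-- The pair of arms played at time `t` with seed `u`. -/
def pair (t : ℕ) (u : Sd) (s : MDBState K St) : Fin K × Fin K :=
  match D.detectionPair t s with
  | some a => a.1
  | none => D.alg.select s.inner u

/-- The changepoint detection is triggered at time `t` when the outcomes at time `t` are `x`. -/
def triggers (t : ℕ) (x : Fin K → Fin K → Bool) (s : MDBState K St) : Prop :=
  ∃ a, D.detectionPair t s = some a ∧
    (s.record a (x a.1.1 a.1.2)).windowExceeds D.w D.b a

open Classical in
/-- The memory of MDB after time step `t` with outcomes `x` and seed `u`. -/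
def next (t : ℕ) (x : Fin K → Fin K → Bool) (u : Sd) (s : MDBState K St) : MDBState K St :=
  if D.triggers t x s then D.fresh t
  else
    match D.detectionPair t s with
    | some a => s.record a (x a.1.1 a.1.2)
    | none =>
      { s with
        inner := D.alg.update s.inner u
          (x (D.alg.select s.inner u).1 (D.alg.select s.inner u).2) }

/-- The memory after `k` time steps when MDB is initialized at time `t₀`, that is, with `t₀` as its
first time step, for outcomes `x` and seeds `u`. -/
def stateFrom (x : ℕ → Fin K → Fin K → Bool) (u : ℕ → Sd) (t₀ : ℕ) : ℕ → MDBState K St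
  | 0 => D.fresh (t₀ - 1)
  | k + 1 => D.next (t₀ + k) (x (t₀ + k)) (u (t₀ + k)) (stateFrom x u t₀ k)

/-- The pair played at time `t ≥ t₀` when MDB is initialized at time `t₀`. -/
def played (x : ℕ → Fin K → Fin K → Bool) (u : ℕ → Sd) (t₀ t : ℕ) : Fin K × Fin K :=
  D.pair t (u t) (D.stateFrom x u t₀ (t - t₀))

/-- The first time step in `{t₀, …, T}` at which the changepoint detection is triggered when MDB is
initialized at time `t₀`; `⊤` if there is none. -/
def firstDetection (T : ℕ) (x : ℕ → Fin K → Fin K → Bool) (u : ℕ → Sd) (t₀ : ℕ) : ℕ∞ :=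
  ⨅ t ∈ {t : ℕ | t₀ ≤ t ∧ t ≤ T ∧ D.triggers t (x t) (D.stateFrom x u t₀ (t - t₀))}, (t : ℕ∞)

/-- The cumulative binary strong regret of MDB over all time steps `1, …, T`. -/
def regret {T M : ℕ} (E : DuelingProblem K T M)
    (x : ℕ → Fin K → Fin K → Bool) (u : ℕ → Sd) : ℝ :=
  ∑ m, ∑ t ∈ E.segment m, E.binaryStrongRegret m (D.played x u 1 t)

end MDB

end

/-
Whether MDB triggers at time `t` depends only on the time `s` of its last reset and on the table of
outcomes, and the reset time depends only on outcomes up to `s`, hence not on the later samples.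
Within a segment these are i.i.d., so shifting the sampling times pair by pair, keeping the number
of samples on either side of the changepoint, compares the detection after a reset at `s` with that
of MDB initialized at the start of the segment. A reset that leaves at least `L` time steps of a
segment is therefore followed by a false or late alarm with probability at most `p + q (1 - p)`.
If a changepoint is missed, the old sampling pattern continues in the next segment; conditioning on
the last reset and proceeding from segment to segment bounds the probability that the detection
fails in a segment by `2 (p + q)`.

On failure the regret of a segment is at most its length. Otherwise the algorithm is reset for the
last time within the first `L / 2` time steps of the segment, and the later regret splits into the
exploration steps, a fraction of at most `2 γ K / (K - 1)` of the segment, and the steps of the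
black box. The data of the latter are independent of the reset and distributed as those of
consecutive time steps, so their expected regret is at most that of the black box run on its own for
the whole segment.
-/

noncomputable section

/-- The index `(t, i, j)` of the outcome of a duel between the arms `i` and `j` at time `t`. -/
abbrev DuelIndex (K : ℕ) : Type := ℕ × Fin K × Fin K

/-- The outcomes of all duels as a single family, so that independence and dependence can be
expressed by sets of indices. -/
def outcomeTable {K : ℕ} (x : ℕ → Fin K → Fin K → Bool) : DuelIndex K → Bool :=
  fun c => x c.1 c.2.1 c.2.2

lemma count_mod_eq_of_mod_eq {l d i : ℕ} (hi : i < d) (h : l % d = i) :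
    Nat.count (fun j => j % d = i) l = l / d := by
  have := Nat.count_modEq_card l (by omega : 0 < d) i
  simpa only [Nat.ModEq, Nat.mod_eq_of_lt hi, h, lt_irrefl, if_false, add_zero] using this

/-! ### The detection mechanism as a function of the outcomes -/

namespace MDB

variable {K : ℕ} {St Sd : Type*} [MeasurableSpace St] [MeasurableSpace Sd] (D : MDB K St Sd)

/-- The position of the pair `a` in the ordering. -/
def idx (a : DistinctPair K) : ℕ := (D.order.symm a : ℕ)

/-- The number of wins of the pair `a` at the times `t - k d`, where `d` is the period and `k` runs
through a given set of lags. -/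
def lagWins (x : DuelIndex K → Bool) (a : DistinctPair K) (t : ℕ) (lags : Finset ℕ) : ℝ :=
  ∑ k ∈ lags, if x (t - k * D.period, a.1) = true then (1 : ℝ) else 0

/-- The numbers of wins of the pair `a` in the two halves of its detection window, when the window
consists of the outcomes at the times `t, t - d, …, t - (w - 1) d`, differ by more than `b`. -/
def Exceeds (x : DuelIndex K → Bool) (a : DistinctPair K) (t : ℕ) : Prop :=
  D.b < |D.lagWins x a t (Finset.Ico (D.w / 2) D.w) - D.lagWins x a t (Finset.range (D.w / 2))|

/-- The detection triggers at time `t` if the last reset was at time `s`. -/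
def AlarmAt (x : DuelIndex K → Bool) (s t : ℕ) : Prop :=
  ∃ a, s + 1 + (D.w - 1) * D.period ≤ t ∧ (t - s - 1) % D.period = D.idx a ∧ D.Exceeds x a t

/-- With detection phases aligned to a reset at time `s`, some detection window contained in
`{u, …, v - 1}` exceeds the threshold. -/
def Alarm (x : DuelIndex K → Bool) (s u v : ℕ) : Prop :=
  ∃ a t, u + (D.w - 1) * D.period ≤ t ∧ t < v ∧ (t - s - 1) % D.period = D.idx a ∧ D.Exceeds x a t

open Classical in
/-- The time of the last reset before time `t`, when the algorithm is initialized at time `1`. -/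
def lastReset (x : DuelIndex K → Bool) : ℕ → ℕ
  | 0 => 0
  | t + 1 => if D.AlarmAt x (lastReset x t) t then t else lastReset x t

/-- The memory `s` before time `t` reflects the outcomes `x` since the last reset: the pair `a` has
been sampled at those times after `s.tau` whose phase is `D.idx a`. -/
structure Tracks (x : ℕ → Fin K → Fin K → Bool) (t : ℕ) (s : MDBState K St) : Prop where
  lt : s.tau < t
  n_eq : ∀ a, s.n a = Nat.count (fun j => j % D.period = D.idx a) (t - s.tau - 1)
  obs_eq : ∀ a k, k < s.n a →
    s.obs a (k + 1) = x (s.tau + 1 + D.idx a + k * D.period) a.1.1 a.1.2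

variable {D}

lemma idx_lt (a : DistinctPair K) : D.idx a < K * (K - 1) / 2 := (D.order.symm a).2

lemma idx_injective : Function.Injective D.idx :=
  Fin.val_injective.comp D.order.symm.injective

lemma detectionPair_eq_some {t : ℕ} {s : MDBState K St} {a : DistinctPair K} :
    D.detectionPair t s = some a ↔ (t - s.tau - 1) % D.period = D.idx a := by
  unfold detectionPair idx
  split_ifs with h
  · rw [Option.some.injEq, ← Equiv.eq_symm_apply, Fin.ext_iff]
  · simp only [false_iff]
    exact fun h' => h (h' ▸ (D.order.symm a).2)

lemma detectionPair_eq_none {t : ℕ} {s : MDBState K St} :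
    D.detectionPair t s = none ↔ ¬ (t - s.tau - 1) % D.period < K * (K - 1) / 2 := by
  unfold detectionPair
  split_ifs with h <;> simp [h]

lemma tracks_fresh (x : ℕ → Fin K → Fin K → Bool) (t : ℕ) : D.Tracks x (t + 1) (D.fresh t) where
  lt := Nat.lt_succ_self t
  n_eq a := by simp [fresh]
  obs_eq a k hk := by simp [fresh] at hk

lemma Tracks.n_eq_div {x : ℕ → Fin K → Fin K → Bool} {t : ℕ} {s : MDBState K St}
    (h : D.Tracks x t s) {a : DistinctPair K} (hd : D.idx a < D.period)
    (ha : (t - s.tau - 1) % D.period = D.idx a) : s.n a = (t - s.tau - 1) / D.period := by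
  rw [h.n_eq, count_mod_eq_of_mod_eq hd ha]

lemma Tracks.time_eq {x : ℕ → Fin K → Fin K → Bool} {t : ℕ} {s : MDBState K St}
    (h : D.Tracks x t s) {a : DistinctPair K} (hd : D.idx a < D.period)
    (ha : (t - s.tau - 1) % D.period = D.idx a) :
    s.tau + 1 + D.idx a + s.n a * D.period = t := by
  have hdiv := Nat.mod_add_div (t - s.tau - 1) D.period
  rw [ha, mul_comm, ← h.n_eq_div hd ha] at hdiv
  have := h.lt
  omega

lemma Tracks.record {x : ℕ → Fin K → Fin K → Bool} {t : ℕ} {s : MDBState K St}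
    (h : D.Tracks x t s) {a : DistinctPair K} (hd : D.idx a < D.period)
    (ha : (t - s.tau - 1) % D.period = D.idx a) :
    D.Tracks x (t + 1) (s.record a (x t a.1.1 a.1.2)) where
  lt := Nat.lt_succ_of_lt h.lt
  n_eq c := by
    have htau : t + 1 - s.tau - 1 = t - s.tau - 1 + 1 := by have := h.lt; omega
    change Function.update s.n a (s.n a + 1) c = Nat.count _ (t + 1 - s.tau - 1)
    rw [htau, Nat.count_succ, ← h.n_eq c]
    rcases eq_or_ne c a with rfl | hc
    · simp [ha]
    · simp [ha, hc, idx_injective.ne hc.symm]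
  obs_eq c k hk := by
    rcases eq_or_ne c a with rfl | hc
    · simp only [MDBState.record, Function.update_self] at hk ⊢
      rcases eq_or_ne k (s.n c) with rfl | hk'
      · rw [Function.update_self, h.time_eq hd ha]
      · rw [Function.update_of_ne (by omega)]
        exact h.obs_eq c k (by omega)
    · simp only [MDBState.record, Function.update_of_ne hc] at hk ⊢
      exact h.obs_eq c k hk

lemma Tracks.next (hd : K * (K - 1) / 2 ≤ D.period) {x : ℕ → Fin K → Fin K → Bool} {t : ℕ}
    (u : Sd) {s : MDBState K St} (h : D.Tracks x t s) :
    D.Tracks x (t + 1) (D.next t (x t) u s) := by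
  unfold MDB.next
  split_ifs with htr
  · exact tracks_fresh x t
  · rcases hp : D.detectionPair t s with _ | a
    · rw [detectionPair_eq_none] at hp
      refine ⟨Nat.lt_succ_of_lt h.lt, fun c => ?_, h.obs_eq⟩
      have htau : t + 1 - s.tau - 1 = t - s.tau - 1 + 1 := by have := h.lt; omega
      have hc := D.idx_lt c
      simp only [htau, Nat.count_succ]
      rw [if_neg (by omega), add_zero, h.n_eq]
    · exact h.record ((D.idx_lt a).trans_le hd) (detectionPair_eq_some.1 hp)

lemma tracks_stateFrom (hd : K * (K - 1) / 2 ≤ D.period) (x : ℕ → Fin K → Fin K → Bool)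
    (u : ℕ → Sd) {t₀ : ℕ} (ht₀ : 0 < t₀) (k : ℕ) :
    D.Tracks x (t₀ + k) (D.stateFrom x u t₀ k) := by
  induction k with
  | zero =>
    have := tracks_fresh (D := D) x (t₀ - 1)
    rwa [Nat.sub_add_cancel ht₀] at this
  | succ k ih => exact ih.next hd (u (t₀ + k))

lemma Tracks.obs_sub {x : ℕ → Fin K → Fin K → Bool} {t : ℕ} {s : MDBState K St}
    (h : D.Tracks x (t + 1) s) {a : DistinctPair K}
    (ht : s.tau + 1 + D.idx a + (s.n a - 1) * D.period = t) {k : ℕ} (hk : k < s.n a) :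
    s.obs a (s.n a - k) = outcomeTable x (t - k * D.period, a.1) := by
  have hobs := h.obs_eq a (s.n a - 1 - k) (by omega)
  have hmul : (s.n a - 1 - k) * D.period + k * D.period = (s.n a - 1) * D.period := by
    rw [← add_mul, Nat.sub_add_cancel (by omega)]
  rw [show s.n a - 1 - k + 1 = s.n a - k by omega,
    show s.tau + 1 + D.idx a + (s.n a - 1 - k) * D.period = t - k * D.period by omega] at hobs
  exact hobs

lemma Tracks.wins_eq_lagWins {x : ℕ → Fin K → Fin K → Bool} {t : ℕ} {s : MDBState K St}
    (h : D.Tracks x (t + 1) s) {a : DistinctPair K}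
    (ht : s.tau + 1 + D.idx a + (s.n a - 1) * D.period = t) {l m : ℕ} (hlm : l ≤ m)
    (hm : m ≤ s.n a) :
    s.wins a (s.n a - m + 1) (s.n a - l) = D.lagWins (outcomeTable x) a t (Finset.Ico l m) := by
  refine Finset.sum_nbij' (fun r => s.n a - r) (fun k => s.n a - k) ?_ ?_ ?_ ?_ fun r hr => ?_
  any_goals
    intro r hr
    simp only [Finset.mem_Icc, Finset.mem_Ico] at hr ⊢
    omega
  rw [Finset.mem_Icc] at hr
  rw [← h.obs_sub ht (by omega), Nat.sub_sub_self (by omega)]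

lemma Tracks.windowExceeds_record_iff (hw : 0 < D.w) {x : ℕ → Fin K → Fin K → Bool} {t : ℕ}
    {s : MDBState K St} (h : D.Tracks x t s) {a : DistinctPair K} (hd : D.idx a < D.period)
    (ha : (t - s.tau - 1) % D.period = D.idx a) :
    (s.record a (x t a.1.1 a.1.2)).windowExceeds D.w D.b a ↔
      s.tau + 1 + (D.w - 1) * D.period ≤ t ∧ D.Exceeds (outcomeTable x) a t := by
  have hs' := h.record hd ha
  set s' := s.record a (x t a.1.1 a.1.2)
  have hn : s'.n a = s.n a + 1 := Function.update_self ..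
  have ht : s'.tau + 1 + D.idx a + (s'.n a - 1) * D.period = t := by
    rw [hn, Nat.add_sub_cancel]
    exact h.time_eq hd ha
  have hle : D.w ≤ s'.n a ↔ s.tau + 1 + (D.w - 1) * D.period ≤ t := by
    have h1 : D.w ≤ s'.n a ↔ D.w - 1 ≤ (t - s.tau - 1) / D.period := by
      rw [hn, h.n_eq_div hd ha]
      omega
    rw [h1, Nat.le_div_iff_mul_le (by omega)]
    have := h.lt
    omega
  unfold MDBState.windowExceeds Exceeds
  rw [← hle]
  refine and_congr_right fun hwn => ?_
  have h_old := hs'.wins_eq_lagWins ht (Nat.div_le_self D.w 2) hwn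
  have h_new := hs'.wins_eq_lagWins ht (Nat.zero_le (D.w / 2)) (by omega)
  rw [Nat.sub_zero, Nat.Ico_zero_eq_range] at h_new
  rw [h_old, h_new]

lemma Tracks.triggers_iff (hd : K * (K - 1) / 2 ≤ D.period) (hw : 0 < D.w)
    {x : ℕ → Fin K → Fin K → Bool} {t : ℕ} {s : MDBState K St} (h : D.Tracks x t s) :
    D.triggers t (x t) s ↔ D.AlarmAt (outcomeTable x) s.tau t := by
  refine exists_congr fun a => ?_
  rw [detectionPair_eq_some, and_left_comm]
  refine and_congr_right fun ha => ?_
  exact h.windowExceeds_record_iff hw ((D.idx_lt a).trans_le hd) ha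

lemma next_tau (t : ℕ) (x : Fin K → Fin K → Bool) (u : Sd) (s : MDBState K St)
    [Decidable (D.triggers t x s)] :
    (D.next t x u s).tau = if D.triggers t x s then t else s.tau := by
  unfold MDB.next
  split_ifs
  · rfl
  · rcases D.detectionPair t s with _ | a <;> rfl

lemma tau_stateFrom (hd : K * (K - 1) / 2 ≤ D.period) (hw : 0 < D.w)
    (x : ℕ → Fin K → Fin K → Bool) (u : ℕ → Sd) (k : ℕ) :
    (D.stateFrom x u 1 k).tau = D.lastReset (outcomeTable x) (1 + k) := by
  classical
  induction k with
  | zero =>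
    have : ¬ D.AlarmAt (outcomeTable x) 0 0 := fun ⟨a, h, _⟩ => by omega
    simp [stateFrom, fresh, lastReset, this]
  | succ k ih =>
    have htr := (tracks_stateFrom (D := D) hd x u one_pos k).triggers_iff hd hw
    rw [ih] at htr
    change (D.next _ _ _ _).tau = _
    rw [next_tau, ← Nat.add_assoc 1 k 1]
    simp only [htr, ih, lastReset]

lemma tau_stateFrom_of_forall_not_triggers {x : ℕ → Fin K → Fin K → Bool} {u : ℕ → Sd}
    {t₀ k : ℕ}
    (h : ∀ j < k, ¬ D.triggers (t₀ + j) (x (t₀ + j)) (D.stateFrom x u t₀ j)) :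
    (D.stateFrom x u t₀ k).tau = t₀ - 1 := by
  classical
  induction k with
  | zero => rfl
  | succ k ih =>
    change (D.next _ _ _ _).tau = _
    rw [next_tau, if_neg (h k (Nat.lt_succ_self k)), ih fun j hj => h j (by omega)]

lemma firstDetection_lt_iff_exists_triggers {x : ℕ → Fin K → Fin K → Bool} {u : ℕ → Sd}
    {T t₀ v : ℕ} (hv : v ≤ T + 1) :
    D.firstDetection T x u t₀ < (v : ℕ∞) ↔
      ∃ k, t₀ + k < v ∧ D.triggers (t₀ + k) (x (t₀ + k)) (D.stateFrom x u t₀ k) := by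
  simp only [firstDetection, iInf_lt_iff, Set.mem_ofPred_eq, Nat.cast_lt]
  constructor
  · rintro ⟨t, ⟨h1, -, htr⟩, hlt⟩
    refine ⟨t - t₀, by omega, ?_⟩
    rwa [Nat.add_sub_cancel' h1]
  · rintro ⟨k, hlt, htr⟩
    refine ⟨t₀ + k, ⟨by omega, by omega, ?_⟩, hlt⟩
    rwa [Nat.add_sub_cancel_left]

lemma firstDetection_lt_iff (hd : K * (K - 1) / 2 ≤ D.period) (hw : 0 < D.w)
    (x : ℕ → Fin K → Fin K → Bool) (u : ℕ → Sd) {T t₀ v : ℕ} (ht₀ : 0 < t₀) (hv : v ≤ T + 1) :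
    D.firstDetection T x u t₀ < (v : ℕ∞) ↔ D.Alarm (outcomeTable x) (t₀ - 1) t₀ v := by
  classical
  have triggers_iff : ∀ k, (∀ j < k, ¬ D.triggers (t₀ + j) (x (t₀ + j)) (D.stateFrom x u t₀ j)) →
      (D.triggers (t₀ + k) (x (t₀ + k)) (D.stateFrom x u t₀ k) ↔
        D.AlarmAt (outcomeTable x) (t₀ - 1) (t₀ + k)) := fun k hk => by
    rw [(tracks_stateFrom hd x u ht₀ k).triggers_iff hd hw, tau_stateFrom_of_forall_not_triggers hk]
  rw [firstDetection_lt_iff_exists_triggers hv]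
  constructor
  · intro h
    obtain ⟨hlt, htr⟩ := Nat.find_spec h
    rw [triggers_iff _ fun j hj hj' => Nat.find_min h hj ⟨by omega, hj'⟩] at htr
    obtain ⟨a, hwin, ha⟩ := htr
    exact ⟨a, _, by omega, hlt, ha⟩
  · rintro ⟨a, t, hwin, htv, ha⟩
    by_contra! hno
    refine hno (t - t₀) (by omega) ((triggers_iff _ fun j hj => hno j (by omega)).2 ?_)
    rw [Nat.add_sub_cancel' (by omega)]
    exact ⟨a, by omega, ha⟩

end MDB

/-! ### Dependence of the detections on the outcomes -/

section DependsOn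

variable {ι : Type*} {α : ι → Type*} {C : Set ι} {A B : (∀ i, α i) → Prop}

lemma dependsOn_and (hA : DependsOn A C) (hB : DependsOn B C) :
    DependsOn (fun x => A x ∧ B x) C :=
  fun _ _ hxy => congrArg₂ And (hA hxy) (hB hxy)

lemma dependsOn_or (hA : DependsOn A C) (hB : DependsOn B C) :
    DependsOn (fun x => A x ∨ B x) C :=
  fun _ _ hxy => congrArg₂ Or (hA hxy) (hB hxy)

lemma dependsOn_not (hA : DependsOn A C) : DependsOn (fun x => ¬ A x) C :=
  fun _ _ hxy => congrArg Not (hA hxy)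

lemma dependsOn_exists {κ : Sort*} {A : κ → (∀ i, α i) → Prop} (h : ∀ k, DependsOn (A k) C) :
    DependsOn (fun x => ∃ k, A k x) C :=
  fun _ _ hxy => congrArg Exists (funext fun k => h k hxy)

lemma dependsOn_and_left {p : Prop} (h : p → DependsOn A C) : DependsOn (fun x => p ∧ A x) C :=
  fun _ _ hxy => propext (and_congr_right fun hp => (h hp hxy).to_iff)

end DependsOn

/-- The indices of the outcomes at the time steps `u, …, v - 1`. -/
def timeBlock (K u v : ℕ) : Set (DuelIndex K) := {c | u ≤ c.1 ∧ c.1 < v}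

lemma timeBlock_mono {K u v u' v' : ℕ} (hu : u' ≤ u) (hv : v ≤ v') :
    timeBlock K u v ⊆ timeBlock K u' v' :=
  fun _ hc => ⟨hu.trans hc.1, hc.2.trans_le hv⟩

lemma sub_mul_sub_mod {t s k d : ℕ} (h : s + 1 + k * d ≤ t) :
    (t - k * d - s - 1) % d = (t - s - 1) % d := by
  rw [show t - s - 1 = t - k * d - s - 1 + k * d by omega, Nat.add_mul_mod_self_right]

namespace MDB

variable {K : ℕ} {St Sd : Type*} [MeasurableSpace St] [MeasurableSpace Sd]

/-- The indices of the detection samples taken at the times `u, …, v - 1` when the detection phases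
are aligned to a reset at time `s`. -/
def sampleBlock (D : MDB K St Sd) (s u v : ℕ) : Set (DuelIndex K) :=
  {c | u ≤ c.1 ∧ c.1 < v ∧
    ∃ a : DistinctPair K, a.1 = c.2 ∧ (c.1 - s - 1) % D.period = D.idx a}

variable {D : MDB K St Sd} {x y : DuelIndex K → Bool}

lemma sampleBlock_subset (s u v : ℕ) : D.sampleBlock s u v ⊆ timeBlock K u v :=
  fun _ hc => ⟨hc.1, hc.2.1⟩

lemma sampleBlock_mono {s u v u' v' : ℕ} (hu : u' ≤ u) (hv : v ≤ v') :
    D.sampleBlock s u v ⊆ D.sampleBlock s u' v' :=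
  fun _ hc => ⟨hu.trans hc.1, hc.2.1.trans_le hv, hc.2.2⟩

lemma alarm_succ_iff {s v : ℕ} : D.Alarm x s (s + 1) v ↔ ∃ t < v, D.AlarmAt x s t := by
  constructor
  · rintro ⟨a, t, hwin, htv, ha⟩
    exact ⟨t, htv, a, hwin, ha⟩
  · rintro ⟨t, htv, a, hwin, ha⟩
    exact ⟨a, t, hwin, htv, ha⟩

lemma Alarm.mono {s u v u' v' : ℕ} (h : D.Alarm x s u v) (hu : u' ≤ u) (hv : v ≤ v') :
    D.Alarm x s u' v' := by
  obtain ⟨a, t, hwin, htv, ha⟩ := h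
  exact ⟨a, t, by omega, by omega, ha⟩

lemma AlarmAt.alarm {s t u v : ℕ} (h : D.AlarmAt x s t) (hu : u + (D.w - 1) * D.period ≤ t)
    (hv : t < v) : D.Alarm x s u v := by
  obtain ⟨a, -, ha⟩ := h
  exact ⟨a, t, hu, hv, ha⟩

lemma lag_le {D : MDB K St Sd} {k : ℕ} (hk : k < D.w) :
    k * D.period ≤ (D.w - 1) * D.period :=
  Nat.mul_le_mul_right _ (Nat.le_sub_one_of_lt hk)

lemma lagWins_congr {a : DistinctPair K} {t t' : ℕ} {lags : Finset ℕ}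
    (h : ∀ k ∈ lags, x (t - k * D.period, a.1) = y (t' - k * D.period, a.1)) :
    D.lagWins x a t lags = D.lagWins y a t' lags :=
  Finset.sum_congr rfl fun k hk => by rw [h k hk]

lemma exceeds_congr {a : DistinctPair K} {t t' : ℕ}
    (h : ∀ k < D.w, x (t - k * D.period, a.1) = y (t' - k * D.period, a.1)) :
    D.Exceeds x a t ↔ D.Exceeds y a t' := by
  unfold Exceeds
  rw [lagWins_congr fun k hk => h k (Finset.mem_Ico.1 hk).2,
    lagWins_congr fun k hk => h k ((Finset.mem_range.1 hk).trans_le (Nat.div_le_self _ _))]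

lemma dependsOn_exceeds {a : DistinctPair K} {s u v t : ℕ} (hs : s < u)
    (hu : u + (D.w - 1) * D.period ≤ t) (hv : t < v)
    (ha : (t - s - 1) % D.period = D.idx a) :
    DependsOn (fun x => D.Exceeds x a t) (D.sampleBlock s u v) := by
  refine fun x y hxy => propext (exceeds_congr fun k hk => hxy (t - k * D.period, a.1) ?_)
  have := lag_le hk
  refine ⟨?_, ?_, a, rfl, ?_⟩ <;> dsimp only
  · omega
  · omega
  · rw [sub_mul_sub_mod (by omega), ha]

lemma dependsOn_alarm_sampleBlock {s u v : ℕ} (hs : s < u) :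
    DependsOn (fun x => D.Alarm x s u v) (D.sampleBlock s u v) :=
  dependsOn_exists fun _ => dependsOn_exists fun _ => dependsOn_and_left fun hu =>
    dependsOn_and_left fun hv => dependsOn_and_left fun ha => dependsOn_exceeds hs hu hv ha

lemma dependsOn_alarm {s u v : ℕ} (hs : s < u) :
    DependsOn (fun x => D.Alarm x s u v) (timeBlock K u v) :=
  (dependsOn_alarm_sampleBlock hs).mono (sampleBlock_subset s u v)

lemma dependsOn_alarmAt (s t : ℕ) :
    DependsOn (fun x => D.AlarmAt x s t) (timeBlock K (s + 1) (t + 1)) :=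
  .mono (sampleBlock_subset s _ _) <| dependsOn_exists fun _ => dependsOn_and_left fun hu =>
    dependsOn_and_left fun ha => dependsOn_exceeds (Nat.lt_succ_self s) hu (Nat.lt_succ_self t) ha

lemma dependsOn_lastReset (t : ℕ) :
    DependsOn (fun x => D.lastReset x t) (timeBlock K 1 t) := by
  induction t with
  | zero => exact fun _ _ _ => rfl
  | succ t ih =>
    intro x y hxy
    have hlast : D.lastReset x t = D.lastReset y t :=
      ih fun c hc => hxy c (timeBlock_mono le_rfl (Nat.le_succ t) hc)
    have halarm : D.AlarmAt x (D.lastReset x t) t ↔ D.AlarmAt y (D.lastReset y t) t := by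
      rw [hlast]
      exact (dependsOn_alarmAt _ t fun c hc =>
        hxy c (timeBlock_mono (Nat.le_add_left 1 _) le_rfl hc)).to_iff
    classical exact if_congr halarm rfl hlast

lemma dependsOn_lastReset_prop (p : ℕ → Prop) (t : ℕ) :
    DependsOn (fun x => p (D.lastReset x t)) (timeBlock K 1 t) :=
  fun _ _ hxy => congrArg p (dependsOn_lastReset t hxy)

lemma lastReset_succ_le (x : DuelIndex K → Bool) (t : ℕ) : D.lastReset x (t + 1) ≤ t := by
  induction t with
  | zero =>
    rw [lastReset]
    split_ifs <;> rfl
  | succ t ih =>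
    rw [lastReset]
    split_ifs <;> omega

lemma lastReset_lt (x : DuelIndex K → Bool) {t : ℕ} (ht : 0 < t) : D.lastReset x t < t := by
  obtain ⟨t, rfl⟩ := Nat.exists_eq_succ_of_ne_zero ht.ne'
  exact Nat.lt_succ_of_le (D.lastReset_succ_le x t)

lemma lastReset_eq_of_forall_ne {a b : ℕ} (hab : a ≤ b)
    (h : ∀ s, a ≤ s → s < b → D.lastReset x (s + 1) ≠ s) : D.lastReset x b = D.lastReset x a := by
  induction b, hab using Nat.le_induction with
  | base => rfl
  | succ b hab ih =>
    have hb := h b hab (Nat.lt_succ_self b)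
    rw [lastReset] at hb ⊢
    split_ifs with hal
    · simp [hal] at hb
    · exact ih fun s hs hs' => h s hs (by omega)

lemma exists_reset_of_alarmAt {a b s t : ℕ} (ha : D.lastReset x a = s) (hat : a ≤ t) (htb : t < b)
    (ht : D.AlarmAt x s t) : ∃ r, a ≤ r ∧ r < b ∧ D.lastReset x (r + 1) = r := by
  by_contra! hno
  have hlast := lastReset_eq_of_forall_ne hat fun r har hrt => hno r har (by omega)
  refine hno t hat htb ?_
  rw [lastReset, hlast, ha, if_pos ht]

lemma lastReset_eq_of_forall_not_alarmAt {a b s : ℕ} (ha : D.lastReset x a = s) (hab : a ≤ b)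
    (h : ∀ t, a ≤ t → t < b → ¬ D.AlarmAt x s t) : D.lastReset x b = s := by
  induction b, hab using Nat.le_induction with
  | base => exact ha
  | succ b hab ih =>
    rw [lastReset, ih fun t hat htb => h t hat (by omega), if_neg (h b hab (Nat.lt_succ_self b))]

end MDB

/-! ### Aligning the detection samples of two resets at a changepoint -/

lemma le_of_modEq_of_sub_lt {x y d : ℤ} (h : x ≡ y [ZMOD d]) (hd : 0 < d) (hlt : y - d < x) :
    y ≤ x := by
  obtain ⟨k, hk⟩ := h.symm.dvd
  have hk0 : -1 < k := lt_of_mul_lt_mul_left (by linarith : d * -1 < d * k) hd.le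
  have := mul_nonneg hd.le (show 0 ≤ k by omega)
  linarith

namespace MDB

variable {K : ℕ} {St Sd : Type*} [MeasurableSpace St] [MeasurableSpace Sd]

/-- The time `t` is congruent to the sampling times of the pair `a` when the detection phases start
at time `a₁`. -/
def InPhase (D : MDB K St Sd) (a₁ : ℕ) (a : DistinctPair K) (t : ℤ) : Prop :=
  t ≡ a₁ + D.idx a [ZMOD D.period]

/-- The shift that takes the sampling times of the pair `a` for detection phases starting at `a₁`
to those for detection phases starting at `a₂`, and preserves the numbers of samples before and
after `β`. -/
def phaseShift (D : MDB K St Sd) (a₁ a₂ β : ℕ) (a : DistinctPair K) : ℤ :=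
  ((a₂ : ℤ) + D.idx a - β) % (D.period : ℤ) - ((a₁ : ℤ) + D.idx a - β) % (D.period : ℤ)

/-- The sampling times since `u` for a reset at time `s` can be shifted to sampling times since `α`
for a reset at time `α - 1`. -/
def Admissible (D : MDB K St Sd) (s u α : ℕ) : Prop :=
  s < u ∧ ((u = s + 1 ∧ α ≤ u) ∨ α + D.period ≤ u)

/-- The change of time that aligns, pair by pair, the samples before time `β + h d`. -/
def alignTime (D : MDB K St Sd) (a₁ a₂ β h : ℕ) (a : DistinctPair K) (t : ℕ) : ℕ :=
  if t < β + h * D.period then ((t : ℤ) + D.phaseShift a₁ a₂ β a).toNat else t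

/-- The change of time `MDB.alignTime` on the indices of the outcomes. -/
def alignIndex (D : MDB K St Sd) (a₁ a₂ β h : ℕ) (c : DuelIndex K) : DuelIndex K :=
  if hc : c.2.1 < c.2.2 then (D.alignTime a₁ a₂ β h ⟨c.2, hc⟩ c.1, c.2) else c

variable {D : MDB K St Sd} {a₁ a₂ β h s u α : ℕ} {a : DistinctPair K}

lemma mod_eq_idx_iff_inPhase (hd : D.idx a < D.period) {t : ℕ} (hst : s < t) :
    (t - s - 1) % D.period = D.idx a ↔ D.InPhase (s + 1) a t := by
  obtain ⟨l, rfl⟩ := Nat.exists_eq_add_of_lt hst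
  have hl : s + l + 1 - s - 1 = l := by omega
  have hcast : ((s + l + 1 : ℕ) : ℤ) = (s + 1 : ℕ) + (l : ℤ) := by push_cast; ring
  have hmod : D.InPhase (s + 1) a (s + l + 1 : ℕ) ↔ (l : ℤ) ≡ D.idx a [ZMOD D.period] := by
    rw [InPhase, hcast]
    exact ⟨Int.ModEq.add_left_cancel' _, Int.ModEq.add_left _⟩
  rw [hl, hmod, Int.natCast_modEq_iff, Nat.ModEq, Nat.mod_eq_of_lt hd]

lemma phaseShift_swap (a₁ a₂ β : ℕ) (a : DistinctPair K) :
    D.phaseShift a₂ a₁ β a = - D.phaseShift a₁ a₂ β a :=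
  (neg_sub _ _).symm

lemma abs_phaseShift_lt (hd : 0 < D.period) (a₁ a₂ β : ℕ) (a : DistinctPair K) :
    |D.phaseShift a₁ a₂ β a| < D.period := by
  have hd' : (0 : ℤ) < D.period := by exact_mod_cast hd
  have h₁ := Int.emod_nonneg ((a₁ : ℤ) + D.idx a - β) hd'.ne'
  have h₂ := Int.emod_nonneg ((a₂ : ℤ) + D.idx a - β) hd'.ne'
  have h₁' := Int.emod_lt_of_pos ((a₁ : ℤ) + D.idx a - β) hd'
  have h₂' := Int.emod_lt_of_pos ((a₂ : ℤ) + D.idx a - β) hd'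
  rw [phaseShift, abs_lt]
  omega

lemma InPhase.add_phaseShift {t : ℤ} (ht : D.InPhase a₁ a t) (a₂ β : ℕ) :
    D.InPhase a₂ a (t + D.phaseShift a₁ a₂ β a) := by
  have hmod := (ht.add (Int.mod_modEq ((a₂ : ℤ) + D.idx a - β) D.period)).sub
    (Int.mod_modEq ((a₁ : ℤ) + D.idx a - β) D.period)
  rw [InPhase, phaseShift, ← add_sub_assoc]
  convert hmod using 1
  ring

lemma InPhase.add_phaseShift_sub_ediv (hd : 0 < D.period) {t : ℤ} (ht : D.InPhase a₁ a t)
    (a₂ β : ℕ) : (t + D.phaseShift a₁ a₂ β a - β) / D.period = (t - β) / D.period := by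
  have hd' : (0 : ℤ) < D.period := by exact_mod_cast hd
  have hmod : (t - β) % (D.period : ℤ) = (a₁ + D.idx a - β) % (D.period : ℤ) := ht.sub_right _
  have hdiv : t + D.phaseShift a₁ a₂ β a - β =
      (a₂ + D.idx a - β) % (D.period : ℤ) + D.period * ((t - β) / D.period) := by
    have := Int.emod_add_mul_ediv (t - β) D.period
    rw [phaseShift, ← hmod]
    linarith
  rw [hdiv, Int.add_mul_ediv_left _ _ hd'.ne', Int.ediv_eq_zero_of_lt
    (Int.emod_nonneg _ hd'.ne') (Int.emod_lt_of_pos _ hd'), zero_add]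

lemma InPhase.add_phaseShift_lt_iff (hd : 0 < D.period) {t : ℤ} (ht : D.InPhase a₁ a t)
    (a₂ β n : ℕ) :
    t + D.phaseShift a₁ a₂ β a < β + n * D.period ↔ t < β + n * D.period := by
  have hd' : (0 : ℤ) < D.period := by exact_mod_cast hd
  have hlt : ∀ r : ℤ, r < β + n * D.period ↔ (r - β) / D.period < n := fun r => by
    rw [Int.ediv_lt_iff_lt_mul hd', sub_lt_iff_lt_add']
  rw [hlt, hlt, ht.add_phaseShift_sub_ediv hd]

lemma Admissible.le_add_phaseShift (hd : 0 < D.period) (hadm : D.Admissible s u α)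
    (hda : D.idx a < D.period) {t : ℤ} (hu : u ≤ t) (ht : D.InPhase (s + 1) a t) (β : ℕ) :
    α ≤ t + D.phaseShift (s + 1) α β a := by
  have habs := abs_lt.1 (abs_phaseShift_lt hd (s + 1) α β a)
  rcases hadm.2 with ⟨rfl, hα⟩ | hα
  · have hfirst : ((s + 1 : ℕ) : ℤ) + D.idx a ≤ t :=
      le_of_modEq_of_sub_lt ht (by omega) (by omega)
    have : (α : ℤ) + D.idx a ≤ t + D.phaseShift (s + 1) α β a :=
      le_of_modEq_of_sub_lt (ht.add_phaseShift α β) (by omega) (by omega)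
    omega
  · omega

lemma Admissible.le_alignTime (hd : 0 < D.period) (hadm : D.Admissible s u α)
    (hda : D.idx a < D.period) {t : ℕ} (hu : u ≤ t) (ht : D.InPhase (s + 1) a t) :
    α ≤ D.alignTime (s + 1) α β h a t := by
  have hα := hadm.le_add_phaseShift hd hda (by exact_mod_cast hu) ht β
  unfold alignTime
  split_ifs
  · omega
  · have := hadm.2
    omega

lemma Admissible.natCast_alignTime (hd : 0 < D.period) (hadm : D.Admissible s u α)
    (hda : D.idx a < D.period) {t : ℕ} (hu : u ≤ t) (ht : D.InPhase (s + 1) a t)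
    (hlt : t < β + h * D.period) :
    (D.alignTime (s + 1) α β h a t : ℤ) = t + D.phaseShift (s + 1) α β a := by
  have := hadm.le_add_phaseShift hd hda (by exact_mod_cast hu) ht β
  rw [alignTime, if_pos hlt, Int.toNat_of_nonneg (by omega)]

lemma Admissible.alignTime_lt_iff (hd : 0 < D.period) (hadm : D.Admissible s u α)
    (hda : D.idx a < D.period) {t : ℕ} (hu : u ≤ t) (ht : D.InPhase (s + 1) a t)
    {n : ℕ} (hn : n ≤ h) :
    D.alignTime (s + 1) α β h a t < β + n * D.period ↔ t < β + n * D.period := by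
  have := Nat.mul_le_mul_right D.period hn
  by_cases hlt : t < β + h * D.period
  · have hcast := hadm.natCast_alignTime hd hda hu ht hlt
    have hiff := ht.add_phaseShift_lt_iff hd α β n
    rw [← hcast] at hiff
    exact_mod_cast hiff
  · rw [alignTime, if_neg hlt]

lemma Admissible.exceeds_alignIndex_iff (hd : 0 < D.period) (hadm : D.Admissible s u α)
    {t t' : ℕ} (hu : u + (D.w - 1) * D.period ≤ t) (hlt : t < β + h * D.period)
    (hphase : (t - s - 1) % D.period = D.idx a) (x : DuelIndex K → Bool)
    (ht' : (t' : ℤ) = t + D.phaseShift (s + 1) α β a) :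
    D.Exceeds (x ∘ D.alignIndex (s + 1) α β h) a t ↔ D.Exceeds x a t' := by
  have hda : D.idx a < D.period := hphase ▸ Nat.mod_lt _ hd
  have hsu := hadm.1
  refine exceeds_congr fun k hk => ?_
  have hlag := lag_le hk
  have hphase_k : D.InPhase (s + 1) a (t - k * D.period : ℕ) :=
    (mod_eq_idx_iff_inPhase hda (by omega)).1 (by rw [sub_mul_sub_mod (by omega), hphase])
  have hcast := hadm.natCast_alignTime (β := β) (h := h) hd hda (by omega) hphase_k (by omega)
  have htime : D.alignTime (s + 1) α β h a (t - k * D.period) = t' - k * D.period := by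
    have := hadm.le_alignTime (β := β) (h := h) hd hda (by omega) hphase_k
    omega
  simp only [Function.comp_apply, alignIndex, dif_pos a.2, Subtype.coe_eta, htime]

lemma Admissible.alarm_of_alarm_alignIndex (hd : 0 < D.period) (hα : 0 < α)
    (hadm : D.Admissible s u α) {x : DuelIndex K → Bool}
    (hal : D.Alarm (x ∘ D.alignIndex (s + 1) α β h) s u β) : D.Alarm x (α - 1) α β := by
  obtain ⟨a, t, hwin, htβ, hphase, hex⟩ := hal
  have hda : D.idx a < D.period := hphase ▸ Nat.mod_lt _ hd
  have hsu := hadm.1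
  have ht : D.InPhase (s + 1) a t := (mod_eq_idx_iff_inPhase hda (by omega)).1 hphase
  have hfirst := hadm.le_add_phaseShift (t := (t - (D.w - 1) * D.period : ℕ)) hd hda (by omega)
    ((mod_eq_idx_iff_inPhase hda (by omega)).1 (by rw [sub_mul_sub_mod (by omega), hphase])) β
  have hlt := (ht.add_phaseShift_lt_iff hd α β 0).2 (by push_cast; omega)
  obtain ⟨t', ht'⟩ := Int.eq_ofNat_of_zero_le
    (show 0 ≤ (t : ℤ) + D.phaseShift (s + 1) α β a by omega)
  have hshift := ht.add_phaseShift α β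
  rw [hadm.exceeds_alignIndex_iff hd hwin (by omega) hphase x ht'.symm] at hex
  refine ⟨a, t', by omega, by push_cast at hlt; omega, ?_, hex⟩
  rw [ht', ← Nat.sub_add_cancel hα] at hshift
  exact (mod_eq_idx_iff_inPhase hda (by omega)).2 hshift

lemma Admissible.alarm_alignIndex (hd : 0 < D.period) (hα : 0 < α) (hadm : D.Admissible s u α)
    (hu : u + (D.w - 1) * D.period ≤ β) {x : DuelIndex K → Bool}
    (hal : D.Alarm x (α - 1) α (β + h * D.period)) (hno : ¬ D.Alarm x (α - 1) α β) :
    D.Alarm (x ∘ D.alignIndex (s + 1) α β h) s u (β + h * D.period) := by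
  obtain ⟨a, t', hwin, hlt', hphase, hex⟩ := hal
  have hda : D.idx a < D.period := hphase ▸ Nat.mod_lt _ hd
  have hsu := hadm.1
  have hβt' : β ≤ t' := by
    by_contra! hlt
    exact hno ⟨a, t', hwin, hlt, hphase, hex⟩
  have ht' : D.InPhase α a t' := by
    have := (mod_eq_idx_iff_inPhase hda (by omega)).1 hphase
    rwa [Nat.sub_add_cancel hα] at this
  have hβ := (ht'.add_phaseShift_lt_iff hd (s + 1) β 0).not.2 (by push_cast; omega)
  obtain ⟨t, ht⟩ := Int.eq_ofNat_of_zero_le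
    (show 0 ≤ (t' : ℤ) + D.phaseShift α (s + 1) β a by push_cast at hβ; omega)
  have hlt := (ht'.add_phaseShift_lt_iff hd (s + 1) β h).2 (by exact_mod_cast hlt')
  have hshift := ht'.add_phaseShift (s + 1) β
  rw [ht] at hβ hlt hshift
  have htβ : t < β + h * D.period := by exact_mod_cast hlt
  have hphase_t := (mod_eq_idx_iff_inPhase hda (by push_cast at hβ; omega)).2 hshift
  refine ⟨a, t, by push_cast at hβ; omega, htβ, hphase_t, ?_⟩
  refine (hadm.exceeds_alignIndex_iff hd (by push_cast at hβ; omega) htβ hphase_t x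
    (t' := t') ?_).2 hex
  rw [phaseShift_swap] at ht
  omega

lemma exists_of_mem_sampleBlock {c : DuelIndex K} {v : ℕ} (hsu : s < u)
    (hc : c ∈ D.sampleBlock s u v) (hd : 0 < D.period) :
    ∃ a : DistinctPair K, c = (c.1, a.1) ∧ D.idx a < D.period ∧ D.InPhase (s + 1) a c.1 := by
  obtain ⟨hu, -, a, ha, hphase⟩ := hc
  have hda : D.idx a < D.period := hphase ▸ Nat.mod_lt _ hd
  exact ⟨a, by rw [ha], hda, (mod_eq_idx_iff_inPhase hda (by omega)).1 hphase⟩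

lemma alignIndex_mk (t : ℕ) (a : DistinctPair K) :
    D.alignIndex a₁ a₂ β h (t, a.1) = (D.alignTime a₁ a₂ β h a t, a.1) :=
  dif_pos a.2

lemma Admissible.le_alignIndex (hd : 0 < D.period) (hadm : D.Admissible s u α)
    {c : DuelIndex K} {v : ℕ} (hc : c ∈ D.sampleBlock s u v) :
    α ≤ (D.alignIndex (s + 1) α β h c).1 := by
  obtain ⟨a, ha, hda, hphase⟩ := exists_of_mem_sampleBlock hadm.1 hc hd
  rw [ha, alignIndex_mk]
  exact hadm.le_alignTime hd hda hc.1 hphase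

lemma Admissible.alignIndex_lt_iff (hd : 0 < D.period) (hadm : D.Admissible s u α)
    {c : DuelIndex K} {v : ℕ} (hc : c ∈ D.sampleBlock s u v) {n : ℕ} (hn : n ≤ h) :
    (D.alignIndex (s + 1) α β h c).1 < β + n * D.period ↔ c.1 < β + n * D.period := by
  obtain ⟨a, ha, hda, hphase⟩ := exists_of_mem_sampleBlock hadm.1 hc hd
  rw [ha, alignIndex_mk]
  exact hadm.alignTime_lt_iff hd hda hc.1 hphase hn

lemma alignIndex_of_le {c : DuelIndex K} (hc : β + h * D.period ≤ c.1) :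
    D.alignIndex a₁ a₂ β h c = c := by
  unfold alignIndex alignTime
  simp only [if_neg hc.not_gt, dite_eq_ite, ite_self]

lemma alignIndex_snd (c : DuelIndex K) : (D.alignIndex a₁ a₂ β h c).2 = c.2 := by
  unfold alignIndex
  split_ifs <;> rfl

lemma Admissible.alignIndex_injOn (hd : 0 < D.period) (hadm : D.Admissible s u α) (v : ℕ) :
    Set.InjOn (D.alignIndex (s + 1) α β h) (D.sampleBlock s u v) := by
  intro c hc c' hc' heq
  have hside : c.1 < β + h * D.period ↔ c'.1 < β + h * D.period := by
    rw [← hadm.alignIndex_lt_iff hd hc le_rfl, ← hadm.alignIndex_lt_iff hd hc' le_rfl, heq]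
  by_cases hlt : c.1 < β + h * D.period
  · obtain ⟨a, ha, hda, hphase⟩ := exists_of_mem_sampleBlock hadm.1 hc hd
    obtain ⟨a', ha', -, hphase'⟩ := exists_of_mem_sampleBlock hadm.1 hc' hd
    have heq' := heq
    rw [ha, ha', alignIndex_mk, alignIndex_mk, Prod.mk.injEq] at heq'
    obtain rfl : a = a' := Subtype.ext heq'.2
    have htime := congrArg (Nat.cast : ℕ → ℤ) heq'.1
    rw [hadm.natCast_alignTime hd hda hc.1 hphase hlt,
      hadm.natCast_alignTime hd hda hc'.1 hphase' (hside.1 hlt), add_left_inj,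
      Nat.cast_inj] at htime
    rw [ha, ha', htime]
  · rwa [alignIndex_of_le (not_lt.1 hlt), alignIndex_of_le (not_lt.1 (hside.not.1 hlt))] at heq

end MDB

/-! ### Probabilities of properties of independent outcomes -/

section OutcomeProb

variable {ι κ Ω β γ δ : Type*} [MeasurableSpace Ω] [MeasurableSpace β] [MeasurableSpace γ]
  [MeasurableSpace δ] {μ : Measure Ω} {X : ι → Ω → Bool} {S C C' : Set ι}
  {A B : (ι → Bool) → Prop}

lemma exists_iff_comp_of_dependsOn {g : κ → ι} (hA : DependsOn A C) (hC : C ⊆ Set.range g) :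
    ∃ A' : (κ → Bool) → Prop, ∀ x, A x ↔ A' (x ∘ g) := by
  have hfactor : Function.FactorsThrough A fun x => x ∘ g := fun x y hxy => hA fun i hi => by
    obtain ⟨k, rfl⟩ := hC hi
    exact congrFun hxy k
  obtain ⟨A', hA'⟩ := (Function.factorsThrough_iff A).1 hfactor
  exact ⟨A', fun x => (congrFun hA' x).to_iff⟩

lemma measurableSet_of_dependsOn (hX : ∀ i, Measurable (X i)) (hC : C.Finite)
    (hA : DependsOn A C) : MeasurableSet {ω | A fun i => X i ω} := by
  obtain ⟨A', hA'⟩ := exists_iff_comp_of_dependsOn (g := fun i : C => (i : ι)) hA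
    Subtype.range_coe.superset
  have := hC.to_subtype
  simp only [hA']
  exact measurable_pi_lambda (fun ω (i : C) => X i ω) (fun i => hX i)
    (Set.toFinite {z | A' z}).measurableSet

lemma exists_measurable_comp_of_dependsOn [Nonempty β] {f : (ι → β) → γ} {g : κ → ι}
    (hf : Measurable f) (hdep : DependsOn f C) (hC : C ⊆ Set.range g) :
    ∃ f' : (κ → β) → γ, Measurable f' ∧ ∀ z, f z = f' (z ∘ g) := by
  classical
  obtain ⟨y⟩ := ‹Nonempty β›
  refine ⟨fun z => f (Function.extend g z fun _ => y), hf.comp ?_, fun z => hdep fun i hi => ?_⟩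
  · refine measurable_pi_lambda _ fun i => ?_
    by_cases hi : ∃ k, g k = i
    · simpa only [Function.extend, hi, dif_pos] using measurable_pi_apply _
    · simpa only [Function.extend, hi, dif_neg, not_false_iff] using measurable_const
  · have hi' : ∃ k, g k = i := hC hi
    simp only [Function.extend, hi', dif_pos, Function.comp_apply, hi'.choose_spec]

lemma indepFun_of_dependsOn [Nonempty β] {Y : ι → Ω → β} {f : (ι → β) → γ} {g : (ι → β) → δ}
    (hY : ∀ i, Measurable (Y i)) (hS : S.Finite) (hind : iIndepFun (fun i : S => Y i) μ)
    (hf : Measurable f) (hg : Measurable g) (hfC : DependsOn f C) (hgC : DependsOn g C')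
    (hC : C ⊆ S) (hC' : C' ⊆ S) (hdisj : Disjoint C C') :
    IndepFun (fun ω => f fun i => Y i ω) (fun ω => g fun i => Y i ω) μ := by
  classical
  have := hS.fintype
  let F (C : Set ι) : Finset S := {i | (i : ι) ∈ C}
  have hF : Disjoint (F C) (F C') := by
    refine Finset.disjoint_left.2 fun i hi hi' => ?_
    exact Set.disjoint_left.1 hdisj (Finset.mem_filter.1 hi).2 (Finset.mem_filter.1 hi').2
  have hrange (C : Set ι) (hC : C ⊆ S) : C ⊆ Set.range fun i : F C => (i.1 : ι) :=
    fun i hi => ⟨⟨⟨i, hC hi⟩, by simpa [F] using hi⟩, rfl⟩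
  obtain ⟨f', hf', hff'⟩ := exists_measurable_comp_of_dependsOn hf hfC (hrange C hC)
  obtain ⟨g', hg', hgg'⟩ := exists_measurable_comp_of_dependsOn hg hgC (hrange C' hC')
  simp only [hff', hgg']
  exact (hind.indepFun_finset _ _ hF fun i => hY i).comp hf' hg'

lemma identDistrib_bool [IsFiniteMeasure μ] {f g : Ω → Bool} (hf : Measurable f)
    (hg : Measurable g) (h : μ.real {ω | f ω = true} = μ.real {ω | g ω = true}) :
    IdentDistrib f g μ μ := by
  refine ⟨hf.aemeasurable, hg.aemeasurable, Measure.ext_of_singleton fun b => ?_⟩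
  have htrue : μ (f ⁻¹' {true}) = μ (g ⁻¹' {true}) :=
    (measureReal_eq_measureReal_iff (measure_ne_top _ _) (measure_ne_top _ _)).1 h
  rw [Measure.map_apply hf (measurableSet_singleton b),
    Measure.map_apply hg (measurableSet_singleton b)]
  cases b
  · have hcompl : ({false} : Set Bool) = {true}ᶜ := by ext b; cases b <;> simp
    rw [hcompl, Set.preimage_compl, Set.preimage_compl,
      measure_compl (hf (measurableSet_singleton _)) (measure_ne_top _ _),
      measure_compl (hg (measurableSet_singleton _)) (measure_ne_top _ _), htrue]
  · exact htrue

/-- The probability that the random family `X` of outcomes has the property `A`. -/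
def outcomeProb (μ : Measure Ω) (X : ι → Ω → Bool) (A : (ι → Bool) → Prop) : ℝ :=
  μ.real {ω | A fun i => X i ω}

lemma outcomeProb_nonneg : 0 ≤ outcomeProb μ X A := measureReal_nonneg

lemma outcomeProb_le_one [IsZeroOrProbabilityMeasure μ] : outcomeProb μ X A ≤ 1 :=
  measureReal_le_one

lemma outcomeProb_mono [IsFiniteMeasure μ] (h : ∀ x, A x → B x) :
    outcomeProb μ X A ≤ outcomeProb μ X B :=
  measureReal_mono fun _ hω => h _ hω

lemma outcomeProb_congr (h : ∀ x, A x ↔ B x) : outcomeProb μ X A = outcomeProb μ X B := by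
  rw [funext fun x => propext (h x)]

lemma outcomeProb_or_le :
    outcomeProb μ X (fun x => A x ∨ B x) ≤ outcomeProb μ X A + outcomeProb μ X B :=
  measureReal_union_le _ _

lemma outcomeProb_not [IsProbabilityMeasure μ] (hX : ∀ i, Measurable (X i)) (hC : C.Finite)
    (hA : DependsOn A C) : outcomeProb μ X (fun x => ¬ A x) = 1 - outcomeProb μ X A :=
  probReal_compl_eq_one_sub (measurableSet_of_dependsOn hX hC hA)

lemma outcomeProb_and_add_and_not [IsFiniteMeasure μ] (hX : ∀ i, Measurable (X i))
    (hC : C.Finite) (hB : DependsOn B C) :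
    outcomeProb μ X (fun x => A x ∧ B x) + outcomeProb μ X (fun x => A x ∧ ¬ B x) =
      outcomeProb μ X A :=
  measureReal_inter_add_sdiff (s := {ω | A fun i => X i ω}) (measurableSet_of_dependsOn hX hC hB)

lemma outcomeProb_exists_eq [IsFiniteMeasure μ] (hX : ∀ i, Measurable (X i)) (F : Finset κ)
    {A : κ → (ι → Bool) → Prop} {C : κ → Set ι} (hC : ∀ k ∈ F, (C k).Finite)
    (hA : ∀ k ∈ F, DependsOn (A k) (C k))
    (hdisj : ∀ x, ∀ k ∈ F, ∀ l ∈ F, A k x → A l x → k = l) :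
    outcomeProb μ X (fun x => ∃ k ∈ F, A k x) = ∑ k ∈ F, outcomeProb μ X (A k) := by
  have hUnion : {ω | ∃ k ∈ F, A k fun i => X i ω} = ⋃ k ∈ F, {ω | A k fun i => X i ω} := by
    ext ω
    simp
  rw [outcomeProb, hUnion]
  refine measureReal_biUnion_finset (fun k hk l hl hkl => Set.disjoint_left.2 fun ω hωk hωl => ?_)
    fun k hk => measurableSet_of_dependsOn hX (hC k hk) (hA k hk)
  exact hkl (hdisj _ k hk l hl hωk hωl)

variable (hX : ∀ i, Measurable (X i)) (hS : S.Finite)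
  (hind : iIndepFun (fun i : S => X i) μ)

include hX hS hind

lemma outcomeProb_and_eq_mul (hA : DependsOn A C) (hB : DependsOn B C') (hC : C ⊆ S)
    (hC' : C' ⊆ S) (hdisj : Disjoint C C') :
    outcomeProb μ X (fun x => A x ∧ B x) = outcomeProb μ X A * outcomeProb μ X B := by
  have hmeas {A : (ι → Bool) → Prop} {C : Set ι} (hC : C ⊆ S) (hA : DependsOn A C) :
      Measurable A :=
    measurableSet_setOfPred.1 (measurableSet_of_dependsOn measurable_pi_apply (hS.subset hC) hA)
  have hmul := (indepFun_of_dependsOn hX hS hind (hmeas hC hA) (hmeas hC' hB) hA hB hC hC'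
    hdisj).measure_inter_preimage_eq_mul {P | P} {P | P} .of_discrete .of_discrete
  simp only [outcomeProb, Measure.real, ← ENNReal.toReal_mul]
  exact congrArg ENNReal.toReal hmul

lemma outcomeProb_exists_and_eq [IsFiniteMeasure μ] (F : Finset κ) {A B : κ → (ι → Bool) → Prop}
    {C C' : κ → Set ι} (hA : ∀ k ∈ F, DependsOn (A k) (C k))
    (hB : ∀ k ∈ F, DependsOn (B k) (C' k)) (hC : ∀ k ∈ F, C k ⊆ S) (hC' : ∀ k ∈ F, C' k ⊆ S)
    (hCC' : ∀ k ∈ F, Disjoint (C k) (C' k))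
    (hdisj : ∀ x, ∀ k ∈ F, ∀ l ∈ F, A k x → A l x → k = l) :
    outcomeProb μ X (fun x => ∃ k ∈ F, A k x ∧ B k x) =
      ∑ k ∈ F, outcomeProb μ X (A k) * outcomeProb μ X (B k) := by
  rw [outcomeProb_exists_eq hX F (fun _ _ => hS) (fun k hk => dependsOn_and
    ((hA k hk).mono (hC k hk)) ((hB k hk).mono (hC' k hk)))
    fun x k hk l hl hkx hlx => hdisj x k hk l hl hkx.1 hlx.1]
  exact Finset.sum_congr rfl fun k hk => outcomeProb_and_eq_mul hX hS hind (hA k hk) (hB k hk)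
    (hC k hk) (hC' k hk) (hCC' k hk)

lemma outcomeProb_exists_and_le [IsFiniteMeasure μ] (F : Finset κ) {A B : κ → (ι → Bool) → Prop}
    {C C' : κ → Set ι} {ε : ℝ} (hA : ∀ k ∈ F, DependsOn (A k) (C k))
    (hB : ∀ k ∈ F, DependsOn (B k) (C' k)) (hC : ∀ k ∈ F, C k ⊆ S) (hC' : ∀ k ∈ F, C' k ⊆ S)
    (hCC' : ∀ k ∈ F, Disjoint (C k) (C' k))
    (hdisj : ∀ x, ∀ k ∈ F, ∀ l ∈ F, A k x → A l x → k = l)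
    (hε : ∀ k ∈ F, outcomeProb μ X (B k) ≤ ε) :
    outcomeProb μ X (fun x => ∃ k ∈ F, A k x ∧ B k x) ≤
      ε * outcomeProb μ X (fun x => ∃ k ∈ F, A k x) := by
  rw [outcomeProb_exists_and_eq hX hS hind F hA hB hC hC' hCC' hdisj,
    outcomeProb_exists_eq hX F (fun k hk => hS.subset (hC k hk)) hA hdisj, mul_comm, Finset.sum_mul]
  exact Finset.sum_le_sum fun k hk => mul_le_mul_of_nonneg_left (hε k hk) outcomeProb_nonneg

lemma outcomeProb_comp [IsFiniteMeasure μ] (hA : DependsOn A C) (hC : C ⊆ S) {f : ι → ι}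
    (hf : Set.MapsTo f C S) (hinj : Set.InjOn f C)
    (hlaw : ∀ i ∈ C, μ.real {ω | X (f i) ω = true} = μ.real {ω | X i ω = true}) :
    outcomeProb μ X (fun x => A (x ∘ f)) = outcomeProb μ X A := by
  have := (hS.subset hC).to_subtype
  obtain ⟨A', hA'⟩ := exists_iff_comp_of_dependsOn (g := fun i : C => (i : ι)) hA
    Subtype.range_coe.superset
  have hident : IdentDistrib (fun ω (i : C) => X (f i) ω) (fun ω (i : C) => X i ω) μ μ :=
    .pi (fun i => identDistrib_bool (hX _) (hX _) (hlaw i i.2))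
      (hind.precomp (g := hf.restrict f C S) (hf.restrict_inj.2 hinj))
      (hind.precomp (Set.inclusion_injective hC))
  simp only [outcomeProb, Measure.real, hA']
  exact congrArg ENNReal.toReal
    (hident.measure_mem_eq (s := {z | A' z}) (Set.toFinite _).measurableSet)

end OutcomeProb

/-! ### False alarms and delays after a reset inside a segment -/

namespace DuelingProblem

variable {K T M : ℕ} (E : DuelingProblem K T M)

/-- The first time step of segment `m`. -/
def start (m : Fin M) : ℕ := E.cp m.castSucc

/-- The first time step after segment `m`. -/
def finish (m : Fin M) : ℕ := E.cp m.succ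

lemma one_le_start (m : Fin M) : 1 ≤ E.start m := by
  rw [← E.cp_zero]
  exact E.cp_strictMono.monotone (Fin.zero_le _)

lemma start_lt_finish (m : Fin M) : E.start m < E.finish m :=
  E.cp_strictMono Fin.castSucc_lt_succ

lemma finish_le (m : Fin M) : E.finish m ≤ T + 1 := by
  rw [← E.cp_last]
  exact E.cp_strictMono.monotone (Fin.le_last _)

lemma start_eq_one {m : Fin M} (hm : (m : ℕ) = 0) : E.start m = 1 := by
  have hcast : m.castSucc = 0 := Fin.ext hm
  rw [start, hcast, E.cp_zero]

lemma start_succ (m : Fin M) (h : (m : ℕ) + 1 < M) : E.start ⟨m + 1, h⟩ = E.finish m := rfl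

lemma mem_segment {m : Fin M} {t : ℕ} : t ∈ E.segment m ↔ E.start m ≤ t ∧ t < E.finish m :=
  Finset.mem_Ico

lemma card_segment (m : Fin M) : (E.segment m).card = E.finish m - E.start m :=
  Nat.card_Ico _ _

end DuelingProblem

lemma finite_timeBlock (K u v : ℕ) : (timeBlock K u v).Finite :=
  ((Set.finite_Ico u v).prod (Set.finite_univ (α := Fin K × Fin K))).subset
    fun _ hc => ⟨hc, Set.mem_univ _⟩

lemma disjoint_timeBlock {K u v u' v' : ℕ} (h : v ≤ u') :
    Disjoint (timeBlock K u v) (timeBlock K u' v') :=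
  Set.disjoint_left.2 fun _ hc hc' => (hc.2.trans_le h).not_ge hc'.1

namespace MDB

variable {K T M : ℕ} {St Sd : Type*} [MeasurableSpace St] [MeasurableSpace Sd]
  {Ω : Type*} [MeasurableSpace Ω]

/-- The number of time steps needed to fill one half of all detection windows. -/
def halfL (D : MDB K St Sd) : ℕ := D.w / 2 * D.period

/-- The bound `p + q (1 - p)` on the probability that the detection raises a false alarm before a
changepoint or a late alarm after it. -/
def errorBound (p q : ℝ) : ℝ := p + q * (1 - p)

/-- The bound on the probability that a changepoint is passed without a timely alarm, by a late
detection or by a false alarm, when the detection at the next changepoint fails as well. -/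
def doubleErrorBound (p q : ℝ) : ℝ := p * errorBound p q + q * (1 - p)

/-- The outcomes are independent Bernoulli variables, the segments are long enough, and the
detection has false alarm probability at most `p` and large delay probability at most `q`. The
conditional probability of a large delay is written without division. -/
structure DetectionBounds (D : MDB K St Sd) (E : DuelingProblem K T M) (μ : Measure Ω)
    (X : DuelIndex K → Ω → Bool) (p q : ℝ) : Prop where
  measurable : ∀ c, Measurable (X c)
  indep : iIndepFun (fun c : timeBlock K 1 (T + 1) => X c) μ
  bernoulli : ∀ m, ∀ t ∈ E.segment m, ∀ a : Fin K × Fin K,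
    μ.real {ω | X (t, a) ω = true} = E.P m a.1 a.2
  period_pos : 0 < D.period
  w_pos : 0 < D.w
  even_w : Even D.w
  length : ∀ m, E.start m + 2 * D.L ≤ E.finish m
  p_nonneg : 0 ≤ p
  p_le_one : p ≤ 1
  q_nonneg : 0 ≤ q
  q_le_one : q ≤ 1
  false_alarm : ∀ m,
    outcomeProb μ X (fun x => D.Alarm x (E.start m - 1) (E.start m) (E.finish m)) ≤ p
  delay : ∀ m : Fin M, (m : ℕ) + 1 < M →
    outcomeProb μ X (fun x => ¬ D.Alarm x (E.start m - 1) (E.start m) (E.finish m + D.halfL)) ≤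
      q * (1 - outcomeProb μ X fun x => D.Alarm x (E.start m - 1) (E.start m) (E.finish m))

variable {D : MDB K St Sd} {E : DuelingProblem K T M} {μ : Measure Ω}
  {X : DuelIndex K → Ω → Bool} {p q : ℝ} {m : Fin M} {s u n v : ℕ}

lemma L_eq_two_mul_halfL (hw : Even D.w) : D.L = 2 * D.halfL := by
  rw [L, halfL, ← mul_assoc, Nat.two_mul_div_two_of_even hw]

lemma Admissible.start_le {α : ℕ} (h : D.Admissible s u α) : α ≤ u := by
  rcases h.2 with h | h <;> omega

lemma admissible_of_add_period_le {α : ℕ} (hs : s < α) (hu : α + D.period ≤ u) :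
    D.Admissible s u α :=
  ⟨by omega, Or.inr hu⟩

lemma admissible_succ {α : ℕ} (hs : α - 1 ≤ s) : D.Admissible s (s + 1) α :=
  ⟨by omega, Or.inl ⟨rfl, by omega⟩⟩

namespace DetectionBounds

variable (h : D.DetectionBounds E μ X p q)

include h

lemma isProbabilityMeasure : IsProbabilityMeasure μ := h.indep.isProbabilityMeasure

lemma L_eq : D.L = 2 * D.halfL := L_eq_two_mul_halfL h.even_w

lemma window_add_period : (D.w - 1) * D.period + D.period = D.L := by
  rw [L, ← Nat.succ_mul, Nat.succ_eq_add_one, Nat.sub_add_cancel h.w_pos]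

lemma period_le_halfL : D.period ≤ D.halfL := by
  obtain ⟨k, hk⟩ := h.even_w
  have := h.w_pos
  exact Nat.le_mul_of_pos_left _ (by omega)

lemma finish_add_halfL_le (m : Fin M) (hm : (m : ℕ) + 1 < M) :
    E.finish m + D.halfL ≤ E.finish ⟨m + 1, hm⟩ := by
  have hlen := h.length ⟨m + 1, hm⟩
  have hL := h.L_eq
  rw [E.start_succ] at hlen
  omega

lemma measureReal_eq_of_mem_segment {t t' : ℕ} (ht : t ∈ E.segment m) (ht' : t' ∈ E.segment m)
    (a : Fin K × Fin K) :
    μ.real {ω | X (t, a) ω = true} = μ.real {ω | X (t', a) ω = true} := by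
  rw [h.bernoulli m t ht, h.bernoulli m t' ht']

lemma outcomeProb_and_eq_mul {A B : (DuelIndex K → Bool) → Prop} {u u' v v' : ℕ}
    (hA : DependsOn A (timeBlock K u v)) (hB : DependsOn B (timeBlock K u' v')) (hu : 1 ≤ u)
    (hv : v ≤ u') (huv : u ≤ u') (hvv : v ≤ v') (hv' : v' ≤ T + 1) :
    outcomeProb μ X (fun x => A x ∧ B x) = outcomeProb μ X A * outcomeProb μ X B :=
  _root_.outcomeProb_and_eq_mul h.measurable (finite_timeBlock K 1 (T + 1)) h.indep hA hB
    (timeBlock_mono hu (hvv.trans hv')) (timeBlock_mono (hu.trans huv) hv') (disjoint_timeBlock hv)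

lemma mem_segment_alignIndex (hadm : D.Admissible s u (E.start m)) {c : DuelIndex K}
    (hc : c ∈ D.sampleBlock s u v) (hlt : c.1 < E.finish m) :
    c.1 ∈ E.segment m ∧ (D.alignIndex (s + 1) (E.start m) (E.finish m) n c).1 ∈ E.segment m := by
  have hiff := hadm.alignIndex_lt_iff (β := E.finish m) h.period_pos hc (Nat.zero_le n)
  rw [zero_mul, add_zero] at hiff
  rw [E.mem_segment, E.mem_segment]
  exact ⟨⟨hadm.start_le.trans hc.1, hlt⟩, hadm.le_alignIndex h.period_pos hc, hiff.2 hlt⟩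

lemma mem_segment_succ_alignIndex (hadm : D.Admissible s u (E.start m)) (hm : (m : ℕ) + 1 < M)
    (hn : E.finish m + n * D.period ≤ E.finish ⟨m + 1, hm⟩) {c : DuelIndex K}
    (hc : c ∈ D.sampleBlock s u v) (hge : E.finish m ≤ c.1)
    (hlt : c.1 < E.finish m + n * D.period) :
    c.1 ∈ E.segment ⟨m + 1, hm⟩ ∧
      (D.alignIndex (s + 1) (E.start m) (E.finish m) n c).1 ∈ E.segment ⟨m + 1, hm⟩ := by
  have hiff := hadm.alignIndex_lt_iff (β := E.finish m) h.period_pos hc (Nat.zero_le n)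
  have hiff' := hadm.alignIndex_lt_iff (β := E.finish m) h.period_pos hc le_rfl (h := n)
  rw [zero_mul, add_zero] at hiff
  rw [E.mem_segment, E.mem_segment, E.start_succ]
  omega

lemma prob_comp_alignIndex_of_mem_segment (hadm : D.Admissible s u (E.start m)) (hv : v ≤ T + 1)
    (hseg : ∀ c ∈ D.sampleBlock s u v,
      D.alignIndex (s + 1) (E.start m) (E.finish m) n c = c ∨ ∃ m', c.1 ∈ E.segment m' ∧
        (D.alignIndex (s + 1) (E.start m) (E.finish m) n c).1 ∈ E.segment m')
    {A : (DuelIndex K → Bool) → Prop} (hA : DependsOn A (D.sampleBlock s u v)) :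
    outcomeProb μ X (fun x => A (x ∘ D.alignIndex (s + 1) (E.start m) (E.finish m) n)) =
      outcomeProb μ X A := by
  have := h.isProbabilityMeasure
  have hsub : D.sampleBlock s u v ⊆ timeBlock K 1 (T + 1) :=
    (sampleBlock_subset s u v).trans
      (timeBlock_mono ((E.one_le_start m).trans hadm.start_le) hv)
  refine outcomeProb_comp h.measurable (finite_timeBlock K 1 (T + 1)) h.indep hA hsub
    (fun c hc => ?_) (hadm.alignIndex_injOn h.period_pos v) fun c hc => ?_
  · rcases hseg c hc with heq | ⟨m', -, hmem⟩
    · rw [heq]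
      exact hsub hc
    · rw [E.mem_segment] at hmem
      exact ⟨(E.one_le_start m').trans hmem.1, hmem.2.trans_le (E.finish_le m')⟩
  · rcases hseg c hc with heq | ⟨m', hmem, hmem'⟩
    · rw [heq]
    · rw [← Prod.mk.eta (p := c), ← h.measureReal_eq_of_mem_segment hmem' hmem, Prod.mk.eta,
        ← alignIndex_snd (D := D) (a₁ := s + 1) (a₂ := E.start m) (β := E.finish m) (h := n) c,
        Prod.mk.eta]

lemma prob_comp_alignIndex_of_le_finish (hadm : D.Admissible s u (E.start m))
    {A : (DuelIndex K → Bool) → Prop} (hA : DependsOn A (D.sampleBlock s u (E.finish m))) :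
    outcomeProb μ X (fun x => A (x ∘ D.alignIndex (s + 1) (E.start m) (E.finish m) n)) =
      outcomeProb μ X A :=
  h.prob_comp_alignIndex_of_mem_segment hadm (E.finish_le m)
    (fun _ hc => Or.inr ⟨m, h.mem_segment_alignIndex hadm hc hc.2.1⟩) hA

lemma prob_comp_alignIndex (hadm : D.Admissible s u (E.start m)) (hm : (m : ℕ) + 1 < M)
    {A : (DuelIndex K → Bool) → Prop} (hA : DependsOn A (D.sampleBlock s u (T + 1))) :
    outcomeProb μ X (fun x => A (x ∘ D.alignIndex (s + 1) (E.start m) (E.finish m) (D.w / 2))) =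
      outcomeProb μ X A := by
  refine h.prob_comp_alignIndex_of_mem_segment hadm le_rfl (fun c hc => ?_) hA
  rcases lt_or_ge c.1 (E.finish m) with hlt | hge
  · exact Or.inr ⟨m, h.mem_segment_alignIndex hadm hc hlt⟩
  rcases lt_or_ge c.1 (E.finish m + D.w / 2 * D.period) with hlt | hge'
  · exact Or.inr ⟨_, h.mem_segment_succ_alignIndex hadm hm (h.finish_add_halfL_le m hm) hc hge hlt⟩
  · exact Or.inl (alignIndex_of_le hge')

lemma prob_alarm_le_prob_alarm_start (hadm : D.Admissible s u (E.start m)) :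
    outcomeProb μ X (fun x => D.Alarm x s u (E.finish m)) ≤
      outcomeProb μ X fun x => D.Alarm x (E.start m - 1) (E.start m) (E.finish m) := by
  have := h.isProbabilityMeasure
  rw [← h.prob_comp_alignIndex_of_le_finish (n := 0) hadm (dependsOn_alarm_sampleBlock hadm.1)]
  exact outcomeProb_mono fun x hx =>
    hadm.alarm_of_alarm_alignIndex h.period_pos (E.one_le_start m) hx

lemma prob_alarm_le (hadm : D.Admissible s u (E.start m)) :
    outcomeProb μ X (fun x => D.Alarm x s u (E.finish m)) ≤ p :=
  (h.prob_alarm_le_prob_alarm_start hadm).trans (h.false_alarm m)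

lemma dependsOn_alarm_comp_alignIndex (hadm : D.Admissible s u (E.start m)) :
    DependsOn (fun x =>
      D.Alarm (x ∘ D.alignIndex (s + 1) (E.start m) (E.finish m) n) s u (E.finish m))
      (timeBlock K (E.start m) (E.finish m)) := by
  refine fun x y hxy => dependsOn_alarm_sampleBlock hadm.1 fun c hc => hxy _ ?_
  exact E.mem_segment.1 (h.mem_segment_alignIndex hadm hc hc.2.1).2

lemma dependsOn_comp_alignIndex (hadm : D.Admissible s u (E.start m)) (hm : (m : ℕ) + 1 < M)
    (hu : u ≤ E.finish m) {B : (DuelIndex K → Bool) → Prop}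
    (hB : DependsOn B (D.sampleBlock s (E.finish m) (T + 1))) :
    DependsOn (fun x => B (x ∘ D.alignIndex (s + 1) (E.start m) (E.finish m) (D.w / 2)))
      (timeBlock K (E.finish m) (T + 1)) := by
  refine fun x y hxy => hB fun c hc => hxy _ ?_
  have hcu := sampleBlock_mono (D := D) (s := s) hu le_rfl hc
  rcases lt_or_ge c.1 (E.finish m + D.w / 2 * D.period) with hlt | hge
  · have hmem := E.mem_segment.1 (h.mem_segment_succ_alignIndex hadm hm
      (h.finish_add_halfL_le m hm) hcu hc.1 hlt).2
    exact ⟨hmem.1, hmem.2.trans_le (E.finish_le _)⟩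
  · rw [alignIndex_of_le hge]
    exact sampleBlock_subset _ _ _ hc

lemma prob_alarm_start_and_not_alarm_alignIndex (hadm : D.Admissible s u (E.start m)) :
    outcomeProb μ X (fun x => D.Alarm x (E.start m - 1) (E.start m) (E.finish m) ∧
      ¬ D.Alarm (x ∘ D.alignIndex (s + 1) (E.start m) (E.finish m) n) s u (E.finish m)) =
      outcomeProb μ X (fun x => D.Alarm x (E.start m - 1) (E.start m) (E.finish m)) -
        outcomeProb μ X fun x => D.Alarm x s u (E.finish m) := by
  have := h.isProbabilityMeasure
  have hsplit := outcomeProb_and_add_and_not (μ := μ)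
    (A := fun x => D.Alarm x (E.start m - 1) (E.start m) (E.finish m)) h.measurable
    (finite_timeBlock _ _ _) (h.dependsOn_alarm_comp_alignIndex hadm (n := n))
  rw [outcomeProb_congr (fun x => and_iff_right_of_imp
      (hadm.alarm_of_alarm_alignIndex h.period_pos (E.one_le_start m))),
    h.prob_comp_alignIndex_of_le_finish (n := n) hadm
      (dependsOn_alarm_sampleBlock hadm.1)] at hsplit
  exact eq_sub_of_add_eq' hsplit

/- A late aligned detection is a late detection from the start of the segment, or the latter has an
alarm in the segment based on samples that the aligned detection does not use. -/
lemma prob_late_alarm_and_le (hadm : D.Admissible s u (E.start m)) (hm : (m : ℕ) + 1 < M)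
    (hu : u + (D.w - 1) * D.period ≤ E.finish m) {B : (DuelIndex K → Bool) → Prop}
    (hB : DependsOn B (D.sampleBlock s (E.finish m) (T + 1))) :
    outcomeProb μ X (fun x => ¬ D.Alarm x s u (E.finish m + D.halfL) ∧ B x) ≤
      q * (1 - outcomeProb μ X fun x => D.Alarm x (E.start m - 1) (E.start m) (E.finish m)) +
        (outcomeProb μ X (fun x => D.Alarm x (E.start m - 1) (E.start m) (E.finish m)) -
          outcomeProb μ X (fun x => D.Alarm x s u (E.finish m))) * outcomeProb μ X B := by
  have := h.isProbabilityMeasure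
  have hnext := (h.finish_add_halfL_le m hm).trans (E.finish_le _)
  have hα := E.one_le_start m
  have hαβ := E.start_lt_finish m
  set f := D.alignIndex (s + 1) (E.start m) (E.finish m) (D.w / 2)
  set A₀ := fun x => D.Alarm x (E.start m - 1) (E.start m) (E.finish m)
  have hBu : DependsOn B (D.sampleBlock s u (T + 1)) :=
    hB.mono (sampleBlock_mono (by omega) le_rfl)
  have hlate : DependsOn (fun x => ¬ D.Alarm x s u (E.finish m + D.halfL) ∧ B x)
      (D.sampleBlock s u (T + 1)) :=
    dependsOn_and ((dependsOn_not (dependsOn_alarm_sampleBlock hadm.1)).mono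
      (sampleBlock_mono le_rfl (by omega))) hBu
  have hcover : ∀ x, ¬ D.Alarm (x ∘ f) s u (E.finish m + D.halfL) ∧ B (x ∘ f) →
      ¬ D.Alarm x (E.start m - 1) (E.start m) (E.finish m + D.halfL) ∨
        (A₀ x ∧ ¬ D.Alarm (x ∘ f) s u (E.finish m)) ∧ B (x ∘ f) := by
    rintro x ⟨hno, hBx⟩
    refine or_iff_not_imp_left.2 fun hal => ⟨⟨?_, fun hal' => ?_⟩, hBx⟩
    · by_contra hno₀
      exact hno (hadm.alarm_alignIndex h.period_pos hα hu (not_not.1 hal) hno₀)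
    · exact hno (hal'.mono le_rfl (Nat.le_add_right _ _))
  rw [← h.prob_comp_alignIndex hadm hm hlate, ← h.prob_comp_alignIndex hadm hm hBu,
    ← h.prob_alarm_start_and_not_alarm_alignIndex hadm, ← h.outcomeProb_and_eq_mul
      (dependsOn_and (dependsOn_alarm (by omega))
        (dependsOn_not (h.dependsOn_alarm_comp_alignIndex hadm)))
      (h.dependsOn_comp_alignIndex hadm hm (by omega) hB) hα le_rfl (by omega) (by omega) le_rfl]
  exact (outcomeProb_mono hcover).trans (outcomeProb_or_le.trans (by gcongr; exact h.delay m hm))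

lemma prob_late_alarm_and_add_le (hadm : D.Admissible s u (E.start m)) (hm : (m : ℕ) + 1 < M)
    (hu : u + (D.w - 1) * D.period ≤ E.finish m) {B : (DuelIndex K → Bool) → Prop} {e : ℝ}
    (hB : DependsOn B (D.sampleBlock s (E.finish m) (T + 1))) (he : outcomeProb μ X B ≤ e)
    (hqe : q ≤ e) :
    e * outcomeProb μ X (fun x => D.Alarm x s u (E.finish m)) +
      outcomeProb μ X (fun x => ¬ D.Alarm x s u (E.finish m + D.halfL) ∧ B x) ≤
      p * e + q * (1 - p) := by
  have hlate := h.prob_late_alarm_and_le hadm hm hu hB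
  have hle := h.prob_alarm_le_prob_alarm_start hadm
  have hfalse := mul_nonneg (sub_nonneg.2 (h.false_alarm m)) (sub_nonneg.2 hqe)
  have hB' := mul_le_mul_of_nonneg_left he (sub_nonneg.2 hle)
  linarith

end DetectionBounds

end MDB

/-! ### Missed changepoints -/

namespace MDB

variable {K T M : ℕ} {St Sd : Type*} [MeasurableSpace St] [MeasurableSpace Sd]
  {Ω : Type*} [MeasurableSpace Ω]

/-- No reset happens at the time steps `a, …, b - 1`; the initialization counts as a reset at
time `0`. -/
def NoReset (D : MDB K St Sd) (x : DuelIndex K → Bool) (a b : ℕ) : Prop :=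
  ∀ s, a ≤ s → s < b → D.lastReset x (s + 1) ≠ s

/-- The first reset at time `a` or later happens at time `s`. -/
def FirstReset (D : MDB K St Sd) (x : DuelIndex K → Bool) (a s : ℕ) : Prop :=
  D.lastReset x (s + 1) = s ∧ D.NoReset x a s

/-- With detection phases aligned to a reset at time `s` and samples from time `u` on, there is an
alarm before the changepoint `v` or none in the first `L / 2` time steps after it. -/
def BadDetection (D : MDB K St Sd) (x : DuelIndex K → Bool) (s u v : ℕ) : Prop :=
  D.Alarm x s u v ∨ ¬ D.Alarm x s u (v + D.halfL)

/-- The changepoint at the start of segment `m` is missed: it is followed by no reset in the first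
`L / 2` time steps of the segment. -/
def Missed (D : MDB K St Sd) (E : DuelingProblem K T M) (m : Fin M) (x : DuelIndex K → Bool) :
    Prop :=
  D.NoReset x (E.start m - 1) (E.start m + D.halfL)

/-- There is no reset in segment `m` which leaves at least `L` further time steps in the segment. -/
def Quiet (D : MDB K St Sd) (E : DuelingProblem K T M) (m : Fin M) (x : DuelIndex K → Bool) :
    Prop :=
  D.NoReset x (E.start m - 1) (E.finish m - D.L)

/-- The detection whose phases are aligned to the last reset before segment `m` is bad at the end of
the segment. -/
def StaleBad (D : MDB K St Sd) (E : DuelingProblem K T M) (m : Fin M) (x : DuelIndex K → Bool) :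
    Prop :=
  D.BadDetection x (D.lastReset x (E.start m)) (E.start m + D.period) (E.finish m)

/-- The changepoint at the start of segment `m` is missed, or its detection is followed by a false
alarm in the segment. -/
def Fails (D : MDB K St Sd) (E : DuelingProblem K T M) (m : Fin M) (x : DuelIndex K → Bool) :
    Prop :=
  D.Missed E m x ∨ ∃ s ∈ Finset.Ico (E.start m - 1) (E.start m + D.halfL),
    D.FirstReset x (E.start m - 1) s ∧ D.Alarm x s (s + 1) (E.finish m)

section

variable {D : MDB K St Sd} {x : DuelIndex K → Bool}

lemma NoReset.mono {a b a' b' : ℕ} (h : D.NoReset x a b) (ha : a ≤ a') (hb : b' ≤ b) :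
    D.NoReset x a' b' :=
  fun s has hsb => h s (ha.trans has) (hsb.trans_le hb)

lemma exists_firstReset_iff {a b : ℕ} :
    (∃ s ∈ Finset.Ico a b, D.FirstReset x a s) ↔ ¬ D.NoReset x a b := by
  constructor
  · rintro ⟨s, hs, hreset, -⟩ hno
    rw [Finset.mem_Ico] at hs
    exact hno s hs.1 hs.2 hreset
  · intro hreset
    unfold NoReset at hreset
    push Not at hreset
    classical
    obtain ⟨has, hsb, hs⟩ := Nat.find_spec hreset
    refine ⟨_, Finset.mem_Ico.2 ⟨has, hsb⟩, hs, fun r har hrs hr => ?_⟩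
    exact Nat.find_min hreset hrs ⟨har, by omega, hr⟩

lemma FirstReset.unique {a s s' : ℕ} (hs : a ≤ s) (hs' : a ≤ s') (h : D.FirstReset x a s)
    (h' : D.FirstReset x a s') : s = s' := by
  rcases lt_trichotomy s s' with hlt | heq | hlt
  · exact absurd h.1 (h'.2 s hs hlt)
  · exact heq
  · exact absurd h'.1 (h.2 s' hs' hlt)

lemma dependsOn_noReset (a b : ℕ) : DependsOn (fun x => D.NoReset x a b) (timeBlock K 1 b) :=
  fun _ _ hxy => propext <| forall₃_congr fun s _ hs =>
    (dependsOn_lastReset_prop (· ≠ s) (s + 1)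
      fun c hc => hxy c (timeBlock_mono le_rfl hs hc)).to_iff

lemma dependsOn_firstReset (a s : ℕ) :
    DependsOn (fun x => D.FirstReset x a s) (timeBlock K 1 (s + 1)) :=
  dependsOn_and (dependsOn_lastReset_prop (· = s) (s + 1))
    ((dependsOn_noReset a s).mono (timeBlock_mono le_rfl (Nat.le_succ s)))

lemma dependsOn_badDetection {s u v : ℕ} (hs : s < u) :
    DependsOn (fun x => D.BadDetection x s u v) (D.sampleBlock s u (v + D.halfL)) :=
  dependsOn_or
    ((dependsOn_alarm_sampleBlock hs).mono (sampleBlock_mono le_rfl (Nat.le_add_right _ _)))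
    (dependsOn_not (dependsOn_alarm_sampleBlock hs))

lemma dependsOn_alarm_lastReset {α u v : ℕ} (hα : 0 < α) (hu : α ≤ u) (hv : α ≤ v) :
    DependsOn (fun x => D.Alarm x (D.lastReset x α) u v) (timeBlock K 1 v) := by
  intro x y hxy
  have hlast : D.lastReset x α = D.lastReset y α :=
    dependsOn_lastReset α fun c hc => hxy c (timeBlock_mono le_rfl hv hc)
  dsimp only
  rw [hlast]
  exact dependsOn_alarm ((lastReset_lt y hα).trans_le hu) fun c hc =>
    hxy c (timeBlock_mono (hα.trans_le hu) le_rfl hc)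

lemma lastReset_eq_of_not_alarm {s v : ℕ} (hs : D.lastReset x (s + 1) = s) (hsv : s < v)
    (hno : ¬ D.Alarm x s (s + 1) v) : D.lastReset x v = s :=
  lastReset_eq_of_forall_not_alarmAt hs hsv fun t _ htv hal =>
    hno (alarm_succ_iff.2 ⟨t, htv, hal⟩)

lemma alarm_or_not_alarm_of_noReset {s u v v' : ℕ} (hsu : s < u)
    (hlast : ¬ D.Alarm x s u v → D.lastReset x v = s) (hno : D.NoReset x v v') :
    D.Alarm x s u v ∨ ¬ D.Alarm x s u v' ∧ D.lastReset x v = s := by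
  refine or_iff_not_imp_left.2 fun hal => ⟨?_, hlast hal⟩
  rintro ⟨a, t, hut, htv', ha⟩
  have hvt : v ≤ t := not_lt.1 fun htv => hal ⟨a, t, hut, htv, ha⟩
  obtain ⟨r, hvr, hrv', hr⟩ := exists_reset_of_alarmAt (hlast hal) hvt htv' ⟨a, by omega, ha⟩
  exact hno r hvr hrv' hr

end

namespace DetectionBounds

variable {D : MDB K St Sd} {E : DuelingProblem K T M} {μ : Measure Ω}
  {X : DuelIndex K → Ω → Bool} {p q : ℝ} {m : Fin M} {s u : ℕ} {x : DuelIndex K → Bool}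
  (h : D.DetectionBounds E μ X p q)

include h

lemma errorBound_nonneg : 0 ≤ errorBound p q :=
  add_nonneg h.p_nonneg (mul_nonneg h.q_nonneg (sub_nonneg.2 h.p_le_one))

lemma q_le_errorBound : q ≤ errorBound p q := by
  have := mul_nonneg h.p_nonneg (sub_nonneg.2 h.q_le_one)
  unfold errorBound
  linarith

lemma missed_of_quiet (hx : D.Quiet E m x) : D.Missed E m x := by
  have hlen := h.length m
  have hL := h.L_eq
  exact hx.mono le_rfl (by omega)

lemma lastReset_finish_of_quiet (hx : D.Quiet E m x)
    (hal : ¬ D.Alarm x (D.lastReset x (E.start m)) (E.start m + D.period) (E.finish m)) :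
    D.lastReset x (E.finish m) = D.lastReset x (E.start m) := by
  have hlen := h.length m
  have hw := h.window_add_period
  have hL : D.lastReset x (E.finish m - D.L) = D.lastReset x (E.start m) :=
    lastReset_eq_of_forall_ne (by omega) fun s hs hs' => hx s (by omega) hs'
  exact lastReset_eq_of_forall_not_alarmAt hL (Nat.sub_le _ _) fun t ht ht' halt =>
    hal (halt.alarm (by omega) ht')

lemma cover_of_noReset_finish
    (hx : D.NoReset x (E.finish m - 1) (E.finish m + D.halfL)) :
    (∃ s ∈ Finset.Ico (E.start m - 1) (E.finish m - D.L), D.FirstReset x (E.start m - 1) s ∧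
      (D.Alarm x s (s + 1) (E.finish m) ∨
        ¬ D.Alarm x s (s + 1) (E.finish m + D.halfL) ∧ D.lastReset x (E.finish m) = s)) ∨
    D.Quiet E m x ∧
      (D.Alarm x (D.lastReset x (E.start m)) (E.start m + D.period) (E.finish m) ∨
        ¬ D.Alarm x (D.lastReset x (E.start m)) (E.start m + D.period) (E.finish m + D.halfL) ∧
          D.lastReset x (E.finish m) = D.lastReset x (E.start m)) := by
  have hlate : D.NoReset x (E.finish m) (E.finish m + D.halfL) := hx.mono (Nat.sub_le _ _) le_rfl
  by_cases hquiet : D.Quiet E m x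
  · have hlt := D.lastReset_lt x (E.one_le_start m)
    exact Or.inr ⟨hquiet, alarm_or_not_alarm_of_noReset (by omega)
      (h.lastReset_finish_of_quiet hquiet) hlate⟩
  · obtain ⟨s, hs, hfirst⟩ := exists_firstReset_iff.2 hquiet
    have hsv : s < E.finish m := (Finset.mem_Ico.1 hs).2.trans_le (Nat.sub_le _ _)
    exact Or.inl ⟨s, hs, hfirst, alarm_or_not_alarm_of_noReset (Nat.lt_succ_self s)
      (lastReset_eq_of_not_alarm hfirst.1 hsv) hlate⟩

lemma prob_exists_firstReset_and {a b : ℕ} (hb : b ≤ T + 1)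
    {B : ℕ → (DuelIndex K → Bool) → Prop}
    (hB : ∀ s, a ≤ s → s < b → DependsOn (B s) (timeBlock K (s + 1) (T + 1))) :
    outcomeProb μ X (fun x => ∃ s ∈ Finset.Ico a b, D.FirstReset x a s ∧ B s x) =
      ∑ s ∈ Finset.Ico a b, outcomeProb μ X (fun x => D.FirstReset x a s) *
        outcomeProb μ X (B s) := by
  have := h.isProbabilityMeasure
  refine outcomeProb_exists_and_eq h.measurable (finite_timeBlock K 1 (T + 1)) h.indep _
    (fun s _ => dependsOn_firstReset a s)
    (fun s hs => hB s (Finset.mem_Ico.1 hs).1 (Finset.mem_Ico.1 hs).2) (fun s hs => ?_)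
    (fun s _ => timeBlock_mono (Nat.le_add_left 1 s) le_rfl)
    (fun s _ => disjoint_timeBlock le_rfl)
    fun x s hs s' hs' => FirstReset.unique (Finset.mem_Ico.1 hs).1 (Finset.mem_Ico.1 hs').1
  have := (Finset.mem_Ico.1 hs).2
  exact timeBlock_mono le_rfl (by omega)

lemma sum_prob_firstReset (a b : ℕ) :
    ∑ s ∈ Finset.Ico a b, outcomeProb μ X (fun x => D.FirstReset x a s) =
      1 - outcomeProb μ X fun x => D.NoReset x a b := by
  have := h.isProbabilityMeasure
  rw [← outcomeProb_not h.measurable (finite_timeBlock K 1 b) (dependsOn_noReset a b),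
    ← outcomeProb_congr fun x => exists_firstReset_iff]
  exact (outcomeProb_exists_eq h.measurable _ (fun s _ => finite_timeBlock K 1 (s + 1))
    (fun s _ => dependsOn_firstReset a s) fun x s hs s' hs' =>
      FirstReset.unique (Finset.mem_Ico.1 hs).1 (Finset.mem_Ico.1 hs').1).symm

lemma prob_exists_firstReset_and_le {a b : ℕ} (hb : b ≤ T + 1)
    {B : ℕ → (DuelIndex K → Bool) → Prop} {ε : ℝ}
    (hB : ∀ s, a ≤ s → s < b → DependsOn (B s) (timeBlock K (s + 1) (T + 1)))
    (hε : ∀ s, a ≤ s → s < b → outcomeProb μ X (B s) ≤ ε) :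
    outcomeProb μ X (fun x => ∃ s ∈ Finset.Ico a b, D.FirstReset x a s ∧ B s x) ≤
      ε * (1 - outcomeProb μ X fun x => D.NoReset x a b) := by
  rw [h.prob_exists_firstReset_and hb hB, ← h.sum_prob_firstReset, mul_comm, Finset.sum_mul]
  refine Finset.sum_le_sum fun s hs => mul_le_mul_of_nonneg_left ?_ outcomeProb_nonneg
  exact hε s (Finset.mem_Ico.1 hs).1 (Finset.mem_Ico.1 hs).2

lemma prob_and_lastReset_le {α c : ℕ} (hα : 0 < α) (hαc : α ≤ c) (hc : c ≤ T + 1)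
    {A : (DuelIndex K → Bool) → Prop} {B : ℕ → (DuelIndex K → Bool) → Prop} {ε : ℝ}
    (hA : DependsOn A (timeBlock K 1 c))
    (hB : ∀ s < α, DependsOn (B s) (timeBlock K c (T + 1)))
    (hε : ∀ s < α, outcomeProb μ X (B s) ≤ ε) :
    outcomeProb μ X (fun x => A x ∧ B (D.lastReset x α) x) ≤ ε * outcomeProb μ X A := by
  have := h.isProbabilityMeasure
  have hmem (x : DuelIndex K → Bool) : D.lastReset x α ∈ Finset.range α :=
    Finset.mem_range.2 (lastReset_lt x hα)
  have hAs (s : ℕ) : DependsOn (fun x => A x ∧ D.lastReset x α = s) (timeBlock K 1 c) :=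
    dependsOn_and hA ((dependsOn_lastReset_prop (· = s) α).mono (timeBlock_mono le_rfl hαc))
  have hle := outcomeProb_exists_and_le h.measurable (finite_timeBlock K 1 (T + 1)) h.indep
    (Finset.range α) (fun s _ => hAs s) (fun s hs => hB s (Finset.mem_range.1 hs))
    (fun s _ => timeBlock_mono le_rfl hc)
    (fun s _ => timeBlock_mono (hα.trans_le hαc) le_rfl) (fun s _ => disjoint_timeBlock le_rfl)
    (fun x s _ s' _ hs hs' => hs.2.symm.trans hs'.2) fun s hs => hε s (Finset.mem_range.1 hs)
  refine (outcomeProb_mono fun x hx => ?_).trans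
    (hle.trans_eq (congrArg _ (outcomeProb_congr fun x => ?_)))
  · exact ⟨_, hmem x, ⟨hx.1, rfl⟩, hx.2⟩
  · exact ⟨fun ⟨_, _, hx, _⟩ => hx, fun hx => ⟨_, hmem x, hx, rfl⟩⟩

end DetectionBounds

end MDB

namespace MDB

namespace DetectionBounds

variable {K T M : ℕ} {St Sd : Type*} [MeasurableSpace St] [MeasurableSpace Sd]
  {Ω : Type*} [MeasurableSpace Ω] {D : MDB K St Sd} {E : DuelingProblem K T M} {μ : Measure Ω}
  {X : DuelIndex K → Ω → Bool} {p q : ℝ} {m : Fin M} {s u : ℕ}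
  (h : D.DetectionBounds E μ X p q)

include h

lemma prob_badDetection_le (hadm : D.Admissible s u (E.start m)) (hm : (m : ℕ) + 1 < M)
    (hu : u + (D.w - 1) * D.period ≤ E.finish m) :
    outcomeProb μ X (fun x => D.BadDetection x s u (E.finish m)) ≤ errorBound p q := by
  have := h.isProbabilityMeasure
  have hle := h.prob_late_alarm_and_add_le hadm hm hu (B := fun _ => True) (e := 1)
    (fun _ _ _ => rfl) outcomeProb_le_one h.q_le_one
  simp only [and_true, one_mul, mul_one] at hle
  exact outcomeProb_or_le.trans hle

lemma prob_and_staleBad_le (hm : (m : ℕ) + 1 < M) {A : (DuelIndex K → Bool) → Prop}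
    (hA : DependsOn A (timeBlock K 1 (E.start m))) :
    outcomeProb μ X (fun x => A x ∧ D.StaleBad E m x) ≤ errorBound p q * outcomeProb μ X A := by
  have hlen := h.length m
  have hw := h.window_add_period
  have := E.start_lt_finish m
  have hnext := (h.finish_add_halfL_le m hm).trans (E.finish_le _)
  refine h.prob_and_lastReset_le (E.one_le_start m) le_rfl (by omega) hA
    (B := fun s x => D.BadDetection x s (E.start m + D.period) (E.finish m))
    (fun s hs => (dependsOn_badDetection (by omega)).mono ?_)
    fun s hs => h.prob_badDetection_le (admissible_of_add_period_le hs le_rfl) hm (by omega)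
  exact (sampleBlock_subset _ _ _).trans (timeBlock_mono (by omega) (by omega))

lemma prob_missed_succ_le (hm : (m : ℕ) + 1 < M) :
    outcomeProb μ X (D.Missed E ⟨m + 1, hm⟩) ≤
      errorBound p q * (1 - outcomeProb μ X (D.Quiet E m)) +
        outcomeProb μ X (fun x => D.Quiet E m x ∧ D.StaleBad E m x) := by
  have := h.isProbabilityMeasure
  have hlen := h.length m
  have hw := h.window_add_period
  have hd := h.period_pos
  have hT := (h.finish_add_halfL_le m hm).trans (E.finish_le _)
  have hcover : ∀ x, D.Missed E ⟨m + 1, hm⟩ x →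
      (∃ s ∈ Finset.Ico (E.start m - 1) (E.finish m - D.L), D.FirstReset x (E.start m - 1) s ∧
        D.BadDetection x s (s + 1) (E.finish m)) ∨ D.Quiet E m x ∧ D.StaleBad E m x :=
    fun x hx => (h.cover_of_noReset_finish hx).imp
      (fun ⟨s, hs, hfirst, hbad⟩ => ⟨s, hs, hfirst, hbad.imp_right And.left⟩)
      (And.imp_right (Or.imp_right And.left))
  refine (outcomeProb_mono hcover).trans (outcomeProb_or_le.trans (add_le_add_left ?_ _))
  refine h.prob_exists_firstReset_and_le (by omega) (fun s _ _ => ?_) fun s hs hs' => ?_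
  · exact (dependsOn_badDetection (Nat.lt_succ_self s)).mono
      ((sampleBlock_subset _ _ _).trans (timeBlock_mono le_rfl hT))
  · exact h.prob_badDetection_le (admissible_succ hs) hm (by omega)

lemma prob_quiet_and_staleBad_le (hm : (m : ℕ) + 1 < M) :
    outcomeProb μ X (fun x => D.Quiet E m x ∧ D.StaleBad E m x) ≤
      p + errorBound p q * outcomeProb μ X (D.Missed E m) := by
  have := h.isProbabilityMeasure
  have hlen := h.length m
  have hw := h.window_add_period
  have hα := E.one_le_start m
  have := E.start_lt_finish m
  have hT := E.finish_le m
  have hd := h.period_le_halfL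
  have hd0 := h.period_pos
  have hL := h.L_eq
  have hT' := (h.finish_add_halfL_le m hm).trans (E.finish_le _)
  have hcover : ∀ x, D.Quiet E m x ∧ D.StaleBad E m x →
      (True ∧ D.Alarm x (D.lastReset x (E.start m)) (E.start m + D.period) (E.finish m)) ∨
      (D.Missed E m x ∧
        D.BadDetection x (D.lastReset x (E.start m)) (E.start m + D.halfL) (E.finish m)) := by
    rintro x ⟨hquiet, hbad | hbad⟩
    · exact Or.inl ⟨trivial, hbad⟩
    · exact Or.inr ⟨h.missed_of_quiet hquiet, Or.inr fun hal => hbad (hal.mono (by omega) le_rfl)⟩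
  refine (outcomeProb_mono hcover).trans (outcomeProb_or_le.trans (add_le_add ?_ ?_))
  · refine (h.prob_and_lastReset_le hα le_rfl (by omega) (A := fun _ => True)
      (B := fun s x => D.Alarm x s (E.start m + D.period) (E.finish m)) (fun _ _ _ => rfl)
      (fun s hs => (dependsOn_alarm (by omega)).mono (timeBlock_mono (by omega) hT))
      fun s hs => h.prob_alarm_le (admissible_of_add_period_le hs le_rfl)).trans ?_
    exact mul_le_of_le_one_right h.p_nonneg outcomeProb_le_one
  · exact h.prob_and_lastReset_le hα (Nat.le_add_right _ _) (by omega)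
      (B := fun s x => D.BadDetection x s (E.start m + D.halfL) (E.finish m))
      (dependsOn_noReset _ _)
      (fun s hs => (dependsOn_badDetection (by omega)).mono
        ((sampleBlock_subset _ _ _).trans (timeBlock_mono le_rfl hT')))
      (fun s hs => h.prob_badDetection_le (admissible_of_add_period_le hs (by omega)) hm
        (by omega))

lemma prob_fails_le (m : Fin M) :
    outcomeProb μ X (D.Fails E m) ≤ outcomeProb μ X (D.Missed E m) +
      p * (1 - outcomeProb μ X (D.Missed E m)) := by
  have hlen := h.length m
  have hL := h.L_eq
  have hT := E.finish_le m
  refine outcomeProb_or_le.trans (add_le_add_right ?_ _)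
  exact h.prob_exists_firstReset_and_le (by omega)
    (fun s _ _ => (dependsOn_alarm (Nat.lt_succ_self s)).mono (timeBlock_mono le_rfl hT))
    fun s hs _ => h.prob_alarm_le (admissible_succ hs)

end DetectionBounds

end MDB

namespace MDB

namespace DetectionBounds

variable {K T M : ℕ} {St Sd : Type*} [MeasurableSpace St] [MeasurableSpace Sd]
  {Ω : Type*} [MeasurableSpace Ω] {D : MDB K St Sd} {E : DuelingProblem K T M} {μ : Measure Ω}
  {X : DuelIndex K → Ω → Bool} {p q : ℝ} {m : Fin M} {s u : ℕ}
  (h : D.DetectionBounds E μ X p q)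

include h

lemma cover_of_quiet_succ (hm : (m : ℕ) + 1 < M) {x : DuelIndex K → Bool}
    (hquiet : D.Quiet E ⟨m + 1, hm⟩ x) (hbad : D.StaleBad E ⟨m + 1, hm⟩ x) :
    ((∃ s ∈ Finset.Ico (E.start m - 1) (E.finish m - D.L), D.FirstReset x (E.start m - 1) s ∧
        D.Alarm x s (s + 1) (E.finish m)) ∧ D.StaleBad E ⟨m + 1, hm⟩ x ∨
      ∃ s ∈ Finset.Ico (E.start m - 1) (E.finish m - D.L), D.FirstReset x (E.start m - 1) s ∧
        ¬ D.Alarm x s (s + 1) (E.finish m + D.halfL) ∧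
          D.BadDetection x s (E.finish m + D.period) (E.finish ⟨m + 1, hm⟩)) ∨
    ((D.Quiet E m x ∧ D.Alarm x (D.lastReset x (E.start m)) (E.start m + D.period) (E.finish m)) ∧
        D.StaleBad E ⟨m + 1, hm⟩ x ∨
      D.Missed E m x ∧
        ¬ D.Alarm x (D.lastReset x (E.start m)) (E.start m + D.halfL) (E.finish m + D.halfL) ∧
          D.BadDetection x (D.lastReset x (E.start m)) (E.finish m + D.period)
            (E.finish ⟨m + 1, hm⟩)) := by
  have hd := h.period_le_halfL
  rcases h.cover_of_noReset_finish (h.missed_of_quiet hquiet) with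
    ⟨s, hs, hfirst, hal | ⟨hal, hlast⟩⟩ | ⟨hquiet, hal | ⟨hal, hlast⟩⟩
  · exact Or.inl (Or.inl ⟨⟨s, hs, hfirst, hal⟩, hbad⟩)
  · exact Or.inl (Or.inr ⟨s, hs, hfirst, hal, hlast ▸ hbad⟩)
  · exact Or.inr (Or.inl ⟨⟨hquiet, hal⟩, hbad⟩)
  · exact Or.inr (Or.inr ⟨h.missed_of_quiet hquiet,
      fun hal' => hal (hal'.mono (by omega) le_rfl), hlast ▸ hbad⟩)

lemma dependsOn_badDetection_succ (hm : (m : ℕ) + 1 + 1 < M) (hs : s < E.finish m) :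
    DependsOn (fun x => D.BadDetection x s (E.finish m + D.period)
      (E.finish ⟨m + 1, Nat.lt_of_succ_lt hm⟩)) (D.sampleBlock s (E.finish m) (T + 1)) := by
  have hT := (h.finish_add_halfL_le ⟨m + 1, Nat.lt_of_succ_lt hm⟩ hm).trans (E.finish_le _)
  exact (dependsOn_badDetection (by omega)).mono (sampleBlock_mono (by omega) hT)

lemma dependsOn_not_alarm_and_badDetection_succ (hm : (m : ℕ) + 1 + 1 < M) (hs : s < E.finish m)
    (hsu : s < u) (hu : u ≤ E.finish m) :
    DependsOn (fun x => ¬ D.Alarm x s u (E.finish m + D.halfL) ∧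
      D.BadDetection x s (E.finish m + D.period) (E.finish ⟨m + 1, Nat.lt_of_succ_lt hm⟩))
      (timeBlock K u (T + 1)) := by
  have hT := (h.finish_add_halfL_le m (Nat.lt_of_succ_lt hm)).trans (E.finish_le _)
  exact dependsOn_and ((dependsOn_not (dependsOn_alarm hsu)).mono (timeBlock_mono le_rfl hT))
    ((h.dependsOn_badDetection_succ hm hs).mono
      ((sampleBlock_subset _ _ _).trans (timeBlock_mono hu le_rfl)))

lemma prob_not_alarm_and_badDetection_succ_le (hm : (m : ℕ) + 1 + 1 < M)
    (hadm : D.Admissible s u (E.start m)) (hs : s < E.finish m)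
    (hu : u + (D.w - 1) * D.period ≤ E.finish m) :
    errorBound p q * outcomeProb μ X (fun x => D.Alarm x s u (E.finish m)) +
      outcomeProb μ X (fun x => ¬ D.Alarm x s u (E.finish m + D.halfL) ∧
        D.BadDetection x s (E.finish m + D.period) (E.finish ⟨m + 1, Nat.lt_of_succ_lt hm⟩)) ≤
      doubleErrorBound p q := by
  have hlen := h.length ⟨m + 1, Nat.lt_of_succ_lt hm⟩
  have hw := h.window_add_period
  rw [E.start_succ] at hlen
  exact h.prob_late_alarm_and_add_le hadm (Nat.lt_of_succ_lt hm) hu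
    (h.dependsOn_badDetection_succ hm hs)
    (h.prob_badDetection_le (admissible_of_add_period_le hs le_rfl) hm (by omega))
    h.q_le_errorBound

lemma prob_firstReset_and_staleBad_succ_le (hm : (m : ℕ) + 1 + 1 < M) :
    outcomeProb μ X (fun x =>
        (∃ s ∈ Finset.Ico (E.start m - 1) (E.finish m - D.L), D.FirstReset x (E.start m - 1) s ∧
          D.Alarm x s (s + 1) (E.finish m)) ∧ D.StaleBad E ⟨m + 1, Nat.lt_of_succ_lt hm⟩ x ∨
        ∃ s ∈ Finset.Ico (E.start m - 1) (E.finish m - D.L), D.FirstReset x (E.start m - 1) s ∧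
          ¬ D.Alarm x s (s + 1) (E.finish m + D.halfL) ∧ D.BadDetection x s
            (E.finish m + D.period) (E.finish ⟨m + 1, Nat.lt_of_succ_lt hm⟩)) ≤
      doubleErrorBound p q * (1 - outcomeProb μ X (D.Quiet E m)) := by
  have hw := h.window_add_period
  have hlen := h.length m
  have hd := h.period_pos
  have hT := E.finish_le m
  have hdep : DependsOn (fun x => ∃ s ∈ Finset.Ico (E.start m - 1) (E.finish m - D.L),
      D.FirstReset x (E.start m - 1) s ∧ D.Alarm x s (s + 1) (E.finish m))
      (timeBlock K 1 (E.finish m)) := by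
    refine dependsOn_exists fun s => dependsOn_and_left fun hs => ?_
    have := (Finset.mem_Ico.1 hs).2
    exact dependsOn_and ((dependsOn_firstReset _ s).mono (timeBlock_mono le_rfl (by omega)))
      ((dependsOn_alarm (Nat.lt_succ_self s)).mono (timeBlock_mono (by omega) le_rfl))
  have hdep₁ (s : ℕ) : DependsOn (fun x => D.Alarm x s (s + 1) (E.finish m))
      (timeBlock K (s + 1) (T + 1)) :=
    (dependsOn_alarm (Nat.lt_succ_self s)).mono (timeBlock_mono le_rfl hT)
  have hquiet : 1 - outcomeProb μ X (D.Quiet E m) =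
      ∑ s ∈ Finset.Ico (E.start m - 1) (E.finish m - D.L),
        outcomeProb μ X (fun x => D.FirstReset x (E.start m - 1) s) :=
    (h.sum_prob_firstReset _ _).symm
  refine outcomeProb_or_le.trans ((add_le_add_left
    (h.prob_and_staleBad_le (m := ⟨m + 1, Nat.lt_of_succ_lt hm⟩) hm hdep) _).trans ?_)
  rw [h.prob_exists_firstReset_and (by omega) fun s _ _ => hdep₁ s,
    h.prob_exists_firstReset_and (by omega) fun s _ hs =>
      h.dependsOn_not_alarm_and_badDetection_succ hm (by omega) (Nat.lt_succ_self s) (by omega),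
    hquiet, Finset.mul_sum, Finset.mul_sum, ← Finset.sum_add_distrib]
  refine Finset.sum_le_sum fun s hs => ?_
  rw [Finset.mem_Ico] at hs
  rw [mul_left_comm, ← mul_add, mul_comm (doubleErrorBound p q)]
  exact mul_le_mul_of_nonneg_left (h.prob_not_alarm_and_badDetection_succ_le hm
    (admissible_succ hs.1) (by omega) (by omega)) outcomeProb_nonneg

lemma prob_alarm_and_staleBad_succ_le (hm : (m : ℕ) + 1 + 1 < M) :
    outcomeProb μ X (fun x => (D.Quiet E m x ∧
        D.Alarm x (D.lastReset x (E.start m)) (E.start m + D.period) (E.finish m)) ∧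
          D.StaleBad E ⟨m + 1, Nat.lt_of_succ_lt hm⟩ x) ≤
      errorBound p q * outcomeProb μ X (fun x => D.Quiet E m x ∧ D.StaleBad E m x) := by
  have := h.isProbabilityMeasure
  refine (h.prob_and_staleBad_le (m := ⟨m + 1, Nat.lt_of_succ_lt hm⟩) hm
    (dependsOn_and ((dependsOn_noReset _ _).mono (timeBlock_mono le_rfl (Nat.sub_le _ _)))
      (dependsOn_alarm_lastReset (E.one_le_start m) (Nat.le_add_right _ _)
        (E.start_lt_finish m).le))).trans ?_
  exact mul_le_mul_of_nonneg_left (outcomeProb_mono fun x hx => ⟨hx.1, Or.inl hx.2⟩)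
    h.errorBound_nonneg

lemma prob_missed_and_badDetection_succ_le (hm : (m : ℕ) + 1 + 1 < M) :
    outcomeProb μ X (fun x => D.Missed E m x ∧
        ¬ D.Alarm x (D.lastReset x (E.start m)) (E.start m + D.halfL) (E.finish m + D.halfL) ∧
          D.BadDetection x (D.lastReset x (E.start m)) (E.finish m + D.period)
            (E.finish ⟨m + 1, Nat.lt_of_succ_lt hm⟩)) ≤
      doubleErrorBound p q * outcomeProb μ X (D.Missed E m) := by
  have hlen := h.length m
  have hL := h.L_eq
  have hw := h.window_add_period
  have hd := h.period_le_halfL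
  have hd0 := h.period_pos
  have hT := E.finish_le m
  have hst := E.start_lt_finish m
  refine h.prob_and_lastReset_le (E.one_le_start m) (Nat.le_add_right _ _) (by omega)
    (B := fun s x => ¬ D.Alarm x s (E.start m + D.halfL) (E.finish m + D.halfL) ∧
      D.BadDetection x s (E.finish m + D.period) (E.finish ⟨m + 1, Nat.lt_of_succ_lt hm⟩))
    (dependsOn_noReset _ _) (fun s hs => h.dependsOn_not_alarm_and_badDetection_succ hm
      (hs.trans hst) (by omega) (by omega)) fun s hs => ?_
  have hle := h.prob_not_alarm_and_badDetection_succ_le hm (u := E.start m + D.halfL)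
    (admissible_of_add_period_le hs (by omega)) (hs.trans hst) (by omega)
  have hnonneg : 0 ≤ errorBound p q *
      outcomeProb μ X (fun x => D.Alarm x s (E.start m + D.halfL) (E.finish m)) :=
    mul_nonneg h.errorBound_nonneg outcomeProb_nonneg
  linarith

lemma prob_quiet_and_staleBad_succ_le (hm : (m : ℕ) + 1 + 1 < M) :
    outcomeProb μ X (fun x => D.Quiet E ⟨m + 1, Nat.lt_of_succ_lt hm⟩ x ∧
        D.StaleBad E ⟨m + 1, Nat.lt_of_succ_lt hm⟩ x) ≤
      doubleErrorBound p q * (1 - outcomeProb μ X (D.Quiet E m)) +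
        (errorBound p q * outcomeProb μ X (fun x => D.Quiet E m x ∧ D.StaleBad E m x) +
          doubleErrorBound p q * outcomeProb μ X (D.Missed E m)) := by
  have := h.isProbabilityMeasure
  refine (outcomeProb_mono fun x hx =>
    h.cover_of_quiet_succ (Nat.lt_of_succ_lt hm) hx.1 hx.2).trans ?_
  refine outcomeProb_or_le.trans (add_le_add (h.prob_firstReset_and_staleBad_succ_le hm) ?_)
  exact outcomeProb_or_le.trans (add_le_add (h.prob_alarm_and_staleBad_succ_le hm)
    (h.prob_missed_and_badDetection_succ_le hm))

end DetectionBounds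

end MDB

namespace MDB

section Start

variable {K T M : ℕ} {St Sd : Type*} [MeasurableSpace St] [MeasurableSpace Sd]
  {D : MDB K St Sd} {E : DuelingProblem K T M} {m : Fin M} {b : ℕ} {x : DuelIndex K → Bool}

lemma not_noReset_zero (hb : 0 < b) : ¬ D.NoReset x 0 b :=
  fun hno => hno 0 le_rfl hb (Nat.le_zero.1 (D.lastReset_succ_le x 0))

lemma not_missed_of_eq_zero (hm : (m : ℕ) = 0) : ¬ D.Missed E m x := by
  rw [Missed, E.start_eq_one hm]
  exact not_noReset_zero (by omega)

end Start

section ErrorBounds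

variable {p q : ℝ}

lemma errorBound_le_one (hp : p ≤ 1) (hq : q ≤ 1) : errorBound p q ≤ 1 := by
  unfold errorBound
  nlinarith [mul_nonneg (sub_nonneg.2 hp) (sub_nonneg.2 hq)]

lemma doubleErrorBound_nonneg (hp : 0 ≤ p) (hp' : p ≤ 1) (hq : 0 ≤ q) :
    0 ≤ doubleErrorBound p q := by
  have : 0 ≤ 1 - p := sub_nonneg.2 hp'
  unfold doubleErrorBound errorBound
  positivity

lemma doubleErrorBound_le_errorBound (hp : 0 ≤ p) (hp' : p ≤ 1) (hq : q ≤ 1) :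
    doubleErrorBound p q ≤ errorBound p q := by
  have hle : 0 ≤ (1 - p) * (p * (1 - q)) :=
    mul_nonneg (sub_nonneg.2 hp') (mul_nonneg hp (sub_nonneg.2 hq))
  unfold doubleErrorBound errorBound
  linarith

lemma missed_bound_of_le (hp : 0 ≤ p) (hpq : p ≤ q) (h : p + q ≤ 1 / 2) :
    (1 - p) * (errorBound p q + (1 - errorBound p q) * p) +
      (1 - errorBound p q) * errorBound p q * (p + 2 * q) ≤ p + 2 * q := by
  obtain ⟨r, rfl⟩ : ∃ r, q = p + r := ⟨q - p, by ring⟩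
  have hr : 0 ≤ r := by linarith
  have h1 : 0 ≤ r * (1 - 2 * r - 4 * p) := mul_nonneg hr (by linarith)
  have h2 : 0 ≤ r ^ 3 * (2 - 4 * p) := mul_nonneg (by positivity) (by linarith)
  have h3 : 0 ≤ p * r ^ 2 * (13 - 18 * p) := mul_nonneg (by positivity) (by linarith)
  have h4 : 0 ≤ p ^ 2 * r * (22 - 25 * p) := mul_nonneg (by positivity) (by linarith)
  have h5 : 0 ≤ p ^ 3 * (11 - 11 * p) := mul_nonneg (by positivity) (by linarith)
  have h6 : 0 ≤ 2 * p ^ 2 * r ^ 3 + 7 * p ^ 3 * r ^ 2 + 8 * p ^ 4 * r + 3 * p ^ 5 := by positivity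
  unfold errorBound
  linarith

lemma staleBad_bound_of_ge (hq : 0 ≤ q) (hpq : q ≤ p) (h : p + q ≤ 1 / 2) :
    (1 - p) ^ 2 * (1 - q) * doubleErrorBound p q +
      (errorBound p q - doubleErrorBound p q) * (p + 2 * q - (1 - p) * errorBound p q) +
      doubleErrorBound p q * ((1 - p) * (1 - q)) * (p + 2 * q) ≤
      p + 2 * q - (1 - p) * errorBound p q := by
  obtain ⟨r, rfl⟩ : ∃ r, p = q + r := ⟨p - q, by ring⟩
  have hr : 0 ≤ r := by linarith
  have h1 : 0 ≤ q * r * (2 - 2 * r - 2 * q) := mul_nonneg (by positivity) (by linarith)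
  have h2 : 0 ≤ q ^ 3 * (2 + 22 * r - 32 * r ^ 2 - 30 * (q * r)) :=
    mul_nonneg (by positivity) (by
      have : 0 ≤ r * (1 / 2 - r) := mul_nonneg hr (by linarith)
      have : 0 ≤ r * (1 / 4 - q) := mul_nonneg hr (by linarith)
      linarith)
  have h3 : 0 ≤ q * r ^ 3 * (8 - 2 * r) := mul_nonneg (by positivity) (by linarith)
  have h4 : 0 ≤ q ^ 2 * r ^ 2 * (22 - 14 * r) := mul_nonneg (by positivity) (by linarith)
  have h5 : 0 ≤ q ^ 4 * (7 - 10 * q) := mul_nonneg (by positivity) (by linarith)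
  have h6 : 0 ≤ q ^ 2 + r ^ 4 + q ^ 2 * r ^ 4 + 6 * q ^ 3 * r ^ 3 + 12 * q ^ 4 * r ^ 2 +
    10 * q ^ 5 * r + 3 * q ^ 6 := by positivity
  unfold doubleErrorBound errorBound
  linarith

end ErrorBounds

namespace DetectionBounds

variable {K T M : ℕ} {St Sd : Type*} [MeasurableSpace St] [MeasurableSpace Sd]
  {Ω : Type*} [MeasurableSpace Ω] {D : MDB K St Sd} {E : DuelingProblem K T M} {μ : Measure Ω}
  {X : DuelIndex K → Ω → Bool} {p q : ℝ} {m : Fin M}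
  (h : D.DetectionBounds E μ X p q)

include h

lemma prob_quiet_and_staleBad_le_prob_quiet :
    outcomeProb μ X (fun x => D.Quiet E m x ∧ D.StaleBad E m x) ≤
      outcomeProb μ X (D.Quiet E m) :=
  have := h.isProbabilityMeasure
  outcomeProb_mono fun _ hx => hx.1

lemma prob_missed_succ_le_errorBound_add (hm : (m : ℕ) + 1 < M) :
    outcomeProb μ X (D.Missed E ⟨m + 1, hm⟩) ≤ errorBound p q +
      (1 - errorBound p q) * outcomeProb μ X (fun x => D.Quiet E m x ∧ D.StaleBad E m x) := by
  have hle := mul_le_mul_of_nonneg_left (h.prob_quiet_and_staleBad_le_prob_quiet (m := m))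
    h.errorBound_nonneg
  have hsucc := h.prob_missed_succ_le hm
  linarith

lemma prob_missed_succ_le_of_le (hpq : p ≤ q) (hsum : p + q ≤ 1 / 2) (hm : (m : ℕ) + 1 < M)
    (hmissed : (1 - p) * outcomeProb μ X (D.Missed E m) ≤ p + 2 * q) :
    (1 - p) * outcomeProb μ X (D.Missed E ⟨m + 1, hm⟩) ≤ p + 2 * q := by
  have hp : 0 ≤ 1 - p := sub_nonneg.2 h.p_le_one
  have he : 0 ≤ 1 - errorBound p q := sub_nonneg.2 (errorBound_le_one h.p_le_one h.q_le_one)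
  have hsucc := mul_le_mul_of_nonneg_left (h.prob_missed_succ_le_errorBound_add hm) hp
  have hbad := mul_le_mul_of_nonneg_left (h.prob_quiet_and_staleBad_le hm) (mul_nonneg hp he)
  have hprev := mul_le_mul_of_nonneg_left hmissed (mul_nonneg he h.errorBound_nonneg)
  linarith [missed_bound_of_le h.p_nonneg hpq hsum]

lemma prob_missed_succ_le_of_staleBad (hm : (m : ℕ) + 1 < M)
    (hbad : (1 - p) ^ 2 * (1 - q) *
        outcomeProb μ X (fun x => D.Quiet E m x ∧ D.StaleBad E m x) ≤
      p + 2 * q - (1 - p) * errorBound p q) :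
    (1 - p) * outcomeProb μ X (D.Missed E ⟨m + 1, hm⟩) ≤ p + 2 * q := by
  have hsucc := mul_le_mul_of_nonneg_left (h.prob_missed_succ_le_errorBound_add hm)
    (sub_nonneg.2 h.p_le_one)
  have hcoeff : 1 - errorBound p q = (1 - p) * (1 - q) := by
    unfold errorBound
    ring
  rw [hcoeff] at hsucc
  linarith

lemma prob_staleBad_succ_le_of_ge (hqp : q ≤ p) (hsum : p + q ≤ 1 / 2)
    (hm : (m : ℕ) + 1 + 1 < M)
    (hmissed : (1 - p) * outcomeProb μ X (D.Missed E m) ≤ p + 2 * q)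
    (hbad : (1 - p) ^ 2 * (1 - q) *
        outcomeProb μ X (fun x => D.Quiet E m x ∧ D.StaleBad E m x) ≤
      p + 2 * q - (1 - p) * errorBound p q) :
    (1 - p) ^ 2 * (1 - q) * outcomeProb μ X (fun x =>
        D.Quiet E ⟨m + 1, Nat.lt_of_succ_lt hm⟩ x ∧
          D.StaleBad E ⟨m + 1, Nat.lt_of_succ_lt hm⟩ x) ≤
      p + 2 * q - (1 - p) * errorBound p q := by
  have hp : 0 ≤ 1 - p := sub_nonneg.2 h.p_le_one
  have hq : 0 ≤ 1 - q := sub_nonneg.2 h.q_le_one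
  have hκ := doubleErrorBound_nonneg h.p_nonneg h.p_le_one h.q_nonneg
  have hκe := sub_nonneg.2 (doubleErrorBound_le_errorBound h.p_nonneg h.p_le_one h.q_le_one)
  have hquiet := mul_le_mul_of_nonneg_left (h.prob_quiet_and_staleBad_le_prob_quiet (m := m)) hκ
  have hsucc := h.prob_quiet_and_staleBad_succ_le hm
  set bad := outcomeProb μ X (fun x => D.Quiet E m x ∧ D.StaleBad E m x)
  set missed := outcomeProb μ X (D.Missed E m)
  have hstep := mul_le_mul_of_nonneg_left
    (hsucc.trans (show _ ≤ doubleErrorBound p q +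
      (errorBound p q - doubleErrorBound p q) * bad + doubleErrorBound p q * missed by linarith))
    (mul_nonneg (pow_nonneg hp 2) hq)
  have hprevBad := mul_le_mul_of_nonneg_left hbad hκe
  have hprevMissed := mul_le_mul_of_nonneg_left hmissed (mul_nonneg hκ (mul_nonneg hp hq))
  linarith [staleBad_bound_of_ge h.q_nonneg hqp hsum]

lemma not_quiet_of_eq_zero (hm : (m : ℕ) = 0) {x : DuelIndex K → Bool} : ¬ D.Quiet E m x := by
  have hlen := h.length m
  have hst := E.one_le_start m
  rw [Quiet, E.start_eq_one hm]
  exact not_noReset_zero (by omega)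

lemma prob_missed_le_and_prob_staleBad_le (hsum : p + q ≤ 1 / 2) (n : ℕ) (hn : n < M) :
    (1 - p) * outcomeProb μ X (D.Missed E ⟨n, hn⟩) ≤ p + 2 * q ∧
    (q ≤ p → n + 1 < M → (1 - p) ^ 2 * (1 - q) *
        outcomeProb μ X (fun x => D.Quiet E ⟨n, hn⟩ x ∧ D.StaleBad E ⟨n, hn⟩ x) ≤
      p + 2 * q - (1 - p) * errorBound p q) := by
  induction n with
  | zero =>
    have hp := h.p_nonneg
    have hq := h.q_nonneg
    have hbound : 0 ≤ p + 2 * q - (1 - p) * errorBound p q := by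
      unfold errorBound
      nlinarith [mul_nonneg hp hq, mul_nonneg (mul_nonneg hp hq) (sub_nonneg.2 h.p_le_one)]
    simp only [outcomeProb, not_missed_of_eq_zero, h.not_quiet_of_eq_zero, false_and,
      Set.ofPred_false, measureReal_empty, mul_zero]
    exact ⟨by positivity, fun _ _ => hbound⟩
  | succ n ih =>
    obtain ⟨hmissed, hbad⟩ := ih (Nat.lt_of_succ_lt hn)
    refine ⟨?_, fun hqp hn' => h.prob_staleBad_succ_le_of_ge (m := ⟨n, Nat.lt_of_succ_lt hn⟩)
      hqp hsum hn' hmissed (hbad hqp hn)⟩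
    rcases le_total p q with hpq | hqp
    · exact h.prob_missed_succ_le_of_le (m := ⟨n, Nat.lt_of_succ_lt hn⟩) hpq hsum hn hmissed
    · exact h.prob_missed_succ_le_of_staleBad (m := ⟨n, Nat.lt_of_succ_lt hn⟩) hn (hbad hqp hn)

lemma prob_fails_le_two_mul (m : Fin M) : outcomeProb μ X (D.Fails E m) ≤ 2 * (p + q) := by
  have := h.isProbabilityMeasure
  rcases le_or_gt (p + q) (1 / 2) with hsum | hsum
  · linarith [(h.prob_missed_le_and_prob_staleBad_le hsum m m.2).1, h.prob_fails_le m]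
  · exact outcomeProb_le_one.trans (by linarith)

end DetectionBounds

end MDB

/-! ### Independence of the time steps -/

section Families

variable {ι κ Ω β γ : Type*} [MeasurableSpace Ω] {μ : Measure Ω} [MeasurableSpace β]
  [MeasurableSpace γ]

lemma iIndepFun_prodMk [Finite ι] {f : ι → Ω → β} {g : ι → Ω → γ}
    (hf : ∀ i, Measurable (f i)) (hg : ∀ i, Measurable (g i)) (hf_ind : iIndepFun f μ)
    (hg_ind : iIndepFun g μ) (hfg : IndepFun (fun ω i => f i ω) (fun ω i => g i ω) μ) :
    iIndepFun (fun i ω => (f i ω, g i ω)) μ := by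
  have := hf_ind.isProbabilityMeasure
  have := Fintype.ofFinite ι
  have hf' : Measurable fun ω i => f i ω := measurable_pi_lambda _ hf
  have hg' : Measurable fun ω i => g i ω := measurable_pi_lambda _ hg
  have hpair i : μ.map (fun ω => (f i ω, g i ω)) = (μ.map (f i)).prod (μ.map (g i)) :=
    (indepFun_iff_map_prod_eq_prod_map_map (hf i).aemeasurable (hg i).aemeasurable).1
      (hfg.comp (measurable_pi_apply i) (measurable_pi_apply i))
  have hjoint := (indepFun_iff_map_prod_eq_prod_map_map hf'.aemeasurable hg'.aemeasurable).1 hfg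
  rw [hf_ind.map_fun_eq_pi_map fun i => (hf i).aemeasurable,
    hg_ind.map_fun_eq_pi_map fun i => (hg i).aemeasurable] at hjoint
  have hswap := measurePreserving_arrowProdEquivProdArrow β γ ι (fun i => μ.map (f i))
    (fun i => μ.map (g i))
  rw [iIndepFun_iff_map_fun_eq_pi_map fun i => ((hf i).prodMk (hg i)).aemeasurable]
  simp_rw [hpair]
  rw [← hswap.symm.map_eq, ← hjoint, Measure.map_map (MeasurableEquiv.measurable _)
    (hf'.prodMk hg')]
  rfl

lemma iIndepFun_curry {f : ι × κ → Ω → β} (hf : ∀ c, Measurable (f c)) (h : iIndepFun f μ) :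
    iIndepFun (fun i ω (k : κ) => f (i, k) ω) μ := by
  have := h.isProbabilityMeasure
  have hrow i : μ.map (fun ω (k : κ) => f (i, k) ω) =
      Measure.infinitePi fun k => μ.map (f (i, k)) :=
    (iIndepFun_iff_map_fun_eq_infinitePi_map fun k => hf (i, k)).1
      (h.precomp (g := fun k => (i, k)) (Prod.mk_right_injective i))
  have hprob c : IsProbabilityMeasure (μ.map (f c)) :=
    Measure.isProbabilityMeasure_map (hf c).aemeasurable
  rw [iIndepFun_iff_map_fun_eq_infinitePi_map fun i => measurable_pi_lambda _ fun k => hf _]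
  simp_rw [hrow]
  rw [← Measure.infinitePi_map_curry (μ := fun i k => μ.map (f (i, k))),
    ← (iIndepFun_iff_map_fun_eq_infinitePi_map hf).1 h,
    Measure.map_map (MeasurableEquiv.measurable _) (measurable_pi_lambda _ hf)]
  rfl

end Families

/-- What a time step may reveal: the outcomes of the duels of all pairs of arms, and the seed of
the black-box algorithm. -/
abbrev StepData (K : ℕ) (Sd : Type*) : Type _ := (Fin K → Fin K → Bool) × Sd

/-- The random outcomes and seed of time step `t`. -/
def stepData {K : ℕ} {Ω Sd : Type*} (X : ℕ → Fin K → Fin K → Ω → Bool) (ξ : ℕ → Ω → Sd)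
    (t : ℕ) (ω : Ω) : StepData K Sd :=
  (fun i j => X t i j ω, ξ t ω)

/-- The outcome variables, indexed by time steps and pairs of arms. -/
def outcomeVar {K : ℕ} {Ω : Type*} (X : ℕ → Fin K → Fin K → Ω → Bool) (c : DuelIndex K) (ω : Ω) :
    Bool :=
  X c.1 c.2.1 c.2.2 ω

lemma DuelingProblem.segment_subset_Icc {K T M : ℕ} (E : DuelingProblem K T M) (m : Fin M) :
    E.segment m ⊆ Finset.Icc 1 T := fun t ht => by
  have := E.one_le_start m
  have := E.finish_le m
  rw [mem_segment] at ht
  exact Finset.mem_Icc.2 (by omega)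

namespace DuelingProblem.IsExperiment

variable {K T M : ℕ} {E : DuelingProblem K T M} {Ω Sd : Type*} [MeasurableSpace Ω]
  [MeasurableSpace Sd] {μ : Measure Ω} {X : ℕ → Fin K → Fin K → Ω → Bool} {ξ : ℕ → Ω → Sd}
  {m : Fin M} {t t' : ℕ}

lemma isProbabilityMeasure (h : E.IsExperiment μ X ξ) : IsProbabilityMeasure μ :=
  h.indep_seeds.isProbabilityMeasure

lemma iIndepFun_outcomeVar (h : E.IsExperiment μ X ξ) :
    iIndepFun (fun c : timeBlock K 1 (T + 1) => outcomeVar X c) μ := by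
  refine h.indep_outcomes.precomp
    (g := fun c : timeBlock K 1 (T + 1) =>
      (⟨c.1.1, Finset.mem_Icc.2 ⟨c.2.1, Nat.lt_succ_iff.1 c.2.2⟩⟩, c.1.2))
    fun c c' hcc' => ?_
  simp only [Prod.mk.injEq, Subtype.mk.injEq] at hcc'
  exact Subtype.ext (Prod.ext hcc'.1 hcc'.2)

lemma measurable_outcomes (h : E.IsExperiment μ X ξ) (t : ℕ) :
    Measurable fun ω (i j : Fin K) => X t i j ω :=
  measurable_pi_lambda _ fun i => measurable_pi_lambda _ fun j => h.measurable_outcome t i j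

lemma measurable_stepData (h : E.IsExperiment μ X ξ) (t : ℕ) : Measurable (stepData X ξ t) :=
  (h.measurable_outcomes t).prodMk (h.measurable_seed t)

lemma measurable_curry_pairs :
    Measurable fun (z : Fin K × Fin K → Bool) (i j : Fin K) => z (i, j) := by
  fun_prop

lemma iIndepFun_stepData (h : E.IsExperiment μ X ξ) :
    iIndepFun (fun t : Finset.Icc 1 T => stepData X ξ t) μ := by
  refine iIndepFun_prodMk (fun t => h.measurable_outcomes t) (fun t => h.measurable_seed t) ?_
    h.indep_seeds ?_
  · exact (iIndepFun_curry (fun c => h.measurable_outcome _ _ _) h.indep_outcomes).comp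
      (fun _ z i j => z (i, j)) fun _ => measurable_curry_pairs
  · exact h.indep.comp (φ := fun z (t : Finset.Icc 1 T) (i j : Fin K) => z (t, i, j)) (ψ := id)
      (by fun_prop) measurable_id

lemma identDistrib_outcomes (h : E.IsExperiment μ X ξ) (ht : t ∈ E.segment m)
    (ht' : t' ∈ E.segment m) :
    IdentDistrib (fun ω (i j : Fin K) => X t i j ω) (fun ω (i j : Fin K) => X t' i j ω) μ μ := by
  have := h.isProbabilityMeasure
  have hind : ∀ r ∈ E.segment m, iIndepFun (fun a : Fin K × Fin K => X r a.1 a.2) μ :=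
    fun r hr => h.indep_outcomes.precomp (g := fun a => (⟨r, E.segment_subset_Icc m hr⟩, a))
      (Prod.mk_right_injective _)
  exact (IdentDistrib.pi (fun a => identDistrib_bool (h.measurable_outcome _ _ _)
    (h.measurable_outcome _ _ _)
    ((h.bernoulli m t ht a.1 a.2).trans (h.bernoulli m t' ht' a.1 a.2).symm))
    (hind t ht) (hind t' ht')).comp measurable_curry_pairs

lemma identDistrib_stepData (h : E.IsExperiment μ X ξ) (ht : t ∈ E.segment m)
    (ht' : t' ∈ E.segment m) : IdentDistrib (stepData X ξ t) (stepData X ξ t') μ μ := by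
  have := h.isProbabilityMeasure
  have hind : ∀ r ∈ E.segment m, IndepFun (fun ω (i j : Fin K) => X r i j ω) (ξ r) μ := by
    intro r hr
    let r' : Finset.Icc 1 T := ⟨r, E.segment_subset_Icc m hr⟩
    have hseed : Measurable fun z : Finset.Icc 1 T → Sd => z r' := measurable_pi_apply r'
    exact h.indep.comp (φ := fun z (i j : Fin K) => z (r', i, j)) (by fun_prop) hseed
  exact (h.identDistrib_outcomes ht ht').prodMk (h.identDistrib t (E.segment_subset_Icc m ht) t'
    (E.segment_subset_Icc m ht')) (hind t ht) (hind t' ht')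

variable {β : Type*} [MeasurableSpace β] {f : (ℕ → StepData K Sd) → β}

lemma nonempty_stepData (h : E.IsExperiment μ X ξ) : Nonempty (StepData K Sd) := by
  have := h.isProbabilityMeasure
  exact (nonempty_of_isProbabilityMeasure μ).map (stepData X ξ 0)

lemma identDistrib_of_dependsOn (h : E.IsExperiment μ X ξ) {n : ℕ} {θ θ' : ℕ → ℕ}
    (hf : Measurable f) (hdep : DependsOn f (Set.Iio n)) (hθ : Set.InjOn θ (Set.Iio n))
    (hθ' : Set.InjOn θ' (Set.Iio n)) (hm : Set.MapsTo θ (Set.Iio n) (E.segment m))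
    (hm' : Set.MapsTo θ' (Set.Iio n) (E.segment m)) :
    IdentDistrib (fun ω => f fun j => stepData X ξ (θ j) ω)
      (fun ω => f fun j => stepData X ξ (θ' j) ω) μ μ := by
  have := h.nonempty_stepData
  obtain ⟨f', hf', hff'⟩ := exists_measurable_comp_of_dependsOn
    (g := fun j : Set.Iio n => (j : ℕ)) hf hdep Subtype.range_coe.superset
  have hind {η : ℕ → ℕ} (hη : Set.InjOn η (Set.Iio n))
      (hmη : Set.MapsTo η (Set.Iio n) (E.segment m)) :
      iIndepFun (fun j : Set.Iio n => stepData X ξ (η j)) μ :=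
    h.iIndepFun_stepData.precomp (g := fun j => ⟨η j, E.segment_subset_Icc m (hmη j.2)⟩)
      fun i j hij => Subtype.ext (hη i.2 j.2 (congrArg Subtype.val hij))
  simp only [hff']
  exact (IdentDistrib.pi (fun j => h.identDistrib_stepData (hm j.2) (hm' j.2)) (hind hθ hm)
    (hind hθ' hm')).comp hf'

lemma indepFun_outcomes_of_dependsOn (h : E.IsExperiment μ X ξ) {n c : ℕ} {θ : ℕ → ℕ}
    {B : (DuelIndex K → Bool) → Prop} (hB : DependsOn B (timeBlock K 1 c)) (hc : 1 ≤ c)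
    (hcT : c ≤ T + 1) (hf : Measurable f) (hdep : DependsOn f (Set.Iio n))
    (hθ : Set.MapsTo θ (Set.Iio n) (Set.Ico c (T + 1))) :
    IndepFun (fun ω => B fun a => outcomeVar X a ω)
      (fun ω => f fun j => stepData X ξ (θ j) ω) μ := by
  have := h.nonempty_stepData
  let table (z : ℕ → StepData K Sd) (a : DuelIndex K) : Bool := (z a.1).1 a.2.1 a.2.2
  have htable a : Measurable fun z => table z a := by fun_prop
  exact indepFun_of_dependsOn (Y := stepData X ξ) (f := fun z => B (table z))
    (g := fun z => f fun j => z (θ j)) (C := Set.Ico 1 c) (C' := Set.Ico c (T + 1))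
    h.measurable_stepData (Finset.finite_toSet _) h.iIndepFun_stepData
    (measurableSet_setOfPred.1 (measurableSet_of_dependsOn htable (finite_timeBlock K 1 c) hB))
    (hf.comp (measurable_pi_lambda _ fun _ => measurable_pi_apply _))
    (fun z z' hz => hB fun a ha => congrFun₂ (congrArg Prod.fst (hz a.1 ha)) a.2.1 a.2.2)
    (fun z z' hz => hdep fun j hj => hz _ (hθ hj))
    (fun t ht => Finset.mem_coe.2 (Finset.mem_Icc.2 (by have := ht.1; have := ht.2; omega)))
    (fun t ht => Finset.mem_coe.2 (Finset.mem_Icc.2 (by have := ht.1; have := ht.2; omega)))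
    (Set.disjoint_left.2 fun _ ht ht' => ht.2.not_ge ht'.1)

end DuelingProblem.IsExperiment

/-! ### The regret of a segment -/

namespace DuelingProblem

variable {K T M : ℕ} (E : DuelingProblem K T M) (m : Fin M)

lemma gap_mem_Icc (i : Fin K) : E.gap m i ∈ Set.Icc 0 (1 / 2 : ℝ) := by
  have hself := E.P_add m (E.best m) (E.best m)
  have hle : 1 / 2 ≤ E.P m (E.best m) i := by
    rcases eq_or_ne i (E.best m) with rfl | hi
    · linarith
    · exact (E.best_wins m i hi).le
  have hone := (E.P_mem m (E.best m) i).2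
  rw [gap]
  exact ⟨by linarith, by linarith⟩

lemma strongRegret_mem_Icc (a : Fin K × Fin K) : E.strongRegret m a ∈ Set.Icc 0 (1 : ℝ) := by
  have h₁ := E.gap_mem_Icc m a.1
  have h₂ := E.gap_mem_Icc m a.2
  rw [strongRegret]
  exact ⟨by linarith [h₁.1, h₂.1], by linarith [h₁.2, h₂.2]⟩

lemma binaryStrongRegret_nonneg (a : Fin K × Fin K) : 0 ≤ E.binaryStrongRegret m a :=
  Int.cast_nonneg (Int.ceil_nonneg (E.strongRegret_mem_Icc m a).1)

lemma binaryStrongRegret_le_one (a : Fin K × Fin K) : E.binaryStrongRegret m a ≤ 1 := by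
  have h : ⌈E.strongRegret m a⌉ ≤ 1 :=
    Int.ceil_le.2 (by exact_mod_cast (E.strongRegret_mem_Icc m a).2)
  rw [binaryStrongRegret]
  exact_mod_cast h

lemma sum_binaryStrongRegret_le_card {ι : Type*} (s : Finset ι) (a : ι → Fin K × Fin K) :
    ∑ i ∈ s, E.binaryStrongRegret m (a i) ≤ s.card :=
  (Finset.sum_le_card_nsmul s _ 1 fun i _ => E.binaryStrongRegret_le_one m (a i)).trans_eq
    (by rw [nsmul_one])

end DuelingProblem

namespace DuelingAlg

variable {K T M : ℕ} {St Sd : Type*} [MeasurableSpace St] [MeasurableSpace Sd]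
  (A : DuelingAlg K St Sd)

/-- The internal state of the black-box algorithm after `k` time steps, where the `j`-th time step
of the algorithm (counting from `0`) has data `z j`. Unlike in `stateFrom`, the time steps need not
be consecutive. -/
def run (z : ℕ → StepData K Sd) : ℕ → St
  | 0 => A.init
  | k + 1 =>
    let a := A.select (run z k) (z k).2
    A.update (run z k) (z k).2 ((z k).1 a.1 a.2)

/-- The pair played in the `k`-th time step of the black-box algorithm. -/
def runPair (z : ℕ → StepData K Sd) (k : ℕ) : Fin K × Fin K := A.select (A.run z k) (z k).2

/-- The binary strong regret of the first `n` time steps of the black-box algorithm under the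
preferences of segment `m`. -/
def runRegret (E : DuelingProblem K T M) (m : Fin M) (n : ℕ) (z : ℕ → StepData K Sd) : ℝ :=
  ∑ j ∈ Finset.range n, E.binaryStrongRegret m (A.runPair z j)

lemma dependsOn_run (k : ℕ) : DependsOn (fun z => A.run z k) (Set.Iio k) := by
  induction k with
  | zero => exact fun z z' _ => rfl
  | succ k ih =>
    intro z z' h
    have hk : z k = z' k := h k (Set.mem_Iio.2 k.lt_succ_self)
    have hrun : A.run z k = A.run z' k := ih fun j hj => h j (Nat.lt_succ_of_lt hj)
    simp only [run, hrun, hk]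

lemma dependsOn_runRegret (E : DuelingProblem K T M) (m : Fin M) (n : ℕ) :
    DependsOn (A.runRegret E m n) (Set.Iio n) := fun z z' h =>
  Finset.sum_congr rfl fun j hj => by
    have hj : j < n := Finset.mem_range.1 hj
    have hrun : A.run z j = A.run z' j := A.dependsOn_run j fun i hi => h i (lt_trans hi hj)
    rw [runPair, runPair, hrun, h j hj]

lemma runRegret_nonneg (E : DuelingProblem K T M) (m : Fin M) (n : ℕ) (z : ℕ → StepData K Sd) :
    0 ≤ A.runRegret E m n z :=
  Finset.sum_nonneg fun _ _ => E.binaryStrongRegret_nonneg m _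

lemma runRegret_le (E : DuelingProblem K T M) (m : Fin M) (n : ℕ) (z : ℕ → StepData K Sd) :
    A.runRegret E m n z ≤ n := by
  simpa only [Finset.card_range, runRegret] using
    E.sum_binaryStrongRegret_le_card m (Finset.range n) _

lemma runRegret_mono (E : DuelingProblem K T M) (m : Fin M) (z : ℕ → StepData K Sd) :
    Monotone fun n => A.runRegret E m n z := fun _ _ h =>
  Finset.sum_le_sum_of_subset_of_nonneg (Finset.range_mono h)
    fun _ _ _ => E.binaryStrongRegret_nonneg m _

lemma stateFrom_eq_run (x : ℕ → Fin K → Fin K → Bool) (u : ℕ → Sd) (t₀ k : ℕ) :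
    A.stateFrom x u t₀ k = A.run (fun j => (x (t₀ + j), u (t₀ + j))) k := by
  induction k with
  | zero => rfl
  | succ k ih => simp only [stateFrom, run, ih]

lemma regretAlone_eq_runRegret (E : DuelingProblem K T M) (x : ℕ → Fin K → Fin K → Bool)
    (u : ℕ → Sd) (m : Fin M) :
    A.regretAlone E x u m = A.runRegret E m (E.segment m).card
      (fun j => (x (E.start m + j), u (E.start m + j))) := by
  have hIco : E.segment m = Finset.Ico (E.start m) (E.finish m) := rfl
  rw [regretAlone, runRegret, hIco, Finset.sum_Ico_eq_sum_range, Nat.card_Ico]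
  refine Finset.sum_congr rfl fun j _ => ?_
  have hsub : E.start m + j - E.cp m.castSucc = j := Nat.add_sub_cancel_left _ _
  rw [runPair, ← A.stateFrom_eq_run, played, hsub]
  rfl

end DuelingAlg

section Count

variable {p : ℕ → Prop} [DecidablePred p]

lemma count_nth_of_lt_count {j n : ℕ} (h : j < Nat.count p n) : Nat.count p (Nat.nth p j) = j :=
  Nat.count_nth fun hf => h.trans_le (Nat.count_le_card hf n)

lemma sum_range_ite_count {β : Type*} [AddCommMonoidWithOne β] (g : ℕ → β) (n : ℕ) :
    (∑ k ∈ Finset.range n, if p k then g (Nat.count p k) else 1) =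
      Nat.count (fun k => ¬ p k) n + ∑ j ∈ Finset.range (Nat.count p n), g j := by
  induction n with
  | zero => simp
  | succ n ih =>
    rw [Finset.sum_range_succ, ih, Nat.count_succ, Nat.count_succ]
    by_cases h : p n
    · simp only [h, not_true, if_true, if_false, add_zero, Finset.sum_range_succ, add_assoc]
    · simp only [h, not_false_iff, if_true, if_false, add_zero, Nat.cast_add, Nat.cast_one]
      abel

lemma count_mod_lt_le (N : ℕ) {d : ℕ} (hd : 0 < d) (n : ℕ) :
    Nat.count (fun k => k % d < N) n ≤ (n / d + 1) * N := by
  have hperiod : Nat.count (fun k => k % d < N) d ≤ N := by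
    rw [Nat.count_eq_card_filter_range]
    refine (Finset.card_le_card (t := Finset.range N) fun k hk => ?_).trans_eq
      (Finset.card_range N)
    obtain ⟨hkd, hkN⟩ := Finset.mem_filter.1 hk
    rwa [Nat.mod_eq_of_lt (Finset.mem_range.1 hkd), ← Finset.mem_range] at hkN
  have hmul (c : ℕ) : Nat.count (fun k => k % d < N) (c * d) ≤ c * N := by
    induction c with
    | zero => simp
    | succ c ih =>
      simp only [add_mul, one_mul, Nat.count_add, Nat.mul_add_mod_self_right]
      exact add_le_add ih hperiod
  have hn : n ≤ (n / d + 1) * d := by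
    have := Nat.lt_mul_div_succ n hd
    rw [mul_comm]
    exact this.le
  exact (Nat.count_monotone _ hn).trans (hmul _)

end Count

namespace MDB

variable {K T M : ℕ} {St Sd : Type*} [MeasurableSpace St] [MeasurableSpace Sd]

/-- The black-box algorithm is run in the `k`-th time step (counting from `0`) after a reset. -/
def Exploits (D : MDB K St Sd) (k : ℕ) : Prop := ¬ k % D.period < K * (K - 1) / 2

instance (D : MDB K St Sd) : DecidablePred D.Exploits :=
  fun k => inferInstanceAs (Decidable (¬ k % D.period < K * (K - 1) / 2))

/-- The `j`-th time step (counting from `0`) of the black-box algorithm after a reset at time `s`,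
if no further reset intervenes. -/
def exploitTime (D : MDB K St Sd) (s j : ℕ) : ℕ := s + 1 + Nat.nth D.Exploits j

/-- The number of time steps of the black-box algorithm after a reset at time `s` and before time
`v`, if no further reset intervenes. -/
def exploitCount (D : MDB K St Sd) (s v : ℕ) : ℕ := Nat.count D.Exploits (v - (s + 1))

/-- The data of the `j`-th time step of the black-box algorithm after a reset at time `s`. -/
def exploitData (D : MDB K St Sd) (x : ℕ → Fin K → Fin K → Bool) (u : ℕ → Sd) (s j : ℕ) :
    StepData K Sd :=
  (x (D.exploitTime s j), u (D.exploitTime s j))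

/-- The fraction of the time steps that MDB spends on the detection. -/
def explorationRate (D : MDB K St Sd) : ℝ := ((K * (K - 1) / 2 : ℕ) : ℝ) / D.period

variable {D : MDB K St Sd} {E : DuelingProblem K T M}

lemma explorationRate_nonneg : 0 ≤ D.explorationRate := by
  unfold explorationRate
  positivity

lemma injOn_exploitTime (s v : ℕ) : Set.InjOn (D.exploitTime s) (Set.Iio (D.exploitCount s v)) :=
  Set.InjOn.comp (add_right_injective (s + 1)).injOn
    (Set.LeftInvOn.injOn (f₁' := Nat.count D.Exploits) fun _ hj => count_nth_of_lt_count hj)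
    (Set.mapsTo_univ _ _)

lemma lt_exploitTime (s j : ℕ) : s < D.exploitTime s j := by
  unfold exploitTime
  omega

lemma exploitTime_lt {s v j : ℕ} (hj : j < D.exploitCount s v) : D.exploitTime s j < v := by
  have := Nat.nth_lt_of_lt_count hj
  unfold exploitTime
  omega

lemma exploitTime_count {s k : ℕ} (hk : D.Exploits k) :
    D.exploitTime s (Nat.count D.Exploits k) = s + 1 + k := by
  rw [exploitTime, Nat.nth_count hk]

lemma exploitCount_le (s v : ℕ) : D.exploitCount s v ≤ v - (s + 1) := Nat.count_le _

section AfterReset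

variable {x : ℕ → Fin K → Fin K → Bool} {u : ℕ → Sd} {s k : ℕ}

lemma inner_stateFrom_of_reset (hd : K * (K - 1) / 2 ≤ D.period) (hw : 0 < D.w)
    (hs : D.lastReset (outcomeTable x) (s + 1) = s) :
    (D.stateFrom x u 1 s).inner = D.alg.init := by
  classical
  rcases s with _ | s
  · rfl
  · have htau : (D.stateFrom x u 1 (s + 1)).tau = s + 1 := by
      rw [tau_stateFrom hd hw, add_comm 1, hs]
    have htau' : (D.stateFrom x u 1 s).tau ≤ s := by
      rw [tau_stateFrom hd hw, add_comm 1]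
      exact D.lastReset_succ_le _ s
    rw [stateFrom, next_tau] at htau
    split_ifs at htau with htrig
    · rw [stateFrom, next, if_pos htrig]
      rfl
    · omega

lemma tau_stateFrom_of_reset (hd : K * (K - 1) / 2 ≤ D.period) (hw : 0 < D.w)
    (hs : D.lastReset (outcomeTable x) (s + 1) = s)
    (hno : ¬ D.Alarm (outcomeTable x) s (s + 1) (s + 1 + k)) :
    (D.stateFrom x u 1 (s + k)).tau = s := by
  rw [tau_stateFrom hd hw, show 1 + (s + k) = s + 1 + k by omega]
  exact lastReset_eq_of_not_alarm hs (by omega) hno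

lemma detectionPair_eq_none_iff_exploits (hd : K * (K - 1) / 2 ≤ D.period) (hw : 0 < D.w)
    (hs : D.lastReset (outcomeTable x) (s + 1) = s)
    (hno : ¬ D.Alarm (outcomeTable x) s (s + 1) (s + 1 + k)) :
    D.detectionPair (s + 1 + k) (D.stateFrom x u 1 (s + k)) = none ↔ D.Exploits k := by
  rw [detectionPair_eq_none, tau_stateFrom_of_reset hd hw hs hno,
    show s + 1 + k - s - 1 = k by omega]
  rfl

lemma inner_stateFrom (hd : K * (K - 1) / 2 ≤ D.period) (hw : 0 < D.w)
    (hs : D.lastReset (outcomeTable x) (s + 1) = s)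
    (hno : ¬ D.Alarm (outcomeTable x) s (s + 1) (s + 1 + k)) :
    (D.stateFrom x u 1 (s + k)).inner =
      D.alg.run (D.exploitData x u s) (Nat.count D.Exploits k) := by
  induction k with
  | zero => exact inner_stateFrom_of_reset hd hw hs
  | succ k ih =>
    have hno' : ¬ D.Alarm (outcomeTable x) s (s + 1) (s + 1 + k) :=
      fun h => hno (h.mono le_rfl (by omega))
    have ht : 1 + (s + k) = s + 1 + k := by omega
    have hquiet : ¬ D.triggers (s + 1 + k) (x (s + 1 + k)) (D.stateFrom x u 1 (s + k)) := by
      rw [← ht, (tracks_stateFrom hd x u one_pos (s + k)).triggers_iff hd hw,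
        tau_stateFrom_of_reset hd hw hs hno', ht]
      exact fun h => hno (alarm_succ_iff.2 ⟨_, by omega, h⟩)
    have hpair := detectionPair_eq_none_iff_exploits (u := u) hd hw hs hno'
    rw [← add_assoc, stateFrom, ht, next, if_neg hquiet, Nat.count_succ]
    rcases hp : D.detectionPair (s + 1 + k) (D.stateFrom x u 1 (s + k)) with _ | a
    · rw [hp, eq_self, true_iff] at hpair
      simp only [if_pos hpair, DuelingAlg.run, ih hno', exploitData, exploitTime_count hpair]
    · have hk : ¬ D.Exploits k := mt hpair.2 (hp ▸ Option.some_ne_none a)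
      rw [if_neg hk, add_zero, ← ih hno']
      rfl

lemma played_of_exploits (hd : K * (K - 1) / 2 ≤ D.period) (hw : 0 < D.w)
    (hs : D.lastReset (outcomeTable x) (s + 1) = s)
    (hno : ¬ D.Alarm (outcomeTable x) s (s + 1) (s + 1 + k)) (hk : D.Exploits k) :
    D.played x u 1 (s + 1 + k) =
      D.alg.runPair (D.exploitData x u s) (Nat.count D.Exploits k) := by
  have hnone := (detectionPair_eq_none_iff_exploits (u := u) hd hw hs hno).2 hk
  rw [played, show s + 1 + k - 1 = s + k by omega, pair, hnone, DuelingAlg.runPair,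
    ← inner_stateFrom hd hw hs hno, exploitData, exploitTime_count hk]

lemma sum_regret_after_reset_le (hd : K * (K - 1) / 2 ≤ D.period) (hw : 0 < D.w) (m : Fin M)
    {v : ℕ} (hs : D.lastReset (outcomeTable x) (s + 1) = s)
    (hno : ¬ D.Alarm (outcomeTable x) s (s + 1) v) :
    ∑ t ∈ Finset.Ico (s + 1) v, E.binaryStrongRegret m (D.played x u 1 t) ≤
      Nat.count (fun k => ¬ D.Exploits k) (v - (s + 1)) +
        D.alg.runRegret E m (D.exploitCount s v) (D.exploitData x u s) := by
  rw [Finset.sum_Ico_eq_sum_range, DuelingAlg.runRegret, exploitCount, ← sum_range_ite_count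
    (fun j => E.binaryStrongRegret m (D.alg.runPair (D.exploitData x u s) j))]
  refine Finset.sum_le_sum fun k hk => ?_
  have hno' : ¬ D.Alarm (outcomeTable x) s (s + 1) (s + 1 + k) :=
    fun h => hno (h.mono le_rfl (by rw [Finset.mem_range] at hk; omega))
  split_ifs with hx
  · rw [played_of_exploits hd hw hs hno' hx]
  · exact E.binaryStrongRegret_le_one m _

end AfterReset

lemma count_exploration_le {n l : ℕ} (hd : 0 < D.period) (hn : n ≤ l) (hl : D.period ≤ l) :
    (Nat.count (fun k => ¬ D.Exploits k) n : ℝ) ≤ 2 * l * D.explorationRate := by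
  have hcount : Nat.count (fun k => ¬ D.Exploits k) n ≤
      (n / D.period + 1) * (K * (K - 1) / 2) := by
    simpa only [Exploits, not_not] using count_mod_lt_le (K * (K - 1) / 2) hd n
  have hfull : ((n / D.period : ℕ) : ℝ) ≤ l / D.period := Nat.cast_div_le.trans (by gcongr)
  have hpartial : (1 : ℝ) ≤ l / D.period := by
    rw [one_le_div (by exact_mod_cast hd)]
    exact_mod_cast hl
  calc (Nat.count (fun k => ¬ D.Exploits k) n : ℝ)
      ≤ ((n / D.period : ℕ) + 1) * ((K * (K - 1) / 2 : ℕ) : ℝ) := by exact_mod_cast hcount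
    _ ≤ (l / D.period + l / D.period) * ((K * (K - 1) / 2 : ℕ) : ℝ) := by gcongr
    _ = 2 * l * D.explorationRate := by rw [explorationRate]; ring

lemma segment_regret_le_of_reset {x : ℕ → Fin K → Fin K → Bool} {u : ℕ → Sd} {s : ℕ}
    (hd : K * (K - 1) / 2 ≤ D.period) (hd0 : 0 < D.period) (hw : 0 < D.w) (m : Fin M)
    (hl : D.period ≤ (E.segment m).card) (hs : D.lastReset (outcomeTable x) (s + 1) = s)
    (hs1 : E.start m ≤ s + 1) (hs2 : s + 1 ≤ E.start m + D.halfL) (hs3 : s + 1 ≤ E.finish m)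
    (hno : ¬ D.Alarm (outcomeTable x) s (s + 1) (E.finish m)) :
    ∑ t ∈ E.segment m, E.binaryStrongRegret m (D.played x u 1 t) ≤
      D.halfL + 2 * (E.segment m).card * D.explorationRate +
        D.alg.runRegret E m (D.exploitCount s (E.finish m)) (D.exploitData x u s) := by
  have hIco : E.segment m = Finset.Ico (E.start m) (E.finish m) := rfl
  have hbefore : ∑ t ∈ Finset.Ico (E.start m) (s + 1),
      E.binaryStrongRegret m (D.played x u 1 t) ≤ D.halfL := by
    refine (E.sum_binaryStrongRegret_le_card m _ _).trans ?_
    rw [Nat.card_Ico]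
    exact_mod_cast (by omega : s + 1 - E.start m ≤ D.halfL)
  have hafter := sum_regret_after_reset_le (E := E) (u := u) hd hw m hs hno
  have hexplore := count_exploration_le (n := E.finish m - (s + 1)) hd0
    (by rw [E.card_segment]; omega) hl
  rw [hIco, ← Finset.sum_Ico_consecutive _ hs1 hs3, ← hIco]
  linarith

end MDB

/-! ### Expected regret -/

lemma setIntegral_eq_mul_of_indepFun {Ω : Type*} [MeasurableSpace Ω] {μ : Measure Ω}
    {B : Ω → Prop} {f : Ω → ℝ} (hB : MeasurableSet {ω | B ω}) (hf : AEMeasurable f μ)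
    (h : IndepFun B f μ) : ∫ ω in {ω | B ω}, f ω ∂μ = μ.real {ω | B ω} * ∫ ω, f ω ∂μ :=
  Indep.setIntegral_eq_mul (f := id) (measurableSet_setOfPred.1 hB).comap_le h hf
    ⟨{True}, trivial, by ext; simp⟩ aestronglyMeasurable_id

namespace DuelingAlg

variable {K T M : ℕ} {St Sd : Type*} [MeasurableSpace St] [MeasurableSpace Sd]
  (A : DuelingAlg K St Sd)

lemma measurable_runPair {k : ℕ} (h : Measurable fun z => A.run z k) :
    Measurable fun z => A.runPair z k :=
  A.measurable_select.comp (h.prodMk (measurable_pi_apply k).snd)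

lemma measurable_run (k : ℕ) : Measurable fun z => A.run z k := by
  induction k with
  | zero => exact measurable_const
  | succ k ih =>
    have heval : Measurable fun y : (Fin K → Fin K → Bool) × (Fin K × Fin K) =>
        y.1 y.2.1 y.2.2 :=
      measurable_from_prod_countable_left fun a =>
        (measurable_pi_apply a.2).comp (measurable_pi_apply a.1)
    exact A.measurable_update.comp (ih.prodMk ((measurable_pi_apply k).snd.prodMk
      (heval.comp ((measurable_pi_apply k).fst.prodMk (A.measurable_runPair ih)))))

lemma measurable_runRegret (E : DuelingProblem K T M) (m : Fin M) (n : ℕ) :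
    Measurable (A.runRegret E m n) :=
  Finset.measurable_sum _ fun j _ =>
    (measurable_of_countable (E.binaryStrongRegret m)).comp
      (A.measurable_runPair (A.measurable_run j))

end DuelingAlg

lemma DuelingProblem.IsExperiment.integrable_runRegret {K T M : ℕ} {E : DuelingProblem K T M}
    {St Ω Sd : Type*} [MeasurableSpace Ω] [MeasurableSpace St] [MeasurableSpace Sd]
    {μ : Measure Ω} {X : ℕ → Fin K → Fin K → Ω → Bool} {ξ : ℕ → Ω → Sd} {A : DuelingAlg K St Sd}
    (h : E.IsExperiment μ X ξ) (m : Fin M) (n : ℕ) (θ : ℕ → ℕ) :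
    Integrable (fun ω => A.runRegret E m n fun j => stepData X ξ (θ j) ω) μ := by
  have := h.isProbabilityMeasure
  have hmeas : Measurable fun ω => A.runRegret E m n fun j => stepData X ξ (θ j) ω :=
    (A.measurable_runRegret E m n).comp
      (measurable_pi_lambda _ fun j => h.measurable_stepData (θ j))
  refine .of_bound hmeas.aestronglyMeasurable n (.of_forall fun ω => ?_)
  rw [Real.norm_of_nonneg (A.runRegret_nonneg E m n _)]
  exact A.runRegret_le E m n _

namespace MDB

variable {K T M : ℕ} {St Ω Sd : Type*} [MeasurableSpace St] [MeasurableSpace Sd]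

/-- The regret of the black-box algorithm in the remainder of segment `m` after a reset at time `s`,
if no further reset intervenes. -/
def resetRegret (D : MDB K St Sd) (E : DuelingProblem K T M) (X : ℕ → Fin K → Fin K → Ω → Bool)
    (ξ : ℕ → Ω → Sd) (m : Fin M) (s : ℕ) (ω : Ω) : ℝ :=
  D.alg.runRegret E m (D.exploitCount s (E.finish m)) fun j => stepData X ξ (D.exploitTime s j) ω

/-- The regret of the black-box algorithm in segment `m` after the first reset at a time in
`{a, …, b - 1}`, and `0` if there is no such reset. -/
def exploitRegret (D : MDB K St Sd) (E : DuelingProblem K T M) (X : ℕ → Fin K → Fin K → Ω → Bool)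
    (ξ : ℕ → Ω → Sd) (m : Fin M) (a b : ℕ) (ω : Ω) : ℝ :=
  ∑ s ∈ Finset.Ico a b, {ω | D.FirstReset (fun c => outcomeVar X c ω) a s}.indicator
    (D.resetRegret E X ξ m s) ω

/-- A pointwise upper bound on the regret in segment `m`: the whole segment is lost if the detection
fails; otherwise the regret comes from the delay, the exploration, and the black-box algorithm. -/
def regretBound (D : MDB K St Sd) (E : DuelingProblem K T M) (X : ℕ → Fin K → Fin K → Ω → Bool)
    (ξ : ℕ → Ω → Sd) (m : Fin M) (ω : Ω) : ℝ :=
  {ω | D.Fails E m fun c => outcomeVar X c ω}.indicator (fun _ => ((E.segment m).card : ℝ)) ω +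
    (D.halfL + 2 * (E.segment m).card * D.explorationRate) +
      D.exploitRegret E X ξ m (E.start m - 1) (E.start m + D.halfL) ω

variable {D : MDB K St Sd} {E : DuelingProblem K T M} {X : ℕ → Fin K → Fin K → Ω → Bool}
  {ξ : ℕ → Ω → Sd} {m : Fin M} {a b s : ℕ}

lemma resetRegret_nonneg (ω : Ω) : 0 ≤ D.resetRegret E X ξ m s ω := D.alg.runRegret_nonneg E m _ _

lemma exploitRegret_nonneg (ω : Ω) : 0 ≤ D.exploitRegret E X ξ m a b ω :=
  Finset.sum_nonneg fun _ _ => Set.indicator_nonneg (fun _ _ => resetRegret_nonneg _) _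

lemma resetRegret_le_exploitRegret (hs : s ∈ Finset.Ico a b) {ω : Ω}
    (h : D.FirstReset (fun c => outcomeVar X c ω) a s) :
    D.resetRegret E X ξ m s ω ≤ D.exploitRegret E X ξ m a b ω :=
  (Set.indicator_of_mem (by exact h) _).symm.trans_le <| Finset.single_le_sum
    (f := fun s => {ω | D.FirstReset (fun c => outcomeVar X c ω) a s}.indicator
      (D.resetRegret E X ξ m s) ω)
    (fun _ _ => Set.indicator_nonneg (fun _ _ => resetRegret_nonneg _) _) hs

lemma dependsOn_fails (h : E.start m + D.halfL ≤ T + 1) :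
    DependsOn (fun x => D.Fails E m x) (timeBlock K 1 (T + 1)) := by
  refine dependsOn_or ((dependsOn_noReset _ _).mono (timeBlock_mono le_rfl h))
    (dependsOn_exists fun s => dependsOn_and_left fun hs => ?_)
  have hsT : s + 1 ≤ T + 1 := (Finset.mem_Ico.1 hs).2.trans_le h
  exact dependsOn_and ((dependsOn_firstReset _ s).mono (timeBlock_mono le_rfl hsT))
    ((dependsOn_alarm s.lt_succ_self).mono (timeBlock_mono (by omega) (E.finish_le m)))

section Experiment

variable [MeasurableSpace Ω] {μ : Measure Ω}

lemma integral_regretAlone_nonneg :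
    0 ≤ ∫ ω, D.alg.regretAlone E (fun t i j => X t i j ω) (fun t => ξ t ω) m ∂μ :=
  integral_nonneg fun _ => Finset.sum_nonneg fun _ _ => E.binaryStrongRegret_nonneg m _

variable (h : E.IsExperiment μ X ξ)
include h

lemma integral_resetRegret_le (hs : E.start m ≤ s + 1) :
    ∫ ω, D.resetRegret E X ξ m s ω ∂μ ≤
      ∫ ω, D.alg.regretAlone E (fun t i j => X t i j ω) (fun t => ξ t ω) m ∂μ := by
  have hcount := D.exploitCount_le s (E.finish m)
  have hcard : D.exploitCount s (E.finish m) ≤ E.finish m - E.start m := by omega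
  have hlaw := h.identDistrib_of_dependsOn (m := m) (θ := D.exploitTime s)
    (θ' := fun j => E.start m + j) (D.alg.measurable_runRegret E m (D.exploitCount s (E.finish m)))
    (D.alg.dependsOn_runRegret E m _) (injOn_exploitTime s _)
    (add_right_injective (E.start m)).injOn
    (fun j hj => E.mem_segment.2 ⟨hs.trans (lt_exploitTime s j), exploitTime_lt hj⟩)
    (fun j hj => E.mem_segment.2 ⟨Nat.le_add_right _ _, Nat.add_lt_of_lt_sub' (hj.trans_le hcard)⟩)
  simp only [DuelingAlg.regretAlone_eq_runRegret]
  refine hlaw.integral_eq.trans_le (integral_mono (h.integrable_runRegret m _ _)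
    (h.integrable_runRegret m _ _) fun ω => ?_)
  exact D.alg.runRegret_mono E m _ (hcard.trans_eq (E.card_segment m).symm)

lemma measurableSet_firstReset :
    MeasurableSet {ω | D.FirstReset (fun c => outcomeVar X c ω) a s} :=
  measurableSet_of_dependsOn (fun _ => h.measurable_outcome _ _ _) (finite_timeBlock _ _ _)
    (dependsOn_firstReset a s)

lemma integrable_indicator_resetRegret :
    Integrable ({ω | D.FirstReset (fun c => outcomeVar X c ω) a s}.indicator
      (D.resetRegret E X ξ m s)) μ :=
  (h.integrable_runRegret m _ _).indicator (measurableSet_firstReset h)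

lemma integrable_exploitRegret : Integrable (D.exploitRegret E X ξ m a b) μ :=
  integrable_finsetSum _ fun _ _ => integrable_indicator_resetRegret h

/- The reset at time `s` is decided before the black-box algorithm sees any of its data. -/
lemma integral_indicator_resetRegret (hs : s ≤ T) :
    ∫ ω, {ω | D.FirstReset (fun c => outcomeVar X c ω) a s}.indicator
        (D.resetRegret E X ξ m s) ω ∂μ =
      outcomeProb μ (outcomeVar X) (fun x => D.FirstReset x a s) *
        ∫ ω, D.resetRegret E X ξ m s ω ∂μ := by
  rw [integral_indicator (measurableSet_firstReset h)]
  refine setIntegral_eq_mul_of_indepFun (measurableSet_firstReset h)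
    (h.integrable_runRegret m _ _).aemeasurable ?_
  exact h.indepFun_outcomes_of_dependsOn (dependsOn_firstReset a s) (by omega) (by omega)
    (D.alg.measurable_runRegret E m _) (D.alg.dependsOn_runRegret E m _)
    fun j hj => ⟨lt_exploitTime s j, (exploitTime_lt hj).trans_le (E.finish_le m)⟩

lemma integral_exploitRegret_le (ha : E.start m ≤ a + 1) (hb : b ≤ T + 1) :
    ∫ ω, D.exploitRegret E X ξ m a b ω ∂μ ≤
      ∫ ω, D.alg.regretAlone E (fun t i j => X t i j ω) (fun t => ξ t ω) m ∂μ := by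
  have := h.isProbabilityMeasure
  set R := ∫ ω, D.alg.regretAlone E (fun t i j => X t i j ω) (fun t => ξ t ω) m ∂μ
  unfold exploitRegret
  rw [integral_finsetSum _ fun _ _ => integrable_indicator_resetRegret h]
  calc ∑ s ∈ Finset.Ico a b, ∫ ω, {ω | D.FirstReset (fun c => outcomeVar X c ω) a s}.indicator
        (D.resetRegret E X ξ m s) ω ∂μ
      ≤ ∑ s ∈ Finset.Ico a b, outcomeProb μ (outcomeVar X) (fun x => D.FirstReset x a s) * R := by
        refine Finset.sum_le_sum fun s hs => ?_
        rw [Finset.mem_Ico] at hs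
        rw [integral_indicator_resetRegret h (by omega)]
        exact mul_le_mul_of_nonneg_left (integral_resetRegret_le h (by omega)) outcomeProb_nonneg
    _ = outcomeProb μ (outcomeVar X) (fun x => ∃ s ∈ Finset.Ico a b, D.FirstReset x a s) * R := by
        rw [← Finset.sum_mul, outcomeProb_exists_eq (X := outcomeVar X)
          (fun _ => h.measurable_outcome _ _ _) _ (fun _ _ => finite_timeBlock _ _ _)
          fun s _ => dependsOn_firstReset a s]
        exact fun x s hs s' hs' =>
          FirstReset.unique (Finset.mem_Ico.1 hs).1 (Finset.mem_Ico.1 hs').1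
    _ ≤ R := mul_le_of_le_one_left integral_regretAlone_nonneg outcomeProb_le_one

end Experiment

namespace DetectionBounds

variable [MeasurableSpace Ω] {μ : Measure Ω} {p q : ℝ}
  (h : D.DetectionBounds E μ (outcomeVar X) p q)
include h

lemma start_add_halfL_le (m : Fin M) : E.start m + D.halfL ≤ E.finish m := by
  have := h.length m
  have := h.L_eq
  omega

lemma measurableSet_fails (m : Fin M) :
    MeasurableSet {ω | D.Fails E m fun c => outcomeVar X c ω} :=
  measurableSet_of_dependsOn h.measurable (finite_timeBlock _ _ _)
    (dependsOn_fails ((h.start_add_halfL_le m).trans (E.finish_le m)))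

lemma segment_regret_le_regretBound (hd : K * (K - 1) / 2 ≤ D.period) (m : Fin M) (ω : Ω) :
    ∑ t ∈ E.segment m, E.binaryStrongRegret m
        (D.played (fun t i j => X t i j ω) (fun t => ξ t ω) 1 t) ≤
      D.regretBound E X ξ m ω := by
  have hexploit : 0 ≤ D.exploitRegret E X ξ m (E.start m - 1) (E.start m + D.halfL) ω :=
    exploitRegret_nonneg ω
  have hexplore := D.explorationRate_nonneg
  rw [regretBound]
  by_cases hfail : D.Fails E m fun c => outcomeVar X c ω
  · rw [Set.indicator_of_mem (by exact hfail)]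
    refine (E.sum_binaryStrongRegret_le_card m _ _).trans ?_
    rw [add_assoc]
    exact le_add_of_nonneg_right (by positivity)
  · rw [Set.indicator_of_notMem (by exact hfail), zero_add]
    obtain ⟨hreset, hquiet⟩ := not_or.1 hfail
    obtain ⟨s, hs, hfirst⟩ := exists_firstReset_iff.2 hreset
    have hlen := h.length m
    have hstart := h.start_add_halfL_le m
    have hL := h.L_eq
    have hperiod := h.period_le_halfL
    have hsIco := Finset.mem_Ico.1 hs
    refine (segment_regret_le_of_reset (x := fun t i j => X t i j ω) (u := fun t => ξ t ω)
      (s := s) hd h.period_pos h.w_pos m (by rw [E.card_segment]; omega) hfirst.1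
      (by omega) (by omega) (by omega) fun hal => hquiet ⟨s, hs, hfirst, hal⟩).trans ?_
    exact add_le_add le_rfl (resetRegret_le_exploitRegret hs hfirst)

lemma integrable_regretBound (hE : E.IsExperiment μ X ξ) (m : Fin M) :
    Integrable (D.regretBound E X ξ m) μ := by
  have := h.isProbabilityMeasure
  exact (((integrable_const _).indicator (h.measurableSet_fails m)).add (integrable_const _)).add
    (integrable_exploitRegret hE)

lemma integral_regretBound_le (hE : E.IsExperiment μ X ξ) (m : Fin M) :
    ∫ ω, D.regretBound E X ξ m ω ∂μ ≤
      D.halfL + (E.segment m).card * (2 * (D.explorationRate + p + q)) +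
        ∫ ω, D.alg.regretAlone E (fun t i j => X t i j ω) (fun t => ξ t ω) m ∂μ := by
  have := h.isProbabilityMeasure
  have hmeas := h.measurableSet_fails m
  have hint : Integrable ({ω | D.Fails E m fun c => outcomeVar X c ω}.indicator
      fun _ => ((E.segment m).card : ℝ)) μ := (integrable_const _).indicator hmeas
  have hfail := mul_le_mul_of_nonneg_right (h.prob_fails_le_two_mul m)
    (Nat.cast_nonneg (α := ℝ) (E.segment m).card)
  have hexploit := integral_exploitRegret_le (D := D) hE (m := m) (a := E.start m - 1) (by omega)
    ((h.start_add_halfL_le m).trans (E.finish_le m))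
  have hsplit : ∫ ω, D.regretBound E X ξ m ω ∂μ =
      outcomeProb μ (outcomeVar X) (D.Fails E m) * (E.segment m).card +
        (D.halfL + 2 * (E.segment m).card * D.explorationRate) +
          ∫ ω, D.exploitRegret E X ξ m (E.start m - 1) (E.start m + D.halfL) ω ∂μ := by
    unfold regretBound
    rw [integral_add (f := fun ω => _ + _) (hint.add (integrable_const _))
        (integrable_exploitRegret hE), integral_add hint (integrable_const _),
      integral_indicator_const _ hmeas, integral_const, probReal_univ, one_smul, smul_eq_mul,
      outcomeProb]
  linarith

end DetectionBounds

end MDB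

lemma DuelingProblem.sum_card_segment {K T M : ℕ} (E : DuelingProblem K T M) :
    ∑ m, ((E.segment m).card : ℝ) = T := by
  have hcard m : ((E.segment m).card : ℝ) = (E.cp m.succ : ℝ) - E.cp m.castSucc := by
    rw [E.card_segment, Nat.cast_sub (E.start_lt_finish m).le]
    rfl
  have hsucc := Fin.sum_univ_succ fun i => (E.cp i : ℝ)
  have hcastSucc := Fin.sum_univ_castSucc fun i => (E.cp i : ℝ)
  rw [E.cp_zero] at hsucc
  rw [E.cp_last] at hcastSucc
  simp_rw [hcard, Finset.sum_sub_distrib]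
  push_cast at hsucc hcastSucc
  linarith

namespace MDB

variable {K T M : ℕ} {St Ω Sd : Type*} [MeasurableSpace Ω] [MeasurableSpace St]
  [MeasurableSpace Sd] {D : MDB K St Sd} {E : DuelingProblem K T M} {μ : Measure Ω}
  {X : ℕ → Fin K → Fin K → Ω → Bool} {ξ : ℕ → Ω → Sd} {p q : ℝ}

lemma DetectionBounds.integral_regret_le (h : D.DetectionBounds E μ (outcomeVar X) p q)
    (hE : E.IsExperiment μ X ξ) (hd : K * (K - 1) / 2 ≤ D.period) :
    ∫ ω, D.regret E (fun t i j => X t i j ω) (fun t => ξ t ω) ∂μ ≤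
      M * D.L / 2 + 2 * T * (D.explorationRate + p + q) +
        ∑ m, ∫ ω, D.alg.regretAlone E (fun t i j => X t i j ω) (fun t => ξ t ω) m ∂μ := by
  calc ∫ ω, D.regret E (fun t i j => X t i j ω) (fun t => ξ t ω) ∂μ
      ≤ ∫ ω, ∑ m, D.regretBound E X ξ m ω ∂μ :=
        integral_mono_of_nonneg
          (.of_forall fun _ => Finset.sum_nonneg fun m _ => Finset.sum_nonneg fun _ _ =>
            E.binaryStrongRegret_nonneg m _)
          (integrable_finsetSum _ fun m _ => h.integrable_regretBound hE m)
          (.of_forall fun ω => Finset.sum_le_sum fun m _ =>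
            h.segment_regret_le_regretBound hd m ω)
    _ = ∑ m, ∫ ω, D.regretBound E X ξ m ω ∂μ :=
        integral_finsetSum _ fun m _ => h.integrable_regretBound hE m
    _ ≤ ∑ m, (D.halfL + (E.segment m).card * (2 * (D.explorationRate + p + q)) +
          ∫ ω, D.alg.regretAlone E (fun t i j => X t i j ω) (fun t => ξ t ω) m ∂μ) :=
        Finset.sum_le_sum fun m _ => h.integral_regretBound_le hE m
    _ = _ := by
        rw [Finset.sum_add_distrib, Finset.sum_add_distrib, ← Finset.sum_mul, E.sum_card_segment,
          Finset.sum_const, Finset.card_univ, Fintype.card_fin, nsmul_eq_mul, h.L_eq]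
        push_cast
        ring

end MDB

/-! ### The parameters of the algorithm -/

lemma cast_mul_sub_one_div_two (K : ℕ) : ((K * (K - 1) / 2 : ℕ) : ℝ) = K * ((K : ℝ) - 1) / 2 := by
  rw [← Nat.choose_two_right, Nat.cast_choose_two]

namespace MDB

variable {K : ℕ} {St Sd : Type*} [MeasurableSpace St] [MeasurableSpace Sd] {D : MDB K St Sd}

lemma pairs_le_period (hγ : D.γ ∈ Set.Ioc (0 : ℝ) 1) : K * (K - 1) / 2 ≤ D.period := by
  obtain ⟨hγ0, hγ1⟩ := hγ
  have hnonneg : 0 ≤ (K : ℝ) * ((K : ℝ) - 1) / 2 :=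
    cast_mul_sub_one_div_two K ▸ Nat.cast_nonneg _
  refine Nat.le_floor ?_
  rw [cast_mul_sub_one_div_two, ← div_div]
  exact le_div_self hnonneg hγ0 hγ1

section ExplorationRate

variable (hγ : 0 < D.γ) (hK : D.γ ≤ ((K : ℝ) - 1) / 2)
include hγ hK

lemma arms_le_ratio : (K : ℝ) ≤ (K : ℝ) * ((K : ℝ) - 1) / (2 * D.γ) := by
  rw [le_div_iff₀ (by linarith)]
  exact mul_le_mul_of_nonneg_left (by linarith) (Nat.cast_nonneg K)

lemma period_pos : 0 < D.period :=
  Nat.floor_pos.2 (le_trans (by linarith) (arms_le_ratio hγ hK))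

lemma explorationRate_le : D.explorationRate ≤ D.γ * K / ((K : ℝ) - 1) := by
  have hd : (0 : ℝ) < D.period := by exact_mod_cast period_pos hγ hK
  have hratio := arms_le_ratio hγ hK
  have hfloor : (K : ℝ) * ((K : ℝ) - 1) / (2 * D.γ) < D.period + 1 := Nat.lt_floor_add_one _
  rw [explorationRate, cast_mul_sub_one_div_two, div_le_div_iff₀ hd (by linarith)]
  set r := (K : ℝ) * ((K : ℝ) - 1) / (2 * D.γ) with hr
  have hpairs : (K : ℝ) * ((K : ℝ) - 1) / 2 = D.γ * r := by
    rw [hr]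
    field_simp
  have hmul : r * ((K : ℝ) - 1) ≤ K * D.period := by
    have := mul_le_mul_of_nonneg_left hfloor.le (Nat.cast_nonneg (α := ℝ) K)
    linarith
  calc (K : ℝ) * ((K : ℝ) - 1) / 2 * ((K : ℝ) - 1) = D.γ * (r * ((K : ℝ) - 1)) := by
        rw [hpairs, mul_assoc]
    _ ≤ D.γ * (K * D.period) := mul_le_mul_of_nonneg_left hmul hγ.le
    _ = D.γ * K * D.period := (mul_assoc _ _ _).symm

end ExplorationRate

end MDB

/-! ### Detection times -/

lemma measureReal_eq_cond_mul {Ω : Type*} [MeasurableSpace Ω] {μ : Measure Ω} [IsFiniteMeasure μ]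
    {s t : Set Ω} (hs : MeasurableSet s) (hts : t ⊆ s) :
    μ.real t = (μ[|s]).real t * μ.real s := by
  rw [Measure.real, Measure.real, Measure.real, ← ENNReal.toReal_mul, cond_mul_eq_inter hs,
    Set.inter_eq_self_of_subset_right hts]

namespace MDB

variable {K T M : ℕ} {St Ω Sd : Type*} [MeasurableSpace St] [MeasurableSpace Sd]
  {D : MDB K St Sd} {E : DuelingProblem K T M}
  {X : ℕ → Fin K → Fin K → Ω → Bool} {ξ : ℕ → Ω → Sd}
  (hd : K * (K - 1) / 2 ≤ D.period) (hw : 0 < D.w) (m : Fin M)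
include hd hw

lemma measureReal_firstDetection_lt [MeasurableSpace Ω] {μ : Measure Ω} {v : ℕ} (hv : v ≤ T + 1) :
    μ.real {ω | D.firstDetection T (fun t i j => X t i j ω) (fun t => ξ t ω) (E.start m) < v} =
      outcomeProb μ (outcomeVar X) (fun x => D.Alarm x (E.start m - 1) (E.start m) v) :=
  congrArg μ.real <| Set.ext fun _ => firstDetection_lt_iff hd hw _ _ (E.one_le_start m) hv

lemma setOf_le_firstDetection {v : ℕ} (hv : v ≤ T + 1) :
    {ω | v ≤ D.firstDetection T (fun t i j => X t i j ω) (fun t => ξ t ω) (E.start m)} =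
      {ω | ¬ D.Alarm (fun c => outcomeVar X c ω) (E.start m - 1) (E.start m) v} :=
  Set.ext fun _ => not_lt.symm.trans
    (firstDetection_lt_iff hd hw _ _ (E.one_le_start m) hv).not

lemma outcomeProb_not_alarm_le [MeasurableSpace Ω] {μ : Measure Ω} [IsProbabilityMeasure μ]
    (hX : ∀ c, Measurable (outcomeVar X c))
    {v v' : ℕ} {q : ℝ} (hvv' : v ≤ v') (hv' : v' ≤ T + 1)
    (hdelay : (μ[|{ω | v ≤ D.firstDetection T (fun t i j => X t i j ω) (fun t => ξ t ω)
      (E.start m)}]).real {ω | v' ≤ D.firstDetection T (fun t i j => X t i j ω) (fun t => ξ t ω)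
        (E.start m)} ≤ q) :
    outcomeProb μ (outcomeVar X) (fun x => ¬ D.Alarm x (E.start m - 1) (E.start m) v') ≤
      q * (1 - outcomeProb μ (outcomeVar X)
        (fun x => D.Alarm x (E.start m - 1) (E.start m) v)) := by
  have hdep := dependsOn_alarm (D := D) (v := v) (Nat.sub_one_lt_of_lt (E.one_le_start m))
  have hfin := finite_timeBlock K (E.start m) v
  rw [setOf_le_firstDetection hd hw m (hvv'.trans hv'), setOf_le_firstDetection hd hw m hv']
    at hdelay
  rw [← outcomeProb_not hX hfin hdep]
  have hquiet := measurableSet_of_dependsOn hX hfin (dependsOn_not hdep)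
  have hsub : {ω | ¬ D.Alarm (fun c => outcomeVar X c ω) (E.start m - 1) (E.start m) v'} ⊆
      {ω | ¬ D.Alarm (fun c => outcomeVar X c ω) (E.start m - 1) (E.start m) v} :=
    fun _ hω hal => hω (Alarm.mono hal le_rfl hvv')
  exact (measureReal_eq_cond_mul hquiet hsub).trans_le
    (mul_le_mul_of_nonneg_right hdelay measureReal_nonneg)

end MDB

end

theorem theorem3_general {K T M : ℕ} (E : DuelingProblem K T M)
    {St Sd : Type*} [MeasurableSpace St] [MeasurableSpace Sd] (D : MDB K St Sd)
    (hw_pos : 0 < D.w) (hw_even : Even D.w) (hγ : D.γ ∈ Set.Ioc (0 : ℝ) 1)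
    {Ω : Type*} [MeasurableSpace Ω] (μ : Measure Ω)
    (X : ℕ → Fin K → Fin K → Ω → Bool) (ξ : ℕ → Ω → Sd) (hX : E.IsExperiment μ X ξ)
    (h1 : ∀ m, 2 * D.L ≤ (E.segment m).card) (hK : D.γ ≤ ((K : ℝ) - 1) / 2)
    (τ : Fin M → Ω → ℕ∞)
    (hτ : ∀ m ω, τ m ω =
      D.firstDetection T (fun t i j => X t i j ω) (fun t => ξ t ω) (E.cp m.castSucc))
    (p q : ℝ) (hp : p ∈ Set.Icc (0 : ℝ) 1) (hq : q ∈ Set.Icc (0 : ℝ) 1)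
    (hfalse : ∀ m, μ.real {ω | τ m ω < (E.cp m.succ : ℕ∞)} ≤ p)
    (hdelay : ∀ m : Fin M, (m : ℕ) + 1 < M →
      (μ[|{ω | (E.cp m.succ : ℕ∞) ≤ τ m ω}]).real
        {ω | ((E.cp m.succ + D.L / 2 : ℕ) : ℕ∞) ≤ τ m ω} ≤ q) :
    ∫ ω, D.regret E (fun t i j => X t i j ω) (fun t => ξ t ω) ∂μ ≤
      (M : ℝ) * (D.L : ℝ) / 2 + 2 * (T : ℝ) * (D.γ * (K : ℝ) / ((K : ℝ) - 1) + p + q) +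
        ∑ m, ∫ ω, D.alg.regretAlone E (fun t i j => X t i j ω) (fun t => ξ t ω) m ∂μ := by
  obtain rfl := funext₂ hτ
  have := hX.isProbabilityMeasure
  have hd := MDB.pairs_le_period hγ
  have hmeas c : Measurable (outcomeVar X c) := hX.measurable_outcome _ _ _
  have hL : D.L = 2 * D.halfL := MDB.L_eq_two_mul_halfL hw_even
  have hlen m : E.start m + 2 * D.L ≤ E.finish m :=
    Nat.add_le_of_le_sub' (E.start_lt_finish m).le ((h1 m).trans_eq (E.card_segment m))
  have hbounds : D.DetectionBounds E μ (outcomeVar X) p q :=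
    { measurable := hmeas, indep := hX.iIndepFun_outcomeVar
      bernoulli := fun m t ht a => hX.bernoulli m t ht a.1 a.2
      period_pos := MDB.period_pos hγ.1 hK, w_pos := hw_pos, even_w := hw_even, length := hlen
      p_nonneg := hp.1, p_le_one := hp.2, q_nonneg := hq.1, q_le_one := hq.2
      false_alarm := fun m =>
        (MDB.measureReal_firstDetection_lt hd hw_pos m (E.finish_le m)).symm.trans_le (hfalse m)
      delay := fun m hm => by
        have hdelay := hdelay m hm
        have hT := hlen ⟨m + 1, hm⟩ |>.trans (E.finish_le _)
        rw [E.start_succ, hL] at hT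
        rw [hL, Nat.mul_div_cancel_left _ two_pos] at hdelay
        exact MDB.outcomeProb_not_alarm_le hd hw_pos m hmeas (by omega) (by omega) hdelay }
  refine (hbounds.integral_regret_le hX hd).trans ?_
  gcongr
  exact MDB.explorationRate_le hγ.1 hK

theorem theorem3 {K T M : ℕ} (E : DuelingProblem K T M)
    {St Sd : Type*} [MeasurableSpace St] [MeasurableSpace Sd] (D : MDB K St Sd)
    (hw_pos : 0 < D.w) (hw_even : Even D.w) (hb : 0 < D.b) (hγ : D.γ ∈ Set.Ioc (0 : ℝ) 1)
    {Ω : Type*} [MeasurableSpace Ω] (μ : Measure Ω) [IsProbabilityMeasure μ]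
    (X : ℕ → Fin K → Fin K → Ω → Bool) (ξ : ℕ → Ω → Sd) (hX : E.IsExperiment μ X ξ)
    -- Assumption 1: every segment has length at least `2 L`
    (h1 : ∀ m, 2 * D.L ≤ (E.segment m).card)
    -- Assumption 2: the minimal segmental change is at least `2 b / w + c` for some `c > 0`
    (h2 : ∃ c : ℝ, 0 < c ∧ ∀ (m : Fin M) (h : (m : ℕ) + 1 < M),
      2 * D.b / D.w + c ≤ E.change m h)
    -- Assumption 3: the range of the exploration rate
    (h3 : D.γ ∈ Set.Icc ((K : ℝ) * ((K : ℝ) - 1) / (2 * (T : ℝ))) (((K : ℝ) - 1) / 2))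
    -- `τ m` is the first detection time of MDB initialized at the first time step of segment `m`
    (τ : Fin M → Ω → ℕ∞)
    (hτ : ∀ m ω, τ m ω =
      D.firstDetection T (fun t i j => X t i j ω) (fun t => ξ t ω) (E.cp m.castSucc))
    (p q : ℝ) (hp : p ∈ Set.Icc (0 : ℝ) 1) (hq : q ∈ Set.Icc (0 : ℝ) 1)
    -- false alarms
    (hfalse : ∀ m, μ.real {ω | τ m ω < (E.cp m.succ : ℕ∞)} ≤ p)
    -- large delays
    (hdelay : ∀ m : Fin M, (m : ℕ) + 1 < M →
      (μ[|{ω | (E.cp m.succ : ℕ∞) ≤ τ m ω}]).real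
        {ω | ((E.cp m.succ + D.L / 2 : ℕ) : ℕ∞) ≤ τ m ω} ≤ q) :
    ∫ ω, D.regret E (fun t i j => X t i j ω) (fun t => ξ t ω) ∂μ ≤
      (M : ℝ) * (D.L : ℝ) / 2 + 2 * (T : ℝ) * (D.γ * (K : ℝ) / ((K : ℝ) - 1) + p + q) +
        ∑ m, ∫ ω, D.alg.regretAlone E (fun t i j => X t i j ω) (fun t => ξ t ω) m ∂μ :=
  theorem3_general E D hw_pos hw_even hγ μ X ξ hX h1 h3.2 τ hτ p q hp hq hfalse hdelay
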